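/- **Setting.** Let $f:\mathbb R\to\mathbb R$ be a flux function and let $u_0\in L^\infty(\mathbb T)$, where $\mathbb T$ is the unit torus. The torus is partitioned into $n$ cells $(x_j,x_{j+1})$ (indices cyclic) of sizes $\Delta x_j$, with $\Delta x_{\min}=\min_j\Delta x_j$. The cells are grouped into $M\ge 2$ contiguous submeshes of at least two cells each. Let $\hat F$ be a numerical flux for $f$: $\hat F(u,u)=f(u)$, $\hat F$ is nondecreasing in the first and nonincreasing in the second argument, and it is Lipschitz in both arguments. Let $U_j^0$ be the average of $u_0$ over cell $j$, let $R=[\operatorname{ess\,inf}u_0,\operatorname{ess\,sup}u_0]$, and for $\xi\in R$ let $K_1(\xi)$, $K_2(\xi)$ be the smallest Lipschitz constants on $R$ of $\hat F(\cdot,\xi)$ and $\hat F(\xi,\cdot)$. Put $$C_j=\frac{\hat F(U_{j-1},U_{j+1})-\hat F(U_j,U_{j+1})}{\Delta x_j(U_j-U_{j-1})},\qquad D_j=\frac{\hat F(U_{j-1},U_j)-\hat F(U_{j-1},U_{j+1})}{\Delta x_j(U_{j+1}-U_j)}$$ (a quotient $0/0$ is read as $0$). **Event traces.** An event trace on $[0,T]$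 is a finite set of triples (cell $j$, time, cell average) in which no cell has two values at the same time, every cell starts at time $0$ from $U_j^0$ and has an event at time $T$, and all times lie in $[0,T]$. Let $\mathcal T_j$ be the set of times of cell $j$, $\lfloor t\rfloor_j=\max\{s\in\mathcal T_j:s\le t\}$, $\lceil t\rceil_j=\min\{s\in\mathcal T_j:s>t\}$, and let $U_j(t)$ be the value of cell $j$ at time $\lfloor t\rfloor_j$; $C_j(t)$, $D_j(t)$ are formed from the values $U_i(t)$. The trace * is *locally ordered* if for each $j$ there are times $0=s^0<\dots<s^m=T$ in $\mathcal T_j\cap\mathcal T_{j+1}$ (synchronization times) such that for each $\mu<m$ one of $\mathcal T_j$, $\mathcal T_{j+1}$ does not meet $(s^\mu,s^{\mu+1})$; * satisfies the *CFL condition* if for all $j$, all such consecutive $s^\mu,s^{\mu+1}$ and all $t\in(s^\mu,s^{\mu+1})$, $\;1+(\lceil t\rceil_{j+1}-s^\mu)C_{j+1}(t)-(\lceil t\rceil_j-s^\mu)D_j(t)\ge 0$; * satisfies the *forward Euler update rule* if $U_j(b)=U_j(a)+\frac1{\Delta x_j}\int_a^b\big[\hat F(U_{j-1}(\sigma),U_j(a))-\hat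 F(U_j(a),U_{j+1}(\sigma))\big]d\sigma$ for any consecutive $a<b$ in $\mathcal T_j$; * is *TVD* if $\sum_j|U_{j+1}(t)-U_j(t)|\le\sum_j|U_{j+1}(0)-U_j(0)|$ for all $t\in[0,T]$. **Algorithm.** Times are integer multiples of $\Delta t_{\min}>0$; the final time is $t_{\rm end}=N\Delta t_{\min}$, $N\in\mathbb N$. A submesh $S$ stores its last update time $\lfloor t\rfloor$, its planned next update time $\lceil t\rceil$, its cell averages $u$, and for each of its two sides: the neighbor's last known update time $\lfloor t\rfloor^{nb}$ and adjacent value $u^{nb}$; the last time $t_{\rm sync}$ at which both updated; the integral $\Sigma\hat F$ of the flux through that interface since the last update of $S$; and bounds $K^{\rm ext},K^{\rm int}$. On the left side $K^{\rm ext}$ is the running maximum since $t_{\rm sync}$ of $-C$, and $K^{\rm int}$ the running maximum since $\lfloor t\rfloor$ of $D$, both at the leftmost cell; on the right side $D$ and $-C$ at the rightmost cell. * $\texttt{next}_s(S)$, for a side $s$, is the largest multiple $t\le t_{\rm end}$ of $\Delta t_{\min}$ with $(t-t_{\rm sync})K^{\rm ext}\le\frac12$ and $(t-\lfloor t\rfloor)K^{\rm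 int}\le\frac12$. $\texttt{next}(S)$ is the minimum of $\texttt{next}_s(S)$ over both sides and of the largest multiple $t\le t_{\rm end}$ of $\Delta t_{\min}$ with $(t-\lfloor t\rfloor)\max(-C_j,D_j)\le\frac12$ at all cells $j$ of $S$ other than its two boundary cells. * *Update of $S$ at time $\tau$.* Do nothing if $\tau\ne\lceil t\rceil$ and the update is not forced, or if $\tau=\lfloor t\rfloor$. Otherwise advance all cells of $S$ from $\lfloor t\rfloor$ to $\tau$ by the forward Euler rule using the stored neighbor data and record the new averages in the event trace; set $\lfloor t\rfloor=\tau$, $\Sigma\hat F=0$, and $t_{\rm sync}=\tau$ on the sides with $\lfloor t\rfloor^{nb}=\tau$; update $K^{\rm ext},K^{\rm int}$; and set $\lceil t\rceil=\texttt{next}(S)$. On each side $s$, schedule at time $\tau$ a push flux to the neighbor, carrying the adjacent value of $S$; it is forcing if $\lfloor t\rfloor^{nb}>t_{\rm sync}$ or $\texttt{next}_s(S)\le\tau$, and in that case set $t_{\rm sync}=\tau$ on that side. If $\lceil t\rceil>\tau$, schedule an unforced update of $S$ at $\lceil t\rceil$. * *Push flux to $S$ on side $s$ at time $\tau$.* Integrate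 $\Sigma\hat F$ up to $\tau$; replace $u^{nb}$ by the received value and $\lfloor t\rfloor^{nb}$ by $\tau$; set $t_{\rm sync}=\tau$ if $\lfloor t\rfloor=\tau$; update $K^{\rm ext},K^{\rm int}$ on that side; set $\lceil t\rceil=\texttt{next}(S)$. If the push is forcing or $\lceil t\rceil\le\tau$, immediately execute a forced update of $S$. Then, if $\lceil t\rceil>\tau$, schedule an unforced update of $S$ at $\lceil t\rceil$. Initially all stored times other than $\lceil t\rceil$ are $0$, all values are the $U_j^0$, all $\Sigma\hat F$ are $0$, the bounds $K^{\rm ext},K^{\rm int}$ have their current values, and an unforced update of each submesh is scheduled at $\lceil t\rceil=\texttt{next}(S)$; the event trace consists of the initial averages at time $0$. As long as events are pending, one of those with the smallest timestamp is removed and executed, ties being broken arbitrarily. **Theorem.** Suppose $$0<\Delta t_{\min}<\inf_{\xi\in R}\frac{\Delta x_{\min}}{2\max(K_1(\xi),K_2(\xi))}$$ (a quotient with denominator $0$ is $+\infty$). Then, however ties are broken, the simulation stops after finitely many events, and the trace it has then generated is an event trace on $[0,t_{\rm end}]$ that is locally ordered and satisfies the CFL condition and the forward Euler update rule. Consequently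 it is a TVD approximation of $\partial_tu+\partial_xf(u)=0$, $u(\cdot,0)=u_0$. -/

import Mathlib

open MeasureTheory
open scoped NNReal ENNReal

noncomputable section

namespace LocalTimestepping

/-! ### Meshes, numerical fluxes, event traces -/

/-- A partition of the unit torus into `n` cells `(x j, x (j+1))`, together with a grouping of the
cells into `M` contiguous submeshes of at least two cells each: submesh `k` consists of the cells
`start k ≤ j < start (k+1)`. The node `x 0` may be any point of the torus. -/
structure Mesh (n M : ℕ) where
  x : Fin (n + 1) → ℝ
  x_strictMono : StrictMono x
  x_last : x (Fin.last n) = x 0 + 1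
  start : Fin (M + 1) → ℕ
  start_zero : start 0 = 0
  start_last : start (Fin.last M) = n
  two_cells : ∀ k : Fin M, start k.castSucc + 2 ≤ start k.succ

namespace Mesh

variable {n M : ℕ} (m : Mesh n M)

lemma start_mono : Monotone m.start :=
  Fin.monotone_iff_le_succ.2 fun k => by have := m.two_cells k; omega

lemma start_succ_le (k : Fin M) : m.start k.succ ≤ n := by
  have := m.start_mono (Fin.le_last k.succ)
  rwa [m.start_last] at this

/-- The size of cell `j`. -/
def dx (j : Fin n) : ℝ := m.x j.succ - m.x j.castSucc

/-- The smallest element size. -/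
def minDx : ℝ := ⨅ j, m.dx j

/-- The cells of submesh `k`. -/
def cells (k : Fin M) : Set (Fin n) := {j | m.start k.castSucc ≤ j ∧ (j : ℕ) < m.start k.succ}

/-- The leftmost cell of submesh `k`. -/
def first (k : Fin M) : Fin n :=
  ⟨m.start k.castSucc, by have := m.two_cells k; have := m.start_succ_le k; omega⟩

/-- The rightmost cell of submesh `k`. -/
def last (k : Fin M) : Fin n :=
  ⟨m.start k.succ - 1, by have := m.two_cells k; have := m.start_succ_le k; omega⟩

/-- The average of a function on the torus over cell `j`. -/
def cellAvg (u₀ : UnitAddCircle → ℝ) (j : Fin n) : ℝ :=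
  (1 / m.dx j) * ∫ y in (m.x j.castSucc)..(m.x j.succ), u₀ (y : UnitAddCircle)

end Mesh

/-- `F` is a numerical flux for the flux function `f`: consistent, monotone, and Lipschitz
continuous in both arguments. -/
structure IsNumericalFlux (f : ℝ → ℝ) (F : ℝ → ℝ → ℝ) : Prop where
  consistent : ∀ u, F u u = f u
  mono_left : ∀ v, Monotone fun u => F u v
  anti_right : ∀ u, Antitone fun v => F u v
  lipschitz : ∃ K : ℝ≥0, (∀ v, LipschitzWith K fun u => F u v) ∧ ∀ u, LipschitzWith K fun v => F u v

/-- The range of `u₀ ∈ L^∞`, as the interval `[ess inf u₀, ess sup u₀]`. -/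
def dataRange (u₀ : UnitAddCircle → ℝ) : Set ℝ := Set.Icc (essInf u₀ volume) (essSup u₀ volume)

/-- The smallest Lipschitz constant of `g` on the set `I` (`⊤` if there is none). -/
def lipConst (g : ℝ → ℝ) (I : Set ℝ) : ℝ≥0∞ :=
  ⨅ (K : ℝ≥0) (_ : LipschitzOnWith K g I), (K : ℝ≥0∞)

/-- The coefficient `C_j` at a cell of size `dx`, where `a`, `b`, `c` are the values on the cell to
the left, on the cell, and on the cell to the right. It only ever multiplies `b - a`, and is `0`
where `a = b`. -/
def coeffC (F : ℝ → ℝ → ℝ) (dx a b c : ℝ) : ℝ := (F a c - F b c) / (dx * (b - a))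

/-- The coefficient `D_j`; it only ever multiplies `c - b`, and is `0` where `b = c`. -/
def coeffD (F : ℝ → ℝ → ℝ) (dx a b c : ℝ) : ℝ := (F a b - F a c) / (dx * (c - b))

/-- An event trace: a set of triples (cell, time, cell average). -/
abbrev EventTrace (n : ℕ) := Set (Fin n × ℝ × ℝ)

namespace EventTrace

variable {n : ℕ} (E : EventTrace n)

/-- The timestamps of cell `j`. -/
def times (j : Fin n) : Set ℝ := {t | ∃ v, (j, t, v) ∈ E}

/-- The nearest previous timestamp `⌊t⌋_j`. -/
def prev (j : Fin n) (t : ℝ) : ℝ := sSup {s ∈ E.times j | s ≤ t}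

/-- The next timestamp `⌈t⌉_j`. -/
def next (j : Fin n) (t : ℝ) : ℝ := sInf {s ∈ E.times j | t < s}

/-- The value `U_j(t)`: the most recent average of cell `j` at time `t`. -/
def value (j : Fin n) (t : ℝ) : ℝ := Classical.epsilon fun v => (j, E.prev j t, v) ∈ E

/-- `E` is a genuine finite event trace on `[0, T]` with initial averages `U₀`: every cell starts at
time `0` from `U₀` and arrives at time `T`, and no cell has two values at the same time. -/
structure IsTraceOn (T : ℝ) (U₀ : Fin n → ℝ) : Prop where
  finite : E.Finite
  unique : ∀ j t v w, (j, t, v) ∈ E → (j, t, w) ∈ E → v = w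
  start_mem : ∀ j, (j, 0, U₀ j) ∈ E
  end_mem : ∀ j, T ∈ E.times j
  mem_Icc : ∀ j, E.times j ⊆ Set.Icc 0 T

variable [NeZero n]

/-- `s 0 < s 1 < … < s m` are synchronization times of the cells `j` and `j+1` from time `0` to time
`T`, such that between any two consecutive ones at most one of the two cells has timestamps. -/
structure IsSyncSeq (T : ℝ) (j : Fin n) (m : ℕ) (s : ℕ → ℝ) : Prop where
  zero : s 0 = 0
  last : s m = T
  lt : ∀ μ < m, s μ < s (μ + 1)
  mem : ∀ μ ≤ m, s μ ∈ E.times j ∩ E.times (j + 1)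
  ordered : ∀ μ < m, E.times j ∩ Set.Ioo (s μ) (s (μ + 1)) = ∅ ∨
    E.times (j + 1) ∩ Set.Ioo (s μ) (s (μ + 1)) = ∅

/-- Local ordering on `[0, T]`. -/
def LocallyOrdered (T : ℝ) : Prop := ∀ j, ∃ m s, E.IsSyncSeq T j m s

/-- The value of `C_j` at time `t`. -/
def C (F : ℝ → ℝ → ℝ) (dx : Fin n → ℝ) (j : Fin n) (t : ℝ) : ℝ :=
  coeffC F (dx j) (E.value (j - 1) t) (E.value j t) (E.value (j + 1) t)

/-- The value of `D_j` at time `t`. -/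
def D (F : ℝ → ℝ → ℝ) (dx : Fin n → ℝ) (j : Fin n) (t : ℝ) : ℝ :=
  coeffD F (dx j) (E.value (j - 1) t) (E.value j t) (E.value (j + 1) t)

/-- The CFL condition between consecutive synchronization times of neighboring cells. -/
def SatisfiesCFL (F : ℝ → ℝ → ℝ) (dx : Fin n → ℝ) (T : ℝ) : Prop :=
  ∀ j m s, E.IsSyncSeq T j m s → ∀ μ < m, ∀ t ∈ Set.Ioo (s μ) (s (μ + 1)),
    0 ≤ 1 + (E.next (j + 1) t - s μ) * E.C F dx (j + 1) t - (E.next j t - s μ) * E.D F dx j t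

/-- The forward Euler update rule between any two consecutive timestamps `a < b` of a cell. -/
def IsForwardEuler (F : ℝ → ℝ → ℝ) (dx : Fin n → ℝ) : Prop :=
  ∀ j, ∀ a ∈ E.times j, ∀ b ∈ E.times j, a < b → E.times j ∩ Set.Ioo a b = ∅ →
    E.value j b = E.value j a + (1 / dx j) * ∫ σ in a..b,
      (F (E.value (j - 1) σ) (E.value j a) - F (E.value j a) (E.value (j + 1) σ))

/-- The total variation of the approximation at time `t`. -/
def TV (t : ℝ) : ℝ := ∑ j, |E.value (j + 1) t - E.value j t|

/-- Total variation diminishing on `[0, T]`. -/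
def IsTVD (T : ℝ) : Prop := ∀ t ∈ Set.Icc 0 T, E.TV t ≤ E.TV 0

end EventTrace

/-! ### The discrete event simulation

All times inside the simulation are natural numbers, counting multiples of the minimum timestep. -/

/-- The two sides of a submesh. -/
inductive Side
  | left
  | right
  deriving DecidableEq

/-- The opposite side. -/
def Side.opp : Side → Side
  | .left => .right
  | .right => .left

/-- What a submesh knows about the neighbor on one of its sides. -/
structure Interface where
  /-- last known update time of the neighbor -/
  tFloor : ℕ
  /-- last time at which both the submesh and the neighbor updated -/
  tSync : ℕ
  /-- the value of the neighboring cell at `tFloor` -/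
  u : ℝ
  /-- the accumulated flux through the interface since the last update of the submesh -/
  sumF : ℝ
  /-- running bound at the interior interface of the boundary cell -/
  Kint : ℝ
  /-- running bound at the interface with the neighbor -/
  Kext : ℝ

/-- The state of a submesh. Only the values `u j` at the submesh's own cells are meaningful. -/
structure Submesh (n : ℕ) where
  tFloor : ℕ
  tCeil : ℕ
  u : Fin n → ℝ
  bdry : Side → Interface

/-- Replace the interface on side `s`. -/
def Submesh.setBdry {n : ℕ} (S : Submesh n) (s : Side) (i : Interface) : Submesh n :=
  { S with bdry := Function.update S.bdry s i }

/-- The events: update submesh `k`; push to submesh `k` the value `msg` of the neighboring cell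
beyond its side `s`. -/
inductive Event (M : ℕ)
  | update (k : Fin M) (forced : Bool)
  | pushFlux (k : Fin M) (s : Side) (msg : ℝ) (force : Bool)

/-- The state of the simulation: the submeshes, the queue of timestamped events, and the event trace
recorded so far. -/
structure Config (n M : ℕ) where
  sub : Fin M → Submesh n
  queue : Multiset (ℕ × Event M)
  trace : EventTrace n

/-- The fixed data of a simulation: mesh, numerical flux, minimum timestep, and final time `N * dt`. -/
structure Sim (n M : ℕ) extends Mesh n M where
  F : ℝ → ℝ → ℝ
  dt : ℝ
  N : ℕ

namespace Sim

variable {n M : ℕ} [NeZero n] [NeZero M] (P : Sim n M)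

/-- The final time. -/
def tEnd : ℝ := P.N * P.dt

/-- The neighboring submesh on side `s`. -/
def neigh (k : Fin M) : Side → Fin M
  | .left => k - 1
  | .right => k + 1

/-- The cell of submesh `k` adjacent to its side `s`. -/
def bdryCell (k : Fin M) : Side → Fin n
  | .left => P.first k
  | .right => P.last k

/-- The value to the left of cell `j` as seen by submesh `k` in state `S`. -/
def uLeft (k : Fin M) (S : Submesh n) (j : Fin n) : ℝ :=
  if j = P.first k then (S.bdry .left).u else S.u (j - 1)

/-- The value to the right of cell `j` as seen by submesh `k` in state `S`. -/
def uRight (k : Fin M) (S : Submesh n) (j : Fin n) : ℝ :=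
  if j = P.last k then (S.bdry .right).u else S.u (j + 1)

/-- `-C_j` as computed by submesh `k`. -/
def negC (k : Fin M) (S : Submesh n) (j : Fin n) : ℝ :=
  -coeffC P.F (P.dx j) (P.uLeft k S j) (S.u j) (P.uRight k S j)

/-- `D_j` as computed by submesh `k`. -/
def posD (k : Fin M) (S : Submesh n) (j : Fin n) : ℝ :=
  coeffD P.F (P.dx j) (P.uLeft k S j) (S.u j) (P.uRight k S j)

/-- The present value of the bound at the interface with the neighbor. -/
def extNow (k : Fin M) (S : Submesh n) : Side → ℝ
  | .left => P.negC k S (P.first k)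
  | .right => P.posD k S (P.last k)

/-- The present value of the bound at the interior interface of the boundary cell. -/
def intNow (k : Fin M) (S : Submesh n) : Side → ℝ
  | .left => P.posD k S (P.first k)
  | .right => P.negC k S (P.last k)

/-- The present numerical flux through the interface on side `s`. -/
def bdryFlux (k : Fin M) (S : Submesh n) : Side → ℝ
  | .left => P.F (S.bdry .left).u (S.u (P.first k))
  | .right => P.F (S.u (P.last k)) (S.bdry .right).u

/-- `accumulate`: integrate the flux through side `s` up to time `τ`, starting where the integral
stored in `sumF` ends. -/
def accumulate (τ : ℕ) (k : Fin M) (s : Side) (S : Submesh n) : Submesh n :=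
  let i := S.bdry s
  S.setBdry s { i with
    sumF := i.sumF + ((τ : ℝ) - max i.tFloor S.tFloor) * P.dt * P.bdryFlux k S s }

/-- `update_K_bdry`: `Kint` is the maximum of its present values since the last update of the
submesh, and `Kext` the maximum of its present values since `tSync`. -/
def updateKBdry (τ : ℕ) (k : Fin M) (s : Side) (S : Submesh n) : Submesh n :=
  let i := S.bdry s
  S.setBdry s { i with
    Kint := if S.tFloor = τ then P.intNow k S s else max i.Kint (P.intNow k S s)
    Kext := if i.tSync = τ then P.extNow k S s else max i.Kext (P.extNow k S s) }

open Classical in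
/-- `compute_t_next_bdry`: the largest time (at most the final time) allowed by the CFL conditions
at the interface with the neighbor, relative to `tSync`, and at the interior interface next to it,
relative to `S.tFloor`. -/
def computeTNextBdry (S : Submesh n) (s : Side) : ℕ :=
  let i := S.bdry s
  Nat.findGreatest (fun t => ((t : ℝ) - i.tSync) * P.dt * i.Kext ≤ 1 / 2 ∧
    ((t : ℝ) - S.tFloor) * P.dt * i.Kint ≤ 1 / 2) P.N

open Classical in
/-- The largest time (at most the final time) allowed by the CFL conditions at the inner cells. -/
def computeTNextInt (k : Fin M) (S : Submesh n) : ℕ :=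
  Nat.findGreatest (fun t => ∀ j ∈ P.cells k, j ≠ P.first k → j ≠ P.last k →
    ((t : ℝ) - S.tFloor) * P.dt * max (P.negC k S j) (P.posD k S j) ≤ 1 / 2) P.N

/-- `compute_t_next` -/
def computeTNext (k : Fin M) (S : Submesh n) : ℕ :=
  min (min (P.computeTNextBdry S .left) (P.computeTNextBdry S .right)) (P.computeTNextInt k S)

open Classical in
/-- `advance`: one forward Euler step of the submesh from `S.tFloor` to `τ`, together with the
corresponding updates of the data stored at the interfaces. -/
def advance (τ : ℕ) (k : Fin M) (S : Submesh n) : Submesh n :=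
  let S₁ := P.accumulate τ k .right (P.accumulate τ k .left S)
  let h : ℝ := ((τ : ℝ) - S.tFloor) * P.dt
  let inflow : Fin n → ℝ := fun j =>
    if j = P.first k then (S₁.bdry .left).sumF else h * P.F (S.u (j - 1)) (S.u j)
  let outflow : Fin n → ℝ := fun j =>
    if j = P.last k then (S₁.bdry .right).sumF else h * P.F (S.u j) (S.u (j + 1))
  let S₂ : Submesh n :=
    { S₁ with
      tFloor := τ
      u := fun j =>
        if j ∈ P.cells k then S.u j + (1 / P.dx j) * (inflow j - outflow j) else S.u j
      bdry := fun s =>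
        { S₁.bdry s with
          sumF := 0
          tSync := if (S₁.bdry s).tFloor = τ then τ else (S₁.bdry s).tSync } }
  P.updateKBdry τ k .right (P.updateKBdry τ k .left S₂)

open Classical in
/-- The event `update` of submesh `k`, executed at time `τ`. -/
def execUpdate (τ : ℕ) (k : Fin M) (forced : Bool) (c : Config n M) : Config n M :=
  let S := c.sub k
  if τ ≠ S.tCeil ∧ forced = false then c
  else if τ = S.tFloor then c
  else
    let S₁ := P.advance τ k S
    let S₂ : Submesh n := { S₁ with tCeil := P.computeTNext k S₁ }
    let force : Side → Bool := fun s =>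
      decide ((S₂.bdry s).tSync < (S₂.bdry s).tFloor ∨ P.computeTNextBdry S₂ s ≤ τ)
    let S₃ : Submesh n :=
      { S₂ with
        bdry := fun s =>
          { S₂.bdry s with tSync := if force s = true then τ else (S₂.bdry s).tSync } }
    let push : Side → ℕ × Event M := fun s =>
      (τ, .pushFlux (neigh k s) s.opp (S₂.u (P.bdryCell k s)) (force s))
    { sub := Function.update c.sub k S₃
      queue := c.queue + {push .left, push .right} +
        (if τ < S₃.tCeil then {(S₃.tCeil, .update k false)} else 0)
      trace := c.trace ∪ {e | ∃ j ∈ P.cells k, e = (j, τ * P.dt, S₁.u j)} }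

open Classical in
/-- The event `push_flux`, executed at time `τ`. -/
def execPushFlux (τ : ℕ) (k : Fin M) (s : Side) (msg : ℝ) (force : Bool) (c : Config n M) :
    Config n M :=
  let S₁ := P.accumulate τ k s (c.sub k)
  let i := S₁.bdry s
  let S₂ := S₁.setBdry s { i with
    u := msg
    tFloor := τ
    tSync := if τ = S₁.tFloor then τ else i.tSync }
  let S₃ := P.updateKBdry τ k s S₂
  let S₄ : Submesh n := { S₃ with tCeil := P.computeTNext k S₃ }
  let c₁ : Config n M := { c with sub := Function.update c.sub k S₄ }
  let c₂ := if force = true ∨ S₄.tCeil ≤ τ then P.execUpdate τ k true c₁ else c₁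
  { c₂ with
    queue := c₂.queue +
      (if τ < (c₂.sub k).tCeil then {((c₂.sub k).tCeil, .update k false)} else 0) }

/-- Execution of a timestamped event. -/
def exec (e : ℕ × Event M) (c : Config n M) : Config n M :=
  match e with
  | (τ, .update k forced) => P.execUpdate τ k forced c
  | (τ, .pushFlux k s msg force) => P.execPushFlux τ k s msg force c

/-- One step of the simulation: remove from the queue some event with the smallest timestamp, and
execute it. Ties between events are broken arbitrarily. -/
def Step (c c' : Config n M) : Prop :=
  ∃ e Q, c.queue = e ::ₘ Q ∧ (∀ e' ∈ Q, e.1 ≤ e'.1) ∧ c' = P.exec e { c with queue := Q }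

/-- The initial state of submesh `k` for the initial cell averages `U₀`. -/
def initSub (U₀ : Fin n → ℝ) (k : Fin M) : Submesh n :=
  let S : Submesh n :=
    { tFloor := 0
      tCeil := 0
      u := U₀
      bdry := fun s =>
        { tFloor := 0
          tSync := 0
          u := match s with
            | .left => U₀ (P.first k - 1)
            | .right => U₀ (P.last k + 1)
          sumF := 0
          Kint := 0
          Kext := 0 } }
  let S₁ := P.updateKBdry 0 k .right (P.updateKBdry 0 k .left S)
  { S₁ with tCeil := P.computeTNext k S₁ }

/-- The initial state of the simulation, with an update scheduled for every submesh. -/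
def initConfig (U₀ : Fin n → ℝ) : Config n M where
  sub := P.initSub U₀
  queue := (Finset.univ : Finset (Fin M)).val.map fun k =>
    ((P.initSub U₀ k).tCeil, Event.update k false)
  trace := {e | ∃ j, e = (j, 0, U₀ j)}

end Sim

end LocalTimestepping

end

/-! All times of the simulation are multiples of `dt`, so a run is described by discrete data: a set
of timestamps for each submesh and a value `V t j` for each step `t` and cell `j`. The proof has two
halves meeting in `IsHistory`. On one side, discrete data obeying the Euler rule, the local ordering
and half of the CFL bound for each cell at an interface yield an event trace with all claimed
properties. On the other side, every run that empties its queue has produced such data.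

Total variation. Let Δ be the jump across an interface. Written with C and D, the Euler rule lets
each of the two adjacent cells damp Δ and add a multiple of the next jump. `abs_le_of_pairOrdered`
bounds |Δ(t)| by |Δ(0)| plus the variation received minus the variation given away, the account of
each cell running up to its latest timestamp. What a cell takes from one of its interfaces it gives
to the other, so the sum over the torus telescopes. The difficulty is asynchrony: between two
synchronizations one cell takes a single long step, and its damping involves all intermediate values
of Δ, which may change sign. The cure is to split the jump as x + R, where the damping owed so far
is θR and θ is the elapsed fraction of the long step; then |x| + (1 - θ)|R| obeys the desired
balance. By `redistribute_step` this splitting can be continued, its new coefficients being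
nonnegative exactly because the two halves of the CFL bound add up to one.

The algorithm. The invariant `Inv` is preserved by the three elementary moves `Inv.advance`,
`Inv.receive` and `Inv.update`. While the events of time τ are being processed, neighbors may
disagree; a clause may fail only at time τ, and only if a push or forced update that repairs it is
outstanding. Once time moves on, no push is left and the exceptions disappear. Running maxima of the
coefficients make a step safe up to its planned time. The maximum principle
`Admissible.step_mem_Icc` keeps all values in the data range, where the bound on `dt` applies; hence
a submesh that has just synchronized can always plan at least one more `dt`, and nothing stalls
before the final time. Termination follows from the decrease of `potential`. -/

noncomputable section

set_option linter.unusedSectionVars false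

namespace LocalTimestepping

/-! ### Combinatorics of the mesh -/

namespace Mesh

variable {n M : ℕ} (m : Mesh n M)

lemma dx_pos (j : Fin n) : 0 < m.dx j :=
  sub_pos.2 (m.x_strictMono j.castSucc_lt_succ)

lemma minDx_le (j : Fin n) : m.minDx ≤ m.dx j :=
  ciInf_le (Set.finite_range _).bddBelow j

lemma minDx_pos [NeZero n] : 0 < m.minDx := by
  obtain ⟨j, hj⟩ := exists_eq_ciInf_of_finite (f := m.dx)
  rw [minDx, ← hj]
  exact m.dx_pos j

lemma first_mem (k : Fin M) : m.first k ∈ m.cells k := by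
  have := m.two_cells k
  simp only [cells, first, Set.mem_ofPred_eq]
  omega

lemma last_mem (k : Fin M) : m.last k ∈ m.cells k := by
  have := m.two_cells k
  simp only [cells, last, Set.mem_ofPred_eq]
  omega

lemma first_ne_last (k : Fin M) : m.first k ≠ m.last k := by
  have := m.two_cells k
  simp only [first, last, ne_eq, Fin.mk.injEq]
  omega

lemma exists_mem_cells (j : Fin n) : ∃ k, j ∈ m.cells k := by
  have key : ∀ i : Fin (M + 1), (j : ℕ) < m.start i → ∃ k, j ∈ m.cells k := by
    intro i
    induction i using Fin.induction with
    | zero => intro h; simp [m.start_zero] at h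
    | succ i ih =>
      intro h
      by_cases h' : (j : ℕ) < m.start i.castSucc
      · exact ih h'
      · exact ⟨i, not_lt.1 h', h⟩
  exact key (Fin.last M) (by rw [m.start_last]; exact j.2)

lemma cells_unique {j : Fin n} {k k' : Fin M} (h : j ∈ m.cells k) (h' : j ∈ m.cells k') :
    k = k' := by
  have aux : ∀ {k k' : Fin M}, j ∈ m.cells k → j ∈ m.cells k' → ¬ k < k' := by
    intro k k' h h' hlt
    have : m.start k.succ ≤ m.start k'.castSucc := m.start_mono (by
      simp only [Fin.le_def, Fin.lt_def, Fin.val_succ, Fin.val_castSucc] at hlt ⊢; omega)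
    have h1 := h.2
    have h2 := h'.1
    omega
  exact le_antisymm (not_lt.1 (aux h' h)) (not_lt.1 (aux h h'))

/-- The submesh to which a cell belongs. -/
def owner (j : Fin n) : Fin M := (m.exists_mem_cells j).choose

lemma mem_cells_owner (j : Fin n) : j ∈ m.cells (m.owner j) := (m.exists_mem_cells j).choose_spec

lemma owner_eq {j : Fin n} {k : Fin M} (h : j ∈ m.cells k) : m.owner j = k :=
  m.cells_unique (m.mem_cells_owner j) h

/-- Addition in `Fin n` and `Fin M` is cyclic: for the last submesh both sides wrap around to the
first cell, otherwise the two submeshes share an ordinary value of `start`. -/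
lemma last_add_one [NeZero n] [NeZero M] (k : Fin M) : m.last k + 1 = m.first (k + 1) := by
  have hv : ((k + 1 : Fin M) : ℕ) = (k + 1) % M := by simp [Fin.val_add]
  have hk := m.two_cells k
  have hn := m.start_succ_le k
  apply Fin.ext
  have hl : ((m.last k + 1 : Fin n) : ℕ) = (m.start k.succ - 1 + 1) % n := by
    simp [Fin.val_add, last]
  rw [hl, Nat.sub_add_cancel (by omega)]
  simp only [first]
  by_cases h : (k : ℕ) + 1 = M
  · have h1 : k.succ = Fin.last M := Fin.ext (by simp [h])
    have h2 : (k + 1 : Fin M).castSucc = 0 := Fin.ext (by simp [hv, h])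
    rw [h1, h2, m.start_last, m.start_zero, Nat.mod_self]
  · have hlt : (k : ℕ) + 1 < M := by omega
    have h2 : (k + 1 : Fin M).castSucc = k.succ :=
      Fin.ext (by simp [hv, Nat.mod_eq_of_lt hlt])
    have h3 := m.start_succ_le (k + 1)
    have h4 := m.two_cells (k + 1)
    rw [h2] at h4 ⊢
    exact Nat.mod_eq_of_lt (by omega)

lemma first_sub_one [NeZero n] [NeZero M] (k : Fin M) : m.first k - 1 = m.last (k - 1) := by
  rw [sub_eq_iff_eq_add, last_add_one, sub_add_cancel]

lemma add_one_mem [NeZero n] {j : Fin n} {k : Fin M} (h : j ∈ m.cells k) (hne : j ≠ m.last k) :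
    j + 1 ∈ m.cells k := by
  have hn := m.start_succ_le k
  have h1 := h.1
  have h2 := h.2
  have h3 : (j : ℕ) ≠ m.start k.succ - 1 := fun h => hne (Fin.ext h)
  have hv : ((j + 1 : Fin n) : ℕ) = j + 1 := by
    rw [Fin.val_add, Fin.val_one', Nat.add_mod_mod]
    exact Nat.mod_eq_of_lt (by omega)
  simp only [cells, Set.mem_ofPred_eq, hv]
  omega

lemma sub_one_mem [NeZero n] {j : Fin n} {k : Fin M} (h : j ∈ m.cells k) (hne : j ≠ m.first k) :
    j - 1 ∈ m.cells k := by
  have hn := m.start_succ_le k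
  have h1 := h.1
  have h2 := h.2
  have h3 : (j : ℕ) ≠ m.start k.castSucc := fun h => hne (Fin.ext h)
  have hv : (j - 1 : Fin n) = ⟨j - 1, by omega⟩ := by
    rw [sub_eq_iff_eq_add]
    apply Fin.ext
    rw [Fin.val_add, Fin.val_one', Nat.add_mod_mod, Nat.sub_add_cancel (by omega)]
    exact (Nat.mod_eq_of_lt j.2).symm
  simp only [cells, Set.mem_ofPred_eq, hv]
  omega

end Mesh

/-! ### Bounds on the coefficients -/

lemma exists_lipschitzOnWith_lt {g : ℝ → ℝ} {I : Set ℝ} {B : ℝ≥0∞} (h : lipConst g I < B) :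
    ∃ K : ℝ≥0, LipschitzOnWith K g I ∧ (K : ℝ≥0∞) < B := by
  simpa only [lipConst, iInf_lt_iff, exists_prop] using h

/-- The hypothesis forces m < d / (2 dt), since otherwise d / (2 m) ≤ dt; the extended arithmetic
also covers m = 0. As `lipConst` is an infimum, some genuine Lipschitz constant then lies below d /
(2 dt), whether or not the infimum is attained. -/
lemma abs_sub_le_of_lipConst_le {g : ℝ → ℝ} {I : Set ℝ} {m : ℝ≥0∞} {dt d : ℝ} (hdt : 0 < dt)
    (hd : 0 < d) (hm : lipConst g I ≤ m)
    (h : ENNReal.ofReal dt < ENNReal.ofReal d / (2 * m)) {a b : ℝ} (ha : a ∈ I) (hb : b ∈ I) :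
    2 * dt * |g a - g b| ≤ d * |a - b| := by
  have hlt : m < ENNReal.ofReal (d / (2 * dt)) := by
    by_contra hcon
    rw [not_lt] at hcon
    have h1 : ENNReal.ofReal d / (2 * m) ≤
        ENNReal.ofReal d / (2 * ENNReal.ofReal (d / (2 * dt))) := by gcongr
    have h2 : ENNReal.ofReal d / (2 * ENNReal.ofReal (d / (2 * dt))) = ENNReal.ofReal dt := by
      rw [show (2 : ℝ≥0∞) = ENNReal.ofReal 2 by simp, ← ENNReal.ofReal_mul (by norm_num),
        ← ENNReal.ofReal_div_of_pos (by positivity)]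
      congr 1
      field_simp
    exact absurd h (not_lt.2 (h1.trans h2.le))
  obtain ⟨K, hK, hKB⟩ := exists_lipschitzOnWith_lt (hm.trans_lt hlt)
  have hK' : (K : ℝ) < d / (2 * dt) := by
    rw [← ENNReal.ofReal_coe_nnreal] at hKB
    exact (ENNReal.ofReal_lt_ofReal_iff (by positivity)).1 hKB
  have h1 : |g a - g b| ≤ K * |a - b| := by
    simpa only [Real.dist_eq] using hK.dist_le_mul a ha b hb
  rw [lt_div_iff₀ (by positivity)] at hK'
  calc 2 * dt * |g a - g b| ≤ 2 * dt * (K * |a - b|) := by gcongr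
    _ = (K * (2 * dt)) * |a - b| := by ring
    _ ≤ d * |a - b| := by gcongr

/-- A timestep `dt` is compatible with half of the CFL condition for values in `R` and cells of size
at least `d`. -/
def HalfCFL (F : ℝ → ℝ → ℝ) (R : Set ℝ) (dt d : ℝ) : Prop :=
  ∀ ξ ∈ R, ∀ a ∈ R, ∀ b ∈ R,
    2 * dt * |F a ξ - F b ξ| ≤ d * |a - b| ∧ 2 * dt * |F ξ a - F ξ b| ≤ d * |a - b|

lemma halfCFL_of_lt_iInf {F : ℝ → ℝ → ℝ} {R : Set ℝ} {dt d : ℝ} (hdt : 0 < dt) (hd : 0 < d)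
    (h : ENNReal.ofReal dt < ⨅ ξ ∈ R, ENNReal.ofReal d /
        (2 * max (lipConst (fun v => F v ξ) R) (lipConst (fun v => F ξ v) R))) :
    HalfCFL F R dt d := fun ξ hξ _ ha _ hb =>
  have h' := h.trans_le (biInf_le _ hξ)
  ⟨abs_sub_le_of_lipConst_le (g := fun v => F v ξ) hdt hd (le_max_left _ _) h' ha hb,
    abs_sub_le_of_lipConst_le (g := fun v => F ξ v) hdt hd (le_max_right _ _) h' ha hb⟩

section Coeff

variable {f : ℝ → ℝ} {F : ℝ → ℝ → ℝ} {d : ℝ}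

lemma coeffC_nonpos (hF : IsNumericalFlux f F) (hd : 0 < d) (a b c : ℝ) :
    coeffC F d a b c ≤ 0 := by
  rcases le_total a b with h | h
  · exact div_nonpos_of_nonpos_of_nonneg (sub_nonpos.2 (hF.mono_left c h))
      (mul_nonneg hd.le (sub_nonneg.2 h))
  · exact div_nonpos_of_nonneg_of_nonpos (sub_nonneg.2 (hF.mono_left c h))
      (mul_nonpos_of_nonneg_of_nonpos hd.le (sub_nonpos.2 h))

lemma coeffD_nonneg (hF : IsNumericalFlux f F) (hd : 0 < d) (a b c : ℝ) :
    0 ≤ coeffD F d a b c := by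
  rcases le_total b c with h | h
  · exact div_nonneg (sub_nonneg.2 (hF.anti_right a h)) (mul_nonneg hd.le (sub_nonneg.2 h))
  · exact div_nonneg_of_nonpos (sub_nonpos.2 (hF.anti_right a h))
      (mul_nonpos_of_nonneg_of_nonpos hd.le (sub_nonpos.2 h))

/-- Both sides vanish for equal values, so the reading of 0/0 is immaterial wherever the coefficient
is multiplied by its jump. -/
lemma coeffC_mul (hd : 0 < d) (a b c : ℝ) : coeffC F d a b c * (b - a) = (F a c - F b c) / d := by
  rcases eq_or_ne a b with rfl | h
  · simp
  · have := sub_ne_zero.2 h.symm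
    rw [coeffC]
    field_simp

lemma coeffD_mul (hd : 0 < d) (a b c : ℝ) : coeffD F d a b c * (c - b) = (F a b - F a c) / d := by
  rcases eq_or_ne b c with rfl | h
  · simp
  · have := sub_ne_zero.2 h.symm
    rw [coeffD]
    field_simp

lemma mul_neg_coeffC_le {R : Set ℝ} {dt dmin : ℝ} (hH : HalfCFL F R dt dmin) (hdt : 0 < dt)
    (hd : 0 < d) (hle : dmin ≤ d) {a b c : ℝ} (ha : a ∈ R) (hb : b ∈ R) (hc : c ∈ R) :
    dt * -coeffC F d a b c ≤ 1 / 2 := by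
  rcases eq_or_ne a b with rfl | h
  · simp [coeffC]
  · have h1 := (hH c hc a ha b hb).1
    have h2 : 0 < |a - b| := abs_pos.2 (sub_ne_zero.2 h)
    have h3 : |coeffC F d a b c| = |F a c - F b c| / (d * |a - b|) := by
      rw [coeffC, abs_div, abs_mul, abs_of_pos hd, abs_sub_comm b a]
    calc dt * -coeffC F d a b c ≤ dt * |coeffC F d a b c| := by gcongr; exact neg_le_abs _
      _ = (2 * dt * |F a c - F b c|) / (2 * (d * |a - b|)) := by rw [h3]; field_simp
      _ ≤ 1 / 2 := by
        rw [div_le_iff₀ (by positivity)]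
        nlinarith

lemma mul_coeffD_le {R : Set ℝ} {dt dmin : ℝ} (hH : HalfCFL F R dt dmin) (hdt : 0 < dt)
    (hd : 0 < d) (hle : dmin ≤ d) {a b c : ℝ} (ha : a ∈ R) (hb : b ∈ R) (hc : c ∈ R) :
    dt * coeffD F d a b c ≤ 1 / 2 := by
  rcases eq_or_ne b c with rfl | h
  · simp [coeffD]
  · have h1 := (hH a ha b hb c hc).2
    have h2 : 0 < |b - c| := abs_pos.2 (sub_ne_zero.2 h)
    have h3 : |coeffD F d a b c| = |F a b - F a c| / (d * |b - c|) := by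
      rw [coeffD, abs_div, abs_mul, abs_of_pos hd, abs_sub_comm c b]
    calc dt * coeffD F d a b c ≤ dt * |coeffD F d a b c| := by gcongr; exact le_abs_self _
      _ = (2 * dt * |F a b - F a c|) / (2 * (d * |b - c|)) := by rw [h3]; field_simp
      _ ≤ 1 / 2 := by
        rw [div_le_iff₀ (by positivity)]
        nlinarith

end Coeff

/-! ### Initial cell averages -/

/-- The real-valued `essSup` and `essInf` bound a function almost everywhere only if it is
essentially bounded, so the finite sup norm is first turned into two-sided bounds. -/
lemma ae_mem_dataRange {u₀ : UnitAddCircle → ℝ} (hu₀ : MemLp u₀ ⊤ volume) :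
    ∀ᵐ y, u₀ y ∈ dataRange u₀ := by
  have hb : ∀ᵐ y, ‖u₀ y‖ ≤ (eLpNormEssSup u₀ volume).toReal := by
    have hfin : eLpNormEssSup u₀ volume ≠ ⊤ := by
      have := hu₀.2
      rw [eLpNorm_exponent_top] at this
      exact this.ne
    filter_upwards [ae_le_eLpNormEssSup (f := u₀) (μ := volume)] with y hy
    rw [← toReal_enorm]
    exact ENNReal.toReal_mono hfin hy
  have hub : Filter.IsBoundedUnder (· ≤ ·) (ae volume) u₀ :=
    ⟨_, Filter.eventually_map.2 (hb.mono fun y hy => (le_abs_self _).trans hy)⟩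
  have hlb : Filter.IsBoundedUnder (· ≥ ·) (ae volume) u₀ :=
    ⟨_, Filter.eventually_map.2 (hb.mono fun y hy => (abs_le.1 hy).1)⟩
  filter_upwards [ae_le_essSup hub, ae_essInf_le hlb] with y h1 h2
  exact ⟨h2, h1⟩

/-- The cell lies in the fundamental domain that begins at `m.x 0`, on which the projection to the
circle preserves measure. Integrability and the almost everywhere bounds are pulled back there and
integrated. -/
lemma cellAvg_mem_dataRange {n M : ℕ} (m : Mesh n M) {u₀ : UnitAddCircle → ℝ}
    (hu₀ : MemLp u₀ ⊤ volume) (j : Fin n) : m.cellAvg u₀ j ∈ dataRange u₀ := by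
  have hdx := m.dx_pos j
  have hmp := UnitAddCircle.measurePreserving_mk (m.x 0)
  have hsub : Set.Ioc (m.x j.castSucc) (m.x j.succ) ⊆ Set.Ioc (m.x 0) (m.x 0 + 1) := by
    rw [← m.x_last]
    exact Set.Ioc_subset_Ioc (m.x_strictMono.monotone (Fin.zero_le _))
      (m.x_strictMono.monotone (Fin.le_last _))
  have hae : ∀ᵐ y : ℝ ∂volume.restrict (Set.Ioc (m.x j.castSucc) (m.x j.succ)),
      u₀ (y : UnitAddCircle) ∈ dataRange u₀ := by
    have h0 : ∀ᵐ y : ℝ ∂volume.restrict (Set.Ioc (m.x 0) (m.x 0 + 1)),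
        u₀ (y : UnitAddCircle) ∈ dataRange u₀ :=
      hmp.quasiMeasurePreserving.ae (ae_mem_dataRange hu₀)
    exact ae_mono (Measure.restrict_mono hsub le_rfl) h0
  have hint : IntegrableOn (fun y : ℝ => u₀ (y : UnitAddCircle))
      (Set.Ioc (m.x j.castSucc) (m.x j.succ)) := by
    have h1 : Integrable u₀ := hu₀.integrable le_top
    exact IntegrableOn.mono_set (hmp.integrable_comp_of_integrable h1) hsub
  have hvol : (volume.real (Set.Ioc (m.x j.castSucc) (m.x j.succ))) = m.dx j := by
    rw [Real.volume_real_Ioc_of_le (m.x_strictMono j.castSucc_lt_succ).le, Mesh.dx]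
  have hconst : ∀ c : ℝ, ∫ _ in Set.Ioc (m.x j.castSucc) (m.x j.succ), c = m.dx j * c := by
    intro c
    rw [setIntegral_const, hvol, smul_eq_mul]
  have hle := m.x_strictMono (j.castSucc_lt_succ)
  have hlo : m.dx j * essInf u₀ volume ≤
      ∫ y in Set.Ioc (m.x j.castSucc) (m.x j.succ), u₀ (y : UnitAddCircle) := by
    rw [← hconst]
    exact integral_mono_ae (integrableOn_const (by simp)) hint (hae.mono fun y hy => hy.1)
  have hhi : ∫ y in Set.Ioc (m.x j.castSucc) (m.x j.succ), u₀ (y : UnitAddCircle) ≤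
      m.dx j * essSup u₀ volume := by
    rw [← hconst]
    exact integral_mono_ae hint (integrableOn_const (by simp)) (hae.mono fun y hy => hy.2)
  rw [Mesh.cellAvg, intervalIntegral.integral_of_le hle.le, one_div, inv_mul_eq_div]
  exact ⟨(le_div_iff₀' hdx).2 hlo, (div_le_iff₀' hdx).2 hhi⟩

end LocalTimestepping

namespace LocalTimestepping

/-! ### Discrete timestamps -/

/-- `a` is the nearest element of `A` at or before `t`. -/
def IsPrevIn (A : Set ℕ) (t a : ℕ) : Prop := a ∈ A ∧ a ≤ t ∧ ∀ s ∈ A, s ≤ t → s ≤ a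

/-- `b` is the nearest element of `A` after `t`. -/
def IsNextIn (A : Set ℕ) (t b : ℕ) : Prop := b ∈ A ∧ t < b ∧ ∀ s ∈ A, t < s → b ≤ s

open Classical in
/-- The nearest element of `A` at or before `t`, provided that `0 ∈ A`. -/
def floorIn (A : Set ℕ) (t : ℕ) : ℕ := Nat.findGreatest (· ∈ A) t

section Floor

variable {A B : Set ℕ} {a b s t N : ℕ}

lemma isPrevIn_floorIn (h0 : 0 ∈ A) (t : ℕ) : IsPrevIn A t (floorIn A t) := by
  classical
  refine ⟨?_, Nat.findGreatest_le t, fun s hs hst => Nat.le_findGreatest hst hs⟩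
  exact Nat.findGreatest_spec (P := (· ∈ A)) (Nat.zero_le t) h0

lemma IsPrevIn.unique (h : IsPrevIn A t a) (h' : IsPrevIn A t b) : a = b :=
  le_antisymm (h'.2.2 a h.1 h.2.1) (h.2.2 b h'.1 h'.2.1)

lemma IsPrevIn.floorIn_eq (h0 : 0 ∈ A) (h : IsPrevIn A t a) : floorIn A t = a :=
  (isPrevIn_floorIn h0 t).unique h

lemma isPrevIn_self (h : t ∈ A) : IsPrevIn A t t := ⟨h, le_rfl, fun _ _ => id⟩

lemma floorIn_of_mem (h0 : 0 ∈ A) (h : t ∈ A) : floorIn A t = t := (isPrevIn_self h).floorIn_eq h0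

lemma floorIn_succ_of_notMem (h : t + 1 ∉ A) : floorIn A (t + 1) = floorIn A t := by
  classical
  exact Nat.findGreatest_of_not h

lemma exists_isNextIn (hN : N ∈ A) (h : t < N) : ∃ b ≤ N, IsNextIn A t b := by
  classical
  have hex : ∃ b, b ∈ A ∧ t < b := ⟨N, hN, h⟩
  exact ⟨Nat.find hex, Nat.find_min' hex ⟨hN, h⟩, (Nat.find_spec hex).1, (Nat.find_spec hex).2,
    fun s hs hts => Nat.find_min' hex ⟨hs, hts⟩⟩

end Floor

/-! ### Redistribution of variation at one interface -/

/-- One substep of the cell with many timestamps. The jump is x + R, and θR is the damping already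
owed by the cell that takes one long step. The substep damps by c, adds f, and increases the debt by
e(x + R), while the elapsed fraction grows from θ to θ'. The weight 1 - θ of |R| is chosen so that
the coefficients of |x| and |R| both drop by exactly c + e. -/
lemma redistribute_step {x R c e f θ θ' A : ℝ} (hθ : 0 ≤ θ) (hθ' : 0 < θ') (hθ'1 : θ' ≤ 1)
    (hc : 0 ≤ c) (he : 0 ≤ e) (h1 : c * θ' + e ≤ θ') (h2 : θ + e ≤ (1 - c) * θ')
    (hA : |x| + (1 - θ) * |R| ≤ A) :
    ∃ x' R', (x + R) + (f - c * (x + R)) = x' + R' ∧ θ * R + e * (x + R) = θ' * R' ∧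
      |x'| + (1 - θ') * |R'| ≤ A + (|f| - (c + e) * |x + R|) := by
  -- A share α of x and a share β of R go into the new R. The debt equation θR + e(x + R) = θ'R'
  -- determines both shares; the CFL hypotheses say that 1 - c - α and 1 - c - β are nonnegative.
  obtain ⟨α, hα⟩ : ∃ α, θ' * α = e := ⟨e / θ', by field_simp⟩
  obtain ⟨β, hβ⟩ : ∃ β, θ' * β = θ + e := ⟨(θ + e) / θ', by field_simp⟩
  have hα0 : 0 ≤ α := by by_contra h; nlinarith
  have hβ0 : 0 ≤ β := by by_contra h; nlinarith
  have hα1 : 0 ≤ 1 - c - α := by by_contra h; nlinarith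
  have hβ1 : 0 ≤ 1 - c - β := by by_contra h; nlinarith
  refine ⟨(1 - c - α) * x + (1 - c - β) * R + f, β * R + α * x, by ring, ?_, ?_⟩
  · linear_combination (-R) * hβ - x * hα
  · have e1 : |(1 - c - α) * x + (1 - c - β) * R + f| ≤
        (1 - c - α) * |x| + (1 - c - β) * |R| + |f| := by
      refine (abs_add_le _ _).trans (add_le_add ((abs_add_le _ _).trans ?_) le_rfl)
      rw [abs_mul, abs_mul, abs_of_nonneg hα1, abs_of_nonneg hβ1]
    have e2 : |β * R + α * x| ≤ β * |R| + α * |x| := by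
      refine (abs_add_le _ _).trans ?_
      rw [abs_mul, abs_mul, abs_of_nonneg hα0, abs_of_nonneg hβ0]
    have e3 : (1 - θ') * |β * R + α * x| ≤ (1 - θ') * (β * |R| + α * |x|) :=
      mul_le_mul_of_nonneg_left e2 (by linarith)
    have e4 : (c + e) * |x + R| ≤ (c + e) * (|x| + |R|) :=
      mul_le_mul_of_nonneg_left (abs_add_le _ _) (by linarith)
    have e5 : (1 - θ') * (β * |R| + α * |x|) =
        β * |R| + α * |x| - (θ + e) * |R| - e * |x| := by
      linear_combination (-|R|) * hβ - |x| * hα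
    linarith

section Interface

variable {A B : Set ℕ} {Δ f g c d : ℕ → ℝ} {σ σ' N : ℕ}

/-- Between two synchronizations at `σ` and `σ'`, the cell on one side of an interface takes a
single step, and the one on the other side steps at the times in `B`. -/
lemma abs_le_between_sync (hlt : σ < σ') (h0 : 0 ∈ B) (hσ : σ ∈ B) (hσ' : σ' ∈ B)
    (hc0 : ∀ t, 0 ≤ c t) (hd0 : ∀ t, 0 ≤ d t)
    (hd : ∀ t, σ ≤ t → t < σ' → ((σ' : ℝ) - σ) * d t ≤ 1 / 2)
    (hc : ∀ t b, σ ≤ t → t < σ' → IsNextIn B t b → ((b : ℝ) - σ) * c t ≤ 1 / 2)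
    (hΔ : ∀ t, σ ≤ t → t < σ' →
      Δ t = Δ σ + ∑ s ∈ Finset.Ico σ (floorIn B t), (f s - c s * Δ s))
    (hΔ' : Δ σ' = Δ σ + ∑ s ∈ Finset.Ico σ σ', (f s - c s * Δ s) +
      ∑ s ∈ Finset.Ico σ σ', (g s - d s * Δ s)) :
    (∀ t, σ ≤ t → t < σ' →
      |Δ t| ≤ |Δ σ| + ∑ s ∈ Finset.Ico σ (floorIn B t), (|f s| - c s * |Δ s|)) ∧
    |Δ σ'| ≤ |Δ σ| + ∑ s ∈ Finset.Ico σ σ', (|f s| - c s * |Δ s|) +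
      ∑ s ∈ Finset.Ico σ σ', (|g s| - d s * |Δ s|) := by
  have hL : (0 : ℝ) < (σ' : ℝ) - σ := sub_pos.2 (by exact_mod_cast hlt)
  set L : ℝ := (σ' : ℝ) - σ with hLdef
  -- Induction on t with the splitting x + R at the latest timestamp of B. The debt of the single
  -- step is θR with θ = (floor - σ) / L. The bound already subtracts the damping by both c and d,
  -- although the one by d is applied only at σ'.
  have key : ∀ t, σ ≤ t → t ≤ σ' → ∃ x R,
      Δ σ + ∑ s ∈ Finset.Ico σ (floorIn B t), (f s - c s * Δ s) = x + R ∧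
      ∑ s ∈ Finset.Ico σ (floorIn B t), d s * Δ s = ((floorIn B t : ℝ) - σ) / L * R ∧
      |x| + (1 - ((floorIn B t : ℝ) - σ) / L) * |R| ≤
        |Δ σ| + ∑ s ∈ Finset.Ico σ (floorIn B t), (|f s| - (c s + d s) * |Δ s|) := by
    intro t hσt
    induction t, hσt using Nat.le_induction with
    | base =>
      intro _
      exact ⟨Δ σ, 0, by simp [floorIn_of_mem h0 hσ]⟩
    | succ t hσt ih =>
      intro htσ'
      obtain ⟨x, R, hx, hR, hA⟩ := ih (by omega)
      by_cases hB : t + 1 ∈ B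
      swap
      · rw [floorIn_succ_of_notMem hB]
        exact ⟨x, R, hx, hR, hA⟩
      rw [floorIn_of_mem h0 hB]
      obtain ⟨hvB, hvt, hvmax⟩ := isPrevIn_floorIn h0 t
      have hσv : σ ≤ floorIn B t := hvmax σ hσ hσt
      set v := floorIn B t with hv
      have hΔc : ∀ s ∈ Finset.Ico v (t + 1), Δ s = x + R := by
        intro s hs
        rw [Finset.mem_Ico] at hs
        have hfl : floorIn B s = v := IsPrevIn.floorIn_eq h0
          ⟨hvB, hs.1, fun r hr hrs => hvmax r hr (by omega)⟩
        rw [hΔ s (by omega) (by omega), hfl, hx]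
      have hnext : ∀ s ∈ Finset.Ico v (t + 1), IsNextIn B s (t + 1) := by
        intro s hs
        rw [Finset.mem_Ico] at hs
        refine ⟨hB, hs.2, fun r hr hsr => ?_⟩
        by_contra hcon
        have := hvmax r hr (by omega)
        omega
      have hv1 : (v : ℝ) < (t : ℝ) + 1 := by exact_mod_cast Nat.lt_succ_of_le hvt
      have hσv' : (σ : ℝ) ≤ v := by exact_mod_cast hσv
      have hT'L : (t : ℝ) + 1 - σ ≤ L := by
        have : ((t + 1 : ℕ) : ℝ) ≤ σ' := by exact_mod_cast htσ'
        push_cast at this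
        linarith
      have hT' : (0 : ℝ) < (t : ℝ) + 1 - σ := by linarith
      have hcard : ((Finset.Ico v (t + 1)).card : ℝ) = (t : ℝ) + 1 - v := by
        rw [Nat.card_Ico, Nat.cast_sub (by omega)]
        push_cast
        ring
      set cs : ℝ := ∑ s ∈ Finset.Ico v (t + 1), c s with hcs
      set ds : ℝ := ∑ s ∈ Finset.Ico v (t + 1), d s with hds
      set fs : ℝ := ∑ s ∈ Finset.Ico v (t + 1), f s with hfs
      have hcs0 : 0 ≤ cs := Finset.sum_nonneg fun s _ => hc0 s
      have hds0 : 0 ≤ ds := Finset.sum_nonneg fun s _ => hd0 s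
      -- The two halves of the CFL condition, summed over the substep from v to t + 1, add up to (t
      -- + 1 - σ) cs + L ds ≤ t + 1 - v. Both hypotheses of `redistribute_step` follow from this.
      have hcsle : ((t : ℝ) + 1 - σ) * cs ≤ ((t : ℝ) + 1 - v) / 2 := by
        rw [hcs, Finset.mul_sum]
        refine (Finset.sum_le_card_nsmul _ _ (1 / 2) fun s hs => ?_).trans_eq ?_
        · have hs' := Finset.mem_Ico.1 hs
          have := hc s (t + 1) (by omega) (by omega) (hnext s hs)
          push_cast at this
          exact this
        · rw [nsmul_eq_mul, hcard]
          ring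
      have hdsle : L * ds ≤ ((t : ℝ) + 1 - v) / 2 := by
        rw [hds, Finset.mul_sum]
        refine (Finset.sum_le_card_nsmul _ _ (1 / 2) fun s hs => ?_).trans_eq ?_
        · have hs' := Finset.mem_Ico.1 hs
          exact hd s (by omega) (by omega)
        · rw [nsmul_eq_mul, hcard]
          ring
      obtain ⟨x', R', h1, h2, h3⟩ := redistribute_step (x := x) (R := R) (c := cs) (e := ds)
        (f := fs) (θ := ((v : ℝ) - σ) / L) (θ' := ((t : ℝ) + 1 - σ) / L)
        (div_nonneg (by linarith) hL.le) (div_pos hT' hL) ((div_le_one hL).2 hT'L) hcs0 hds0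
        (by
          rw [← mul_div_assoc, div_add' _ _ _ hL.ne', div_le_div_iff_of_pos_right hL]
          linarith)
        (by
          rw [← mul_div_assoc, div_add' _ _ _ hL.ne', div_le_div_iff_of_pos_right hL]
          linarith) hA
      have hsplit : ∀ φ : ℕ → ℝ, ∑ s ∈ Finset.Ico σ (t + 1), φ s =
          ∑ s ∈ Finset.Ico σ v, φ s + ∑ s ∈ Finset.Ico v (t + 1), φ s := fun φ =>
        (Finset.sum_Ico_consecutive φ hσv (by omega)).symm
      refine ⟨x', R', ?_, ?_, ?_⟩
      · rw [hsplit, ← add_assoc, hx, ← h1, hfs, hcs, Finset.sum_mul, ← Finset.sum_sub_distrib]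
        congr 1
        exact Finset.sum_congr rfl fun s hs => by rw [hΔc s hs]
      · rw [hsplit, hR]
        push_cast
        rw [← h2, hds, Finset.sum_mul]
        congr 1
        exact Finset.sum_congr rfl fun s hs => by rw [hΔc s hs]
      · rw [hsplit]
        push_cast
        refine h3.trans ?_
        rw [← add_assoc]
        refine add_le_add le_rfl ?_
        have : ∑ s ∈ Finset.Ico v (t + 1), (|f s| - (c s + d s) * |Δ s|) =
            ∑ s ∈ Finset.Ico v (t + 1), |f s| - (cs + ds) * |x + R| := by
          rw [hcs, hds, ← Finset.sum_add_distrib, Finset.sum_mul, ← Finset.sum_sub_distrib]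
          exact Finset.sum_congr rfl fun s hs => by rw [hΔc s hs]
        rw [this]
        exact sub_le_sub_right (Finset.abs_sum_le_sum_abs _ _) _
  have hsumabs : ∀ v, |∑ s ∈ Finset.Ico σ v, d s * Δ s| ≤ ∑ s ∈ Finset.Ico σ v, d s * |Δ s| := by
    intro v
    refine (Finset.abs_sum_le_sum_abs _ _).trans_eq (Finset.sum_congr rfl fun s _ => ?_)
    rw [abs_mul, abs_of_nonneg (hd0 s)]
  have hsub : ∀ v, ∑ s ∈ Finset.Ico σ v, (|f s| - (c s + d s) * |Δ s|) =
      ∑ s ∈ Finset.Ico σ v, (|f s| - c s * |Δ s|) - ∑ s ∈ Finset.Ico σ v, d s * |Δ s| := by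
    intro v
    rw [← Finset.sum_sub_distrib]
    exact Finset.sum_congr rfl fun s _ => by ring
  constructor
  -- Before σ' the jump is still x + R. The missing θ|R| is the absolute value of the accumulated
  -- debt, hence at most the sum of d|Δ|, which is why only the damping by c appears in the bound
  -- here.
  · intro t h1 h2
    obtain ⟨x, R, hx, hR, hA⟩ := key t h1 h2.le
    rw [hsub] at hA
    have h3 := hsumabs (floorIn B t)
    have hθ : 0 ≤ ((floorIn B t : ℝ) - σ) / L := by
      have : (σ : ℝ) ≤ floorIn B t := by exact_mod_cast (isPrevIn_floorIn h0 t).2.2 σ hσ h1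
      exact div_nonneg (by linarith) hL.le
    rw [hR, abs_mul, abs_of_nonneg hθ] at h3
    rw [hΔ t h1 h2, hx]
    linarith [abs_add_le x R]
  -- At σ' the fraction θ is 1: the debt is all of R, and paying it leaves x plus the sum of g.
  · obtain ⟨x, R, hx, hR, hA⟩ := key σ' hlt.le le_rfl
    rw [hsub] at hA
    rw [floorIn_of_mem h0 hσ', div_self hL.ne'] at *
    have e1 : ∑ s ∈ Finset.Ico σ σ', (g s - d s * Δ s) =
        ∑ s ∈ Finset.Ico σ σ', g s - R := by rw [Finset.sum_sub_distrib, hR, one_mul]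
    have e2 : Δ σ' = x + ∑ s ∈ Finset.Ico σ σ', g s := by rw [hΔ', hx, e1]; ring
    have e3 : ∑ s ∈ Finset.Ico σ σ', (|g s| - d s * |Δ s|) =
        ∑ s ∈ Finset.Ico σ σ', |g s| - ∑ s ∈ Finset.Ico σ σ', d s * |Δ s| := by
      rw [Finset.sum_sub_distrib]
    rw [e2, e3]
    have e4 := abs_add_le x (∑ s ∈ Finset.Ico σ σ', g s)
    have e5 := Finset.abs_sum_le_sum_abs g (Finset.Ico σ σ')
    linarith

/-- The pairwise form of the local ordering of two sets of timestamps. -/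
def PairOrdered (A B : Set ℕ) : Prop :=
  ∀ p ∈ A, ∀ q ∈ B, ∃ r ∈ A ∩ B, min p q ≤ r ∧ r ≤ max p q

/-- A point of A and a point of B strictly inside the window would enclose a common time. The
pairwise form of the ordering is the one that can be maintained while timestamps are added one at a
time. -/
lemma PairOrdered.between (h : PairOrdered A B)
    (hno : ∀ r ∈ A ∩ B, ¬ (σ < r ∧ r < σ')) :
    (∀ r ∈ A, ¬ (σ < r ∧ r < σ')) ∨ ∀ r ∈ B, ¬ (σ < r ∧ r < σ') := by
  by_contra! hcon
  obtain ⟨⟨p, hp, hp1, hp2⟩, q, hq, hq1, hq2⟩ := hcon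
  obtain ⟨r, hr, h1, h2⟩ := h p hp q hq
  exact hno r hr ⟨lt_of_lt_of_le (lt_min hp1 hq1) h1, lt_of_le_of_lt h2 (max_lt hp2 hq2)⟩

lemma sum_range_floorIn_eq (hσv : σ ≤ N) (φ : ℕ → ℝ) :
    ∑ s ∈ Finset.range N, φ s = ∑ s ∈ Finset.range σ, φ s + ∑ s ∈ Finset.Ico σ N, φ s :=
  (Finset.sum_range_add_sum_Ico φ hσv).symm

/-- Extends the bound from the synchronization σ over one window in which A takes a single step: the
sums up to σ are absorbed into Δ σ, and the remainder is `abs_le_between_sync`. -/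
lemma abs_le_of_single_step (hlt : σ < σ') (hA0 : 0 ∈ A) (hB0 : 0 ∈ B)
    (hσ : σ ∈ A ∩ B) (hσ' : σ' ∈ A ∩ B) (hno : ∀ r ∈ A, ¬ (σ < r ∧ r < σ'))
    (hc0 : ∀ t, 0 ≤ c t) (hd0 : ∀ t, 0 ≤ d t)
    (hd : ∀ t s b, IsPrevIn (A ∩ B) t s → IsNextIn A t b → ((b : ℝ) - s) * d t ≤ 1 / 2)
    (hc : ∀ t s b, IsPrevIn (A ∩ B) t s → IsNextIn B t b → ((b : ℝ) - s) * c t ≤ 1 / 2)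
    (hΔ : ∀ t ≤ σ', Δ t = Δ 0 + ∑ s ∈ Finset.range (floorIn A t), (g s - d s * Δ s) +
      ∑ s ∈ Finset.range (floorIn B t), (f s - c s * Δ s))
    (hle : |Δ σ| ≤ |Δ 0| + ∑ s ∈ Finset.range (floorIn A σ), (|g s| - d s * |Δ s|) +
      ∑ s ∈ Finset.range (floorIn B σ), (|f s| - c s * |Δ s|))
    {t : ℕ} (ht1 : σ ≤ t) (ht2 : t ≤ σ') :
    |Δ t| ≤ |Δ 0| + ∑ s ∈ Finset.range (floorIn A t), (|g s| - d s * |Δ s|) +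
      ∑ s ∈ Finset.range (floorIn B t), (|f s| - c s * |Δ s|) := by
  have hprev : ∀ t, σ ≤ t → t < σ' → IsPrevIn (A ∩ B) t σ := fun t h1 h2 =>
    ⟨hσ, h1, fun s hs hst => by by_contra hcon; exact hno s hs.1 ⟨by omega, by omega⟩⟩
  have hnext : ∀ t, σ ≤ t → t < σ' → IsNextIn A t σ' := fun t h1 h2 =>
    ⟨hσ'.1, h2, fun s hs hst => by by_contra hcon; exact hno s hs ⟨by omega, by omega⟩⟩
  have hflA : ∀ t, σ ≤ t → t < σ' → floorIn A t = σ := fun t h1 h2 => IsPrevIn.floorIn_eq hA0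
    ⟨hσ.1, h1, fun s hs hst => by by_contra hcon; exact hno s hs ⟨by omega, by omega⟩⟩
  have hflB : ∀ t, σ ≤ t → σ ≤ floorIn B t := fun t h1 =>
    (isPrevIn_floorIn hB0 t).2.2 σ hσ.2 h1
  have hΔσ := hΔ σ hlt.le
  rw [floorIn_of_mem hA0 hσ.1, floorIn_of_mem hB0 hσ.2] at hΔσ hle
  obtain ⟨hmid, hend⟩ := abs_le_between_sync (B := B) (Δ := Δ) (f := f) (g := g) (c := c) (d := d)
    hlt hB0 hσ.2 hσ'.2 hc0 hd0 (fun t h1 h2 => hd t σ σ' (hprev t h1 h2) (hnext t h1 h2))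
    (fun t b h1 h2 hb => hc t σ b (hprev t h1 h2) hb)
    (fun t h1 h2 => by
      rw [hΔ t h2.le, hflA t h1 h2, sum_range_floorIn_eq (hflB t h1), hΔσ]
      ring)
    (by
      rw [hΔ σ' le_rfl, floorIn_of_mem hA0 hσ'.1, floorIn_of_mem hB0 hσ'.2,
        sum_range_floorIn_eq hlt.le, sum_range_floorIn_eq (N := σ') hlt.le, hΔσ]
      ring)
  rcases ht2.lt_or_eq with h | rfl
  · rw [hflA t ht1 h, sum_range_floorIn_eq (hflB t ht1)]
    linarith [hmid t ht1 h]
  · rw [floorIn_of_mem hA0 hσ'.1, floorIn_of_mem hB0 hσ'.2, sum_range_floorIn_eq hlt.le,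
      sum_range_floorIn_eq (N := t) hlt.le]
    linarith

/-- The variation across an interface is controlled by the initial variation and the variation
received from, minus that passed on to, the neighboring interfaces. -/
lemma abs_le_of_pairOrdered (hA0 : 0 ∈ A) (hB0 : 0 ∈ B) (hAN : N ∈ A) (hBN : N ∈ B)
    (hord : PairOrdered A B) (hc0 : ∀ t, 0 ≤ c t) (hd0 : ∀ t, 0 ≤ d t)
    (hd : ∀ t s b, IsPrevIn (A ∩ B) t s → IsNextIn A t b → ((b : ℝ) - s) * d t ≤ 1 / 2)
    (hc : ∀ t s b, IsPrevIn (A ∩ B) t s → IsNextIn B t b → ((b : ℝ) - s) * c t ≤ 1 / 2)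
    (hΔ : ∀ t ≤ N, Δ t = Δ 0 + ∑ s ∈ Finset.range (floorIn A t), (g s - d s * Δ s) +
      ∑ s ∈ Finset.range (floorIn B t), (f s - c s * Δ s)) :
    ∀ t ≤ N, |Δ t| ≤ |Δ 0| + ∑ s ∈ Finset.range (floorIn A t), (|g s| - d s * |Δ s|) +
      ∑ s ∈ Finset.range (floorIn B t), (|f s| - c s * |Δ s|) := by
  intro t
  induction t using Nat.strong_induction_on with
  | _ t ih =>
    intro htN
    rcases Nat.eq_zero_or_pos t with rfl | htpos
    · simp [floorIn_of_mem hA0 hA0, floorIn_of_mem hB0 hB0]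
    have h0 : 0 ∈ A ∩ B := ⟨hA0, hB0⟩
    -- The window is taken around t - 1 so that σ < t ≤ σ'. The induction hypothesis thus applies at
    -- σ even when t is itself a synchronization time.
    obtain ⟨hσ, hσt, hσmax⟩ := isPrevIn_floorIn h0 (t - 1)
    obtain ⟨σ', hσ'N, hσ', htσ', hσ'min⟩ := exists_isNextIn (A := A ∩ B) ⟨hAN, hBN⟩
      (show t - 1 < N by omega)
    set σ := floorIn (A ∩ B) (t - 1)
    have hno : ∀ r ∈ A ∩ B, ¬ (σ < r ∧ r < σ') := by
      intro r hr h
      by_cases hrt : r ≤ t - 1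
      · have := hσmax r hr hrt
        omega
      · have := hσ'min r hr (by omega)
        omega
    have ihσ := ih σ (by omega) (by omega)
    rcases hord.between hno with h | h
    · exact abs_le_of_single_step (by omega) hA0 hB0 hσ hσ' h hc0 hd0 hd hc
        (fun t ht => hΔ t (by omega)) ihσ (by omega) (by omega)
    · have := abs_le_of_single_step (A := B) (B := A) (f := g) (g := f) (c := d) (d := c)
        (Δ := Δ) (σ := σ) (σ' := σ')
        (by omega) hB0 hA0 hσ.symm hσ'.symm h hd0 hc0
        (by rwa [Set.inter_comm]) (by rwa [Set.inter_comm])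
        (fun t ht => by rw [hΔ t (by omega)]; ring) (by linarith) (t := t) (by omega) (by omega)
      linarith

end Interface

/-! ### Discrete histories -/

/-- The coefficient `C_j` for the cell averages `v`. -/
def cellC {n : ℕ} [NeZero n] (F : ℝ → ℝ → ℝ) (dx : Fin n → ℝ) (j : Fin n) (v : Fin n → ℝ) : ℝ :=
  coeffC F (dx j) (v (j - 1)) (v j) (v (j + 1))

/-- The coefficient `D_j` for the cell averages `v`. -/
def cellD {n : ℕ} [NeZero n] (F : ℝ → ℝ → ℝ) (dx : Fin n → ℝ) (j : Fin n) (v : Fin n → ℝ) : ℝ :=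
  coeffD F (dx j) (v (j - 1)) (v j) (v (j + 1))

/-- A complete history of cell averages `V t j` at times `t * dt`, where cell `j` has the
timestamps `T j`. -/
structure IsHistory {n : ℕ} [NeZero n] (F : ℝ → ℝ → ℝ) (dx : Fin n → ℝ) (dt : ℝ) (N : ℕ)
    (T : Fin n → Set ℕ) (V : ℕ → Fin n → ℝ) : Prop where
  zero_mem : ∀ j, 0 ∈ T j
  last_mem : ∀ j, N ∈ T j
  le_last : ∀ j, ∀ t ∈ T j, t ≤ N
  const : ∀ j t, t + 1 ∉ T j → V (t + 1) j = V t j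
  euler : ∀ j a b, a ∈ T j → IsNextIn (T j) a b → V b j = V a j + dt / dx j *
    ∑ t ∈ Finset.Ico a b, (F (V t (j - 1)) (V a j) - F (V a j) (V t (j + 1)))
  ordered : ∀ j, PairOrdered (T j) (T (j + 1))
  cflD : ∀ j t σ b, IsPrevIn (T j ∩ T (j + 1)) t σ → IsNextIn (T j) t b →
    ((b : ℝ) - σ) * (dt * cellD F dx j (V t)) ≤ 1 / 2
  cflC : ∀ j t σ b, IsPrevIn (T j ∩ T (j + 1)) t σ → IsNextIn (T (j + 1)) t b →
    ((b : ℝ) - σ) * (dt * -cellC F dx (j + 1) (V t)) ≤ 1 / 2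

/-- A function that only changes at the times in `A` is constant after `a` up to the next such
time. -/
lemma eq_of_const {A : Set ℕ} {v : ℕ → ℝ} (hv : ∀ t, t + 1 ∉ A → v (t + 1) = v t) {a t : ℕ}
    (h : a ≤ t) (hA : ∀ s ∈ A, s ≤ t → s ≤ a) : v t = v a := by
  induction t, h using Nat.le_induction with
  | base => rfl
  | succ t hat ih =>
    rw [hv t fun hmem => by have := hA _ hmem le_rfl; omega,
      ih fun s hs hst => hA s hs (by omega)]

namespace IsHistory

variable {n : ℕ} [NeZero n] {f : ℝ → ℝ} {F : ℝ → ℝ → ℝ} {dx : Fin n → ℝ} {dt : ℝ} {N : ℕ}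
  {T : Fin n → Set ℕ} {V : ℕ → Fin n → ℝ}

lemma eq_of_isPrevIn (h : IsHistory F dx dt N T V) {j : Fin n} {t a : ℕ}
    (ha : IsPrevIn (T j) t a) : V t j = V a j :=
  eq_of_const (v := fun t => V t j) (h.const j) ha.2.1 ha.2.2

/-- The increment of cell `j` due to the interval between the times `t` and `t + 1`. -/
def incr (F : ℝ → ℝ → ℝ) (dx : Fin n → ℝ) (dt : ℝ) (V : ℕ → Fin n → ℝ) (j : Fin n) (t : ℕ) : ℝ :=
  dt * cellD F dx j (V t) * (V t (j + 1) - V t j) +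
    dt * cellC F dx j (V t) * (V t j - V t (j - 1))

/-- During a step the cell's own value is frozen, and inserting the flux F(U_{j-1}, U_{j+1}) splits
the flux difference into its D and C parts. The sum stops at the latest timestamp because the step
in progress has not yet been applied. -/
lemma eq_add_sum_incr (h : IsHistory F dx dt N T V) (hdx : ∀ j, 0 < dx j) (j : Fin n) (t : ℕ) :
    V t j = V 0 j + ∑ s ∈ Finset.range (floorIn (T j) t), incr F dx dt V j s := by
  induction t with
  | zero => simp [floorIn_of_mem (h.zero_mem j) (h.zero_mem j)]
  | succ t ih =>
    by_cases hmem : t + 1 ∈ T j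
    swap
    · rw [floorIn_succ_of_notMem hmem, h.const j t hmem, ih]
    have hp := isPrevIn_floorIn (h.zero_mem j) t
    rw [floorIn_of_mem (h.zero_mem j) hmem]
    set a := floorIn (T j) t
    have hnext : IsNextIn (T j) a (t + 1) := by
      refine ⟨hmem, by have := hp.2.1; omega, fun s hs has => ?_⟩
      by_contra hcon
      have := hp.2.2 s hs (by omega)
      omega
    rw [h.euler j a (t + 1) hp.1 hnext, ← h.eq_of_isPrevIn hp, ih,
      sum_range_floorIn_eq (N := t + 1) (σ := a) (by have := hp.2.1; omega), ← add_assoc, ← ih,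
      Finset.mul_sum]
    congr 1
    refine Finset.sum_congr rfl fun s hs => ?_
    rw [Finset.mem_Ico] at hs
    have hs' : V s j = V t j := by
      rw [h.eq_of_isPrevIn hp]
      exact h.eq_of_isPrevIn ⟨hp.1, hs.1, fun r hr hrs => hp.2.2 r hr (by omega)⟩
    have e1 := coeffC_mul (F := F) (hdx j) (V s (j - 1)) (V s j) (V s (j + 1))
    have e2 := coeffD_mul (F := F) (hdx j) (V s (j - 1)) (V s j) (V s (j + 1))
    rw [incr, cellD, cellC, mul_assoc, mul_assoc, e1, e2, hs']
    ring

lemma sum_abs_le (h : IsHistory F dx dt N T V) (hF : IsNumericalFlux f F) (hdx : ∀ j, 0 < dx j)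
    (hdt : 0 < dt) {t : ℕ} (ht : t ≤ N) :
    ∑ j, |V t (j + 1) - V t j| ≤ ∑ j, |V 0 (j + 1) - V 0 j| := by
  -- The net variation that cell j moves during one `dt`: the loss of its right interface minus that
  -- of its left one. The same ψ is charged to the one interface and credited to the other.
  set ψ : Fin n → ℕ → ℝ := fun j s => dt * cellD F dx j (V s) * |V s (j + 1) - V s j| +
    dt * cellC F dx j (V s) * |V s j - V s (j - 1)| with hψ
  have hC0 : ∀ j s, 0 ≤ dt * -cellC F dx j (V s) := fun j s =>
    mul_nonneg hdt.le (neg_nonneg.2 (coeffC_nonpos hF (hdx j) _ _ _))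
  have hD0 : ∀ j s, 0 ≤ dt * cellD F dx j (V s) := fun j s =>
    mul_nonneg hdt.le (coeffD_nonneg hF (hdx j) _ _ _)
  have key : ∀ j, |V t (j + 1) - V t j| ≤ |V 0 (j + 1) - V 0 j| -
      ∑ s ∈ Finset.range (floorIn (T j) t), ψ j s +
      ∑ s ∈ Finset.range (floorIn (T (j + 1)) t), ψ (j + 1) s := by
    intro j
    have := abs_le_of_pairOrdered (A := T j) (B := T (j + 1)) (N := N)
      (Δ := fun t => V t (j + 1) - V t j)
      (f := fun s => dt * cellD F dx (j + 1) (V s) * (V s (j + 1 + 1) - V s (j + 1)))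
      (c := fun s => dt * -cellC F dx (j + 1) (V s))
      (d := fun s => dt * cellD F dx j (V s))
      (g := fun s => dt * -cellC F dx j (V s) * (V s j - V s (j - 1)))
      (h.zero_mem j) (h.zero_mem _) (h.last_mem j) (h.last_mem _) (h.ordered j)
      (hC0 _) (hD0 _) (h.cflD j) (h.cflC j) (fun t _ => by
        have e1 := h.eq_add_sum_incr hdx j t
        have e2 := h.eq_add_sum_incr hdx (j + 1) t
        have e3 : ∀ s, dt * -cellC F dx j (V s) * (V s j - V s (j - 1)) -
            dt * cellD F dx j (V s) * (V s (j + 1) - V s j) = -incr F dx dt V j s := fun s => by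
          rw [incr]; ring
        have e4 : ∀ s, dt * cellD F dx (j + 1) (V s) * (V s (j + 1 + 1) - V s (j + 1)) -
            dt * -cellC F dx (j + 1) (V s) * (V s (j + 1) - V s j) =
            incr F dx dt V (j + 1) s := fun s => by
          rw [incr, add_sub_cancel_right]; ring
        simp only [e3, e4, Finset.sum_neg_distrib]
        linarith) t ht
    refine this.trans_eq ?_
    have e3 : ∀ s, |dt * -cellC F dx j (V s) * (V s j - V s (j - 1))| -
        dt * cellD F dx j (V s) * |V s (j + 1) - V s j| = -ψ j s := fun s => by
      rw [abs_mul, abs_of_nonneg (hC0 j s), hψ]; ring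
    have e4 : ∀ s, |dt * cellD F dx (j + 1) (V s) * (V s (j + 1 + 1) - V s (j + 1))| -
        dt * -cellC F dx (j + 1) (V s) * |V s (j + 1) - V s j| = ψ (j + 1) s := fun s => by
      rw [abs_mul, abs_of_nonneg (hD0 _ s), hψ]
      simp only [add_sub_cancel_right]
      ring
    simp only [e3, e4, Finset.sum_neg_distrib]
    ring
  have hre : ∑ j, ∑ s ∈ Finset.range (floorIn (T (j + 1)) t), ψ (j + 1) s =
      ∑ j, ∑ s ∈ Finset.range (floorIn (T j) t), ψ j s :=
    Equiv.sum_comp (Equiv.addRight (1 : Fin n))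
      (fun j => ∑ s ∈ Finset.range (floorIn (T j) t), ψ j s)
  calc ∑ j, |V t (j + 1) - V t j| ≤ ∑ j, (|V 0 (j + 1) - V 0 j| -
      ∑ s ∈ Finset.range (floorIn (T j) t), ψ j s +
      ∑ s ∈ Finset.range (floorIn (T (j + 1)) t), ψ (j + 1) s) := Finset.sum_le_sum fun j _ => key j
    _ = ∑ j, |V 0 (j + 1) - V 0 j| := by
      rw [Finset.sum_add_distrib, Finset.sum_sub_distrib, hre]
      ring

end IsHistory

end LocalTimestepping

namespace LocalTimestepping

/-! ### From discrete histories to event traces -/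

/-- The event trace of a history of cell averages `V t j` at times `t * dt`, where cell `j` has the
timestamps `T j`. -/
def historyTrace {n : ℕ} (dt : ℝ) (T : Fin n → Set ℕ) (V : ℕ → Fin n → ℝ) : EventTrace n :=
  {e | ∃ j, ∃ t ∈ T j, e = (j, (t : ℝ) * dt, V t j)}

section Trace

variable {n : ℕ} {dt : ℝ} {T : Fin n → Set ℕ} {V : ℕ → Fin n → ℝ} {j : Fin n} {r v : ℝ} {a b : ℕ}

lemma mem_historyTrace :
    (j, r, v) ∈ historyTrace dt T V ↔ ∃ t ∈ T j, r = (t : ℝ) * dt ∧ v = V t j := by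
  constructor
  · rintro ⟨j', t, ht, h⟩
    simp only [Prod.mk.injEq] at h
    obtain ⟨rfl, h1, h2⟩ := h
    exact ⟨t, ht, h1, h2⟩
  · rintro ⟨t, ht, rfl, rfl⟩
    exact ⟨j, t, ht, rfl⟩

lemma mem_times_historyTrace :
    r ∈ (historyTrace dt T V).times j ↔ ∃ t ∈ T j, r = (t : ℝ) * dt := by
  constructor
  · rintro ⟨v, hv⟩
    obtain ⟨t, ht, h, -⟩ := mem_historyTrace.1 hv
    exact ⟨t, ht, h⟩
  · rintro ⟨t, ht, rfl⟩
    exact ⟨V t j, mem_historyTrace.2 ⟨t, ht, rfl, rfl⟩⟩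

lemma natCast_mul_le_iff (hdt : 0 < dt) (hr : 0 ≤ r) (t : ℕ) :
    (t : ℝ) * dt ≤ r ↔ t ≤ ⌊r / dt⌋₊ := by
  rw [Nat.le_floor_iff (by positivity), le_div_iff₀ hdt]

lemma lt_natCast_mul_iff (hdt : 0 < dt) (hr : 0 ≤ r) (t : ℕ) :
    r < (t : ℝ) * dt ↔ ⌊r / dt⌋₊ < t := by
  rw [← not_le, natCast_mul_le_iff hdt hr, not_le]

lemma prev_historyTrace (hdt : 0 < dt) (hr : 0 ≤ r) (ha : IsPrevIn (T j) ⌊r / dt⌋₊ a) :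
    (historyTrace dt T V).prev j r = a * dt := by
  refine IsGreatest.csSup_eq ⟨⟨mem_times_historyTrace.2 ⟨a, ha.1, rfl⟩,
    (natCast_mul_le_iff hdt hr a).2 ha.2.1⟩, ?_⟩
  rintro s ⟨hs, hsr⟩
  obtain ⟨t, ht, rfl⟩ := mem_times_historyTrace.1 hs
  have : (t : ℝ) ≤ a := by exact_mod_cast ha.2.2 t ht ((natCast_mul_le_iff hdt hr t).1 hsr)
  gcongr

lemma next_historyTrace (hdt : 0 < dt) (hr : 0 ≤ r) (hb : IsNextIn (T j) ⌊r / dt⌋₊ b) :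
    (historyTrace dt T V).next j r = b * dt := by
  refine IsLeast.csInf_eq ⟨⟨mem_times_historyTrace.2 ⟨b, hb.1, rfl⟩,
    (lt_natCast_mul_iff hdt hr b).2 hb.2.1⟩, ?_⟩
  rintro s ⟨hs, hsr⟩
  obtain ⟨t, ht, rfl⟩ := mem_times_historyTrace.1 hs
  have : (b : ℝ) ≤ t := by exact_mod_cast hb.2.2 t ht ((lt_natCast_mul_iff hdt hr t).1 hsr)
  gcongr

lemma natCast_mul_inj (hdt : 0 < dt) {s t : ℕ} (h : (s : ℝ) * dt = (t : ℝ) * dt) : s = t := by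
  exact_mod_cast mul_right_cancel₀ hdt.ne' h

lemma natCast_mul_lt_iff (hdt : 0 < dt) {s t : ℕ} : (s : ℝ) * dt < (t : ℝ) * dt ↔ s < t := by
  rw [mul_lt_mul_iff_left₀ hdt, Nat.cast_lt]

lemma times_inter_Ioo_eq_empty (hdt : 0 < dt) 
    (h : ∀ r ∈ T j, ¬ (a < r ∧ r < b)) :
    (historyTrace dt T V).times j ∩ Set.Ioo ((a : ℝ) * dt) (b * dt) = ∅ := by
  rw [Set.eq_empty_iff_forall_notMem]
  rintro r ⟨hr, h1, h2⟩
  obtain ⟨t, ht, rfl⟩ := mem_times_historyTrace.1 hr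
  exact h t ht ⟨(natCast_mul_lt_iff hdt).1 h1, (natCast_mul_lt_iff hdt).1 h2⟩

end Trace

namespace IsHistory

variable {n : ℕ} [NeZero n] {f : ℝ → ℝ} {F : ℝ → ℝ → ℝ} {dx : Fin n → ℝ} {dt : ℝ} {N : ℕ}
  {T : Fin n → Set ℕ} {V : ℕ → Fin n → ℝ}

/-- The value of a trace is an arbitrary choice among its triples; since t ↦ t * dt is injective,
only one triple is available at the previous timestamp. -/
lemma value_eq (h : IsHistory F dx dt N T V) (hdt : 0 < dt) (j : Fin n) {r : ℝ} (hr : 0 ≤ r) :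
    (historyTrace dt T V).value j r = V ⌊r / dt⌋₊ j := by
  have hp := isPrevIn_floorIn (h.zero_mem j) ⌊r / dt⌋₊
  set a := floorIn (T j) ⌊r / dt⌋₊
  have hmem : (j, (historyTrace dt T V).prev j r, V a j) ∈ historyTrace dt T V :=
    mem_historyTrace.2 ⟨a, hp.1, prev_historyTrace hdt hr hp, rfl⟩
  have hv : (j, (historyTrace dt T V).prev j r, (historyTrace dt T V).value j r) ∈
      historyTrace dt T V :=
    Classical.epsilon_spec (p := fun v => (j, (historyTrace dt T V).prev j r, v) ∈
      historyTrace dt T V) ⟨_, hmem⟩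
  obtain ⟨t, ht, h1, h2⟩ := mem_historyTrace.1 hv
  rw [prev_historyTrace hdt hr hp] at h1
  rw [h2, ← natCast_mul_inj hdt h1, h.eq_of_isPrevIn hp]

lemma value_natCast_mul (h : IsHistory F dx dt N T V) (hdt : 0 < dt) (j : Fin n) (t : ℕ) :
    (historyTrace dt T V).value j (t * dt) = V t j := by
  rw [h.value_eq hdt j (by positivity), mul_div_cancel_right₀ _ hdt.ne', Nat.floor_natCast]

lemma isTraceOn (h : IsHistory F dx dt N T V) (hdt : 0 < dt) :
    (historyTrace dt T V).IsTraceOn (N * dt) (V 0) where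
  finite := by
    refine (Set.finite_range
      (fun p : Fin n × Fin (N + 1) => (p.1, ((p.2 : ℕ) : ℝ) * dt, V p.2 p.1))).subset ?_
    rintro _ ⟨j, t, ht, rfl⟩
    exact ⟨(j, ⟨t, Nat.lt_succ_of_le (h.le_last j t ht)⟩), rfl⟩
  unique := by
    intro j r v w hv hw
    obtain ⟨t, ht, h1, rfl⟩ := mem_historyTrace.1 hv
    obtain ⟨t', ht', h2, rfl⟩ := mem_historyTrace.1 hw
    rw [natCast_mul_inj hdt (h1.symm.trans h2)]
  start_mem := fun j => mem_historyTrace.2 ⟨0, h.zero_mem j, by simp, rfl⟩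
  end_mem := fun j => mem_times_historyTrace.2 ⟨N, h.last_mem j, rfl⟩
  mem_Icc := by
    intro j r hr
    obtain ⟨t, ht, rfl⟩ := mem_times_historyTrace.1 hr
    have : (t : ℝ) ≤ N := by exact_mod_cast h.le_last j t ht
    exact ⟨by positivity, by gcongr⟩

lemma mem_sync_iff (hdt : 0 < dt) {j : Fin n} {r : ℝ} :
    r ∈ (historyTrace dt T V).times j ∩ (historyTrace dt T V).times (j + 1) ↔
      ∃ t ∈ T j ∩ T (j + 1), r = (t : ℝ) * dt := by
  constructor
  · rintro ⟨h1, h2⟩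
    obtain ⟨t, ht, rfl⟩ := mem_times_historyTrace.1 h1
    obtain ⟨t', ht', h'⟩ := mem_times_historyTrace.1 h2
    rw [← natCast_mul_inj hdt h'] at ht'
    exact ⟨t, ⟨ht, ht'⟩, rfl⟩
  · rintro ⟨t, ht, rfl⟩
    exact ⟨mem_times_historyTrace.2 ⟨t, ht.1, rfl⟩, mem_times_historyTrace.2 ⟨t, ht.2, rfl⟩⟩

lemma locallyOrdered (h : IsHistory F dx dt N T V) (hdt : 0 < dt) :
    (historyTrace dt T V).LocallyOrdered (N * dt) := by
  intro j
  -- The sequence runs through all common timestamps from a on: a is put before the sequence that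
  -- starts at the next common one.
  have hsteps : ∀ a ∈ T j ∩ T (j + 1), ∃ (m : ℕ) (s : ℕ → ℕ), s 0 = a ∧ s m = N ∧
      (∀ μ < m, s μ < s (μ + 1)) ∧ (∀ μ ≤ m, s μ ∈ T j ∩ T (j + 1)) ∧
      ∀ μ < m, ∀ r ∈ T j ∩ T (j + 1), ¬ (s μ < r ∧ r < s (μ + 1)) := by
    intro a ha
    induction hk : N - a using Nat.strong_induction_on generalizing a with
    | _ k ih =>
      rcases (h.le_last j a ha.1).lt_or_eq with hlt | rfl
      · obtain ⟨b, hbN, hb, hab, hmin⟩ := exists_isNextIn (A := T j ∩ T (j + 1))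
          ⟨h.last_mem j, h.last_mem _⟩ hlt
        obtain ⟨m, s, h0, hm, h1, h2, h3⟩ := ih (N - b) (by omega) b hb rfl
        refine ⟨m + 1, fun μ => Nat.casesOn μ a s, rfl, hm, ?_, ?_, ?_⟩
        · rintro (_ | μ) hμ
          · simpa [h0] using hab
          · exact h1 μ (by omega)
        · rintro (_ | μ) hμ
          · exact ha
          · exact h2 μ (by omega)
        · rintro (_ | μ) hμ
          · intro r hr hcon
            simp only [h0] at hcon
            have := hmin r hr hcon.1
            omega
          · exact h3 μ (by omega)
      · exact ⟨0, fun _ => a, rfl, rfl, by simp, fun _ _ => ha, by simp⟩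
  obtain ⟨m, s, h0, hm, h1, h2, h3⟩ := hsteps 0 ⟨h.zero_mem j, h.zero_mem _⟩
  refine ⟨m, fun μ => s μ * dt, by simp [h0], by simp [hm],
    fun μ hμ => (natCast_mul_lt_iff hdt).2 (h1 μ hμ),
    fun μ hμ => (mem_sync_iff hdt).2 ⟨s μ, h2 μ hμ, rfl⟩, fun μ hμ => ?_⟩
  exact ((h.ordered j).between (h3 μ hμ)).imp (times_inter_Ioo_eq_empty hdt)
    (times_inter_Ioo_eq_empty hdt)

/-- The condition concerns every synchronization sequence. Its ordering property excludes common
timestamps inside a window, so `s μ` is the last common timestamp before t; the C and D terms are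
then at most 1/2 each. -/
lemma satisfiesCFL (h : IsHistory F dx dt N T V) (hdt : 0 < dt) :
    (historyTrace dt T V).SatisfiesCFL F dx (N * dt) := by
  intro j m s hs μ hμ t ht
  obtain ⟨a, ha, hsa⟩ := (mem_sync_iff hdt).1 (hs.mem μ hμ.le)
  obtain ⟨b, hb, hsb⟩ := (mem_sync_iff hdt).1 (hs.mem (μ + 1) hμ)
  rw [hsa, hsb] at ht
  have ht0 : 0 ≤ t := le_trans (by positivity) ht.1.le
  have hat : a ≤ ⌊t / dt⌋₊ := (natCast_mul_le_iff hdt ht0 a).1 ht.1.le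
  have htb : ⌊t / dt⌋₊ < b := (lt_natCast_mul_iff hdt ht0 b).1 ht.2
  have hprev : IsPrevIn (T j ∩ T (j + 1)) ⌊t / dt⌋₊ a := by
    refine ⟨ha, hat, fun r hr hrt => ?_⟩
    by_contra hcon
    have hmem : (r : ℝ) * dt ∈ Set.Ioo (s μ) (s (μ + 1)) := by
      rw [hsa, hsb]
      exact ⟨(natCast_mul_lt_iff hdt).2 (by omega), (natCast_mul_lt_iff hdt).2 (by omega)⟩
    have hr' := (mem_sync_iff (V := V) hdt).2 ⟨r, hr, rfl⟩
    rcases hs.ordered μ hμ with h' | h'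
    · exact Set.eq_empty_iff_forall_notMem.1 h' _ ⟨hr'.1, hmem⟩
    · exact Set.eq_empty_iff_forall_notMem.1 h' _ ⟨hr'.2, hmem⟩
  have hbN := h.le_last j b hb.1
  obtain ⟨b₁, -, hb₁⟩ := exists_isNextIn (h.last_mem j) (htb.trans_le hbN)
  obtain ⟨b₂, -, hb₂⟩ := exists_isNextIn (h.last_mem (j + 1)) (htb.trans_le hbN)
  have e1 := h.cflD j _ a b₁ hprev hb₁
  have e2 := h.cflC j _ a b₂ hprev hb₂
  have hv : ∀ i, (historyTrace dt T V).value i t = V ⌊t / dt⌋₊ i := fun i => h.value_eq hdt i ht0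
  rw [next_historyTrace hdt ht0 hb₁, next_historyTrace hdt ht0 hb₂, hsa]
  simp only [EventTrace.C, EventTrace.D, hv]
  simp only [cellC, cellD] at e1 e2
  linarith

lemma isForwardEuler (h : IsHistory F dx dt N T V) (hdt : 0 < dt) :
    (historyTrace dt T V).IsForwardEuler F dx := by
  intro j r hr r' hr' hlt hemp
  obtain ⟨a, ha, rfl⟩ := mem_times_historyTrace.1 hr
  obtain ⟨b, hb, rfl⟩ := mem_times_historyTrace.1 hr'
  have hab := (natCast_mul_lt_iff hdt).1 hlt
  have hnext : IsNextIn (T j) a b := by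
    refine ⟨hb, hab, fun s hs has => ?_⟩
    by_contra hcon
    exact Set.eq_empty_iff_forall_notMem.1 hemp (s * dt)
      ⟨mem_times_historyTrace.2 ⟨s, hs, rfl⟩, (natCast_mul_lt_iff hdt).2 has,
        (natCast_mul_lt_iff hdt).2 (by omega)⟩
  rw [h.value_natCast_mul hdt, h.value_natCast_mul hdt, h.euler j a b ha hnext]
  set g : ℝ → ℝ := fun σ => F ((historyTrace dt T V).value (j - 1) σ) (V a j) -
    F (V a j) ((historyTrace dt T V).value (j + 1) σ) with hg
  set G : ℕ → ℝ := fun t => F (V t (j - 1)) (V a j) - F (V a j) (V t (j + 1)) with hG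
  have hle : ∀ t : ℕ, (t : ℝ) * dt ≤ ((t + 1 : ℕ) : ℝ) * dt := fun t => by
    push_cast
    nlinarith
  -- The values are constant on each open interval between consecutive multiples of `dt`, so the
  -- integral is a finite sum and the conventions at the endpoints play no role.
  have hpiece : ∀ t : ℕ, Set.EqOn g (fun _ => G t)
      (Set.Ioo ((t : ℝ) * dt) (((t + 1 : ℕ) : ℝ) * dt)) := by
    intro t σ hσ
    have hσ0 : 0 ≤ σ := le_trans (by positivity) hσ.1.le
    have hfl : ⌊σ / dt⌋₊ = t := by
      have h1 := (natCast_mul_le_iff hdt hσ0 t).1 hσ.1.le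
      have h2 := (lt_natCast_mul_iff hdt hσ0 (t + 1)).1 hσ.2
      omega
    simp only [hg, hG, h.value_eq hdt _ hσ0, hfl]
  have hint : ∀ t : ℕ, IntervalIntegrable g volume ((t : ℝ) * dt) (((t + 1 : ℕ) : ℝ) * dt) := by
    intro t
    rw [intervalIntegrable_iff_integrableOn_Ioo_of_le (hle t)]
    exact (integrableOn_const (by simp)).congr_fun (hpiece t).symm measurableSet_Ioo
  have hval : ∀ t : ℕ, ∫ σ in ((t : ℝ) * dt)..(((t + 1 : ℕ) : ℝ) * dt), g σ = dt * G t := by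
    intro t
    rw [intervalIntegral.integral_of_le (hle t), integral_Ioc_eq_integral_Ioo,
      setIntegral_congr_fun measurableSet_Ioo (hpiece t), setIntegral_const,
      Real.volume_real_Ioo_of_le (hle t), smul_eq_mul]
    push_cast
    ring
  have hsum := intervalIntegral.sum_integral_adjacent_intervals_Ico (f := g) (μ := volume)
    (a := fun t : ℕ => (t : ℝ) * dt) hab.le (fun t _ => hint t)
  rw [← hsum, Finset.sum_congr rfl (fun t _ => hval t), ← Finset.mul_sum]
  ring

lemma isTVD (h : IsHistory F dx dt N T V) (hF : IsNumericalFlux f F) (hdx : ∀ j, 0 < dx j)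
    (hdt : 0 < dt) : (historyTrace dt T V).IsTVD (N * dt) := by
  intro t ht
  have hle : ⌊t / dt⌋₊ ≤ N := by
    have h1 : t / dt ≤ N := (div_le_iff₀ hdt).2 ht.2
    exact (Nat.floor_mono h1).trans_eq (Nat.floor_natCast N)
  simpa [EventTrace.TV, h.value_eq hdt _ ht.1, h.value_eq hdt _ le_rfl] using
    h.sum_abs_le hF hdx hdt hle

end IsHistory

end LocalTimestepping

namespace LocalTimestepping

@[simp] lemma Side.opp_opp (s : Side) : s.opp.opp = s := by cases s <;> rfl

namespace Submesh

variable {n : ℕ} (S : Submesh n) (s s' : Side) (i : Interface)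

@[simp] lemma setBdry_tFloor : (S.setBdry s i).tFloor = S.tFloor := rfl
@[simp] lemma setBdry_bdry_same : (S.setBdry s i).bdry s = i := by simp [setBdry]

variable {s s'}

lemma setBdry_bdry_of_ne (h : s' ≠ s) : (S.setBdry s i).bdry s' = S.bdry s' := by
  simp [setBdry, h]

end Submesh

namespace Sim

/-! ### Effect of the elementary operations on the stored data of a single submesh -/

section Local

variable {n M : ℕ} [NeZero n] (P : Sim n M)

/-- The vectors of cell averages of two states of a submesh, and the neighboring values known to
them on side `s`, agree. -/
def SameView (S S' : Submesh n) (s : Side) : Prop := S.u = S'.u ∧ (S.bdry s).u = (S'.bdry s).u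

variable {P} {k : Fin M} {S S' : Submesh n} {s s' : Side} {τ : ℕ}

/-- A submesh has at least two cells, so the boundary cell on side s never reads the outside value
stored on the other side. -/
lemma extNow_congr (h : SameView S S' s) : P.extNow k S s = P.extNow k S' s := by
  obtain ⟨h1, h2⟩ := h
  cases s
  · simp [extNow, negC, uLeft, uRight, P.first_ne_last k, h1, h2]
  · simp [extNow, posD, uLeft, uRight, (P.first_ne_last k).symm, h1, h2]

lemma intNow_congr (h : SameView S S' s) : P.intNow k S s = P.intNow k S' s := by
  obtain ⟨h1, h2⟩ := h
  cases s
  · simp [intNow, posD, uLeft, uRight, P.first_ne_last k, h1, h2]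
  · simp [intNow, negC, uLeft, uRight, (P.first_ne_last k).symm, h1, h2]

lemma bdryFlux_congr (h : SameView S S' s) : P.bdryFlux k S s = P.bdryFlux k S' s := by
  obtain ⟨h1, h2⟩ := h
  cases s <;> simp [bdryFlux, h1, h2]

@[simp] lemma accumulate_tFloor : (P.accumulate τ k s S).tFloor = S.tFloor := rfl

@[simp] lemma accumulate_bdry_tFloor :
    ((P.accumulate τ k s S).bdry s').tFloor = (S.bdry s').tFloor := by
  by_cases h : s' = s
  · subst h; simp [accumulate]
  · simp [accumulate, Submesh.setBdry_bdry_of_ne _ _ h]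

@[simp] lemma accumulate_bdry_tSync :
    ((P.accumulate τ k s S).bdry s').tSync = (S.bdry s').tSync := by
  by_cases h : s' = s
  · subst h; simp [accumulate]
  · simp [accumulate, Submesh.setBdry_bdry_of_ne _ _ h]

@[simp] lemma accumulate_bdry_u :
    ((P.accumulate τ k s S).bdry s').u = (S.bdry s').u := by
  by_cases h : s' = s
  · subst h; simp [accumulate]
  · simp [accumulate, Submesh.setBdry_bdry_of_ne _ _ h]

@[simp] lemma accumulate_bdry_Kint :
    ((P.accumulate τ k s S).bdry s').Kint = (S.bdry s').Kint := by
  by_cases h : s' = s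
  · subst h; simp [accumulate]
  · simp [accumulate, Submesh.setBdry_bdry_of_ne _ _ h]

@[simp] lemma accumulate_bdry_Kext :
    ((P.accumulate τ k s S).bdry s').Kext = (S.bdry s').Kext := by
  by_cases h : s' = s
  · subst h; simp [accumulate]
  · simp [accumulate, Submesh.setBdry_bdry_of_ne _ _ h]

/-- The integral of the flux through side `s` since the last update, up to time `τ`. -/
def fluxUpTo (P : Sim n M) (τ : ℕ) (k : Fin M) (s : Side) (S : Submesh n) : ℝ :=
  (S.bdry s).sumF + ((τ : ℝ) - max (S.bdry s).tFloor S.tFloor) * P.dt * P.bdryFlux k S s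

lemma accumulate_bdry_sumF_same :
    ((P.accumulate τ k s S).bdry s).sumF = P.fluxUpTo τ k s S := by
  simp [accumulate, fluxUpTo]

lemma accumulate_bdry_of_ne (h : s' ≠ s) : (P.accumulate τ k s S).bdry s' = S.bdry s' := by
  simp [accumulate, Submesh.setBdry_bdry_of_ne _ _ h]

/-- The two sides are accumulated in succession, but the flux on one side does not depend on the
integral stored on the other. -/
lemma accumulate_both_sumF :
    ((P.accumulate τ k .right (P.accumulate τ k .left S)).bdry s).sumF = P.fluxUpTo τ k s S := by
  cases s
  · rw [accumulate_bdry_of_ne (by simp), accumulate_bdry_sumF_same]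
  · rw [accumulate_bdry_sumF_same, fluxUpTo, fluxUpTo, accumulate_bdry_of_ne (by simp),
      accumulate_tFloor,
      bdryFlux_congr (S := P.accumulate τ k .left S) (S' := S) ⟨rfl, by simp⟩]

@[simp] lemma updateKBdry_tFloor : (P.updateKBdry τ k s S).tFloor = S.tFloor := rfl
@[simp] lemma updateKBdry_u : (P.updateKBdry τ k s S).u = S.u := rfl

@[simp] lemma updateKBdry_bdry_tFloor :
    ((P.updateKBdry τ k s S).bdry s').tFloor = (S.bdry s').tFloor := by
  by_cases h : s' = s
  · subst h; simp [updateKBdry]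
  · simp [updateKBdry, Submesh.setBdry_bdry_of_ne _ _ h]

@[simp] lemma updateKBdry_bdry_tSync :
    ((P.updateKBdry τ k s S).bdry s').tSync = (S.bdry s').tSync := by
  by_cases h : s' = s
  · subst h; simp [updateKBdry]
  · simp [updateKBdry, Submesh.setBdry_bdry_of_ne _ _ h]

@[simp] lemma updateKBdry_bdry_u :
    ((P.updateKBdry τ k s S).bdry s').u = (S.bdry s').u := by
  by_cases h : s' = s
  · subst h; simp [updateKBdry]
  · simp [updateKBdry, Submesh.setBdry_bdry_of_ne _ _ h]

@[simp] lemma updateKBdry_bdry_sumF :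
    ((P.updateKBdry τ k s S).bdry s').sumF = (S.bdry s').sumF := by
  by_cases h : s' = s
  · subst h; simp [updateKBdry]
  · simp [updateKBdry, Submesh.setBdry_bdry_of_ne _ _ h]

lemma updateKBdry_bdry_of_ne (h : s' ≠ s) : (P.updateKBdry τ k s S).bdry s' = S.bdry s' := by
  simp [updateKBdry, Submesh.setBdry_bdry_of_ne _ _ h]

lemma updateKBdry_bdry_Kint_same : ((P.updateKBdry τ k s S).bdry s).Kint =
    if S.tFloor = τ then P.intNow k S s else max (S.bdry s).Kint (P.intNow k S s) := by
  simp [updateKBdry]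

lemma updateKBdry_bdry_Kext_same : ((P.updateKBdry τ k s S).bdry s).Kext =
    if (S.bdry s).tSync = τ then P.extNow k S s else max (S.bdry s).Kext (P.extNow k S s) := by
  simp [updateKBdry]

lemma updateKBdry_both_Kint :
    ((P.updateKBdry τ k .right (P.updateKBdry τ k .left S)).bdry s).Kint =
      if S.tFloor = τ then P.intNow k S s else max (S.bdry s).Kint (P.intNow k S s) := by
  cases s
  · rw [updateKBdry_bdry_of_ne (by simp), updateKBdry_bdry_Kint_same]
  · rw [updateKBdry_bdry_Kint_same, updateKBdry_bdry_of_ne (by simp), updateKBdry_tFloor,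
      intNow_congr (S := P.updateKBdry τ k .left S) (S' := S) ⟨rfl, by simp⟩]

lemma updateKBdry_both_Kext :
    ((P.updateKBdry τ k .right (P.updateKBdry τ k .left S)).bdry s).Kext =
      if (S.bdry s).tSync = τ then P.extNow k S s
        else max (S.bdry s).Kext (P.extNow k S s) := by
  cases s
  · rw [updateKBdry_bdry_of_ne (by simp), updateKBdry_bdry_Kext_same]
  · rw [updateKBdry_bdry_Kext_same, updateKBdry_bdry_of_ne (by simp),
      extNow_congr (S := P.updateKBdry τ k .left S) (S' := S) ⟨rfl, by simp⟩]

/-! ### The effect of an update on a submesh -/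

lemma advance_u {j : Fin n} (hj : j ∈ P.cells k) : (P.advance τ k S).u j = S.u j + (1 / P.dx j) *
    ((if j = P.first k then P.fluxUpTo τ k .left S
        else ((τ : ℝ) - S.tFloor) * P.dt * P.F (S.u (j - 1)) (S.u j)) -
      (if j = P.last k then P.fluxUpTo τ k .right S
        else ((τ : ℝ) - S.tFloor) * P.dt * P.F (S.u j) (S.u (j + 1)))) := by
  simp only [advance, updateKBdry_u, hj, if_true, accumulate_both_sumF]

lemma advance_bdry_tFloor : ((P.advance τ k S).bdry s).tFloor = (S.bdry s).tFloor := by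
  simp [advance]

lemma advance_bdry_u : ((P.advance τ k S).bdry s).u = (S.bdry s).u := by
  simp [advance]

lemma advance_bdry_sumF : ((P.advance τ k S).bdry s).sumF = 0 := by
  simp [advance]

lemma advance_bdry_tSync : ((P.advance τ k S).bdry s).tSync =
    if (S.bdry s).tFloor = τ then τ else (S.bdry s).tSync := by
  simp [advance]

lemma advance_bdry_Kint :
    ((P.advance τ k S).bdry s).Kint = P.intNow k (P.advance τ k S) s := by
  conv_lhs => rw [advance]
  rw [updateKBdry_both_Kint, if_pos rfl]
  exact intNow_congr ⟨by simp [advance], by simp [advance]⟩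

lemma advance_bdry_Kext : ((P.advance τ k S).bdry s).Kext =
    if ((P.advance τ k S).bdry s).tSync = τ then P.extNow k (P.advance τ k S) s
      else max (S.bdry s).Kext (P.extNow k (P.advance τ k S) s) := by
  rw [advance_bdry_tSync]
  conv_lhs => rw [advance]
  rw [updateKBdry_both_Kext]
  have h : ∀ S' : Submesh n, SameView S' (P.advance τ k S) s →
      P.extNow k S' s = P.extNow k (P.advance τ k S) s := fun S' h => extNow_congr h
  rw [h _ ⟨by simp [advance], by simp [advance]⟩]
  simp

variable (P) [NeZero M]

open Classical in
/-- Whether an update of submesh `k` at time `τ` forces an update of its neighbor on side `s`. -/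
def forcing (τ : ℕ) (k : Fin M) (S : Submesh n) (s : Side) : Bool :=
  decide (((P.advance τ k S).bdry s).tSync < ((P.advance τ k S).bdry s).tFloor ∨
    P.computeTNextBdry (P.advance τ k S) s ≤ τ)

/-- The state of submesh `k` after an update at time `τ`. -/
def updated (τ : ℕ) (k : Fin M) (S : Submesh n) : Submesh n :=
  { P.advance τ k S with
    tCeil := P.computeTNext k (P.advance τ k S)
    bdry := fun s => { (P.advance τ k S).bdry s with
      tSync := if P.forcing τ k S s = true then τ else ((P.advance τ k S).bdry s).tSync } }

/-- The push scheduled on side `s` by an update of submesh `k` at time `τ`. -/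
def pushEvent (τ : ℕ) (k : Fin M) (S : Submesh n) (s : Side) : ℕ × Event M :=
  (τ, .pushFlux (neigh k s) s.opp ((P.updated τ k S).u (P.bdryCell k s)) (P.forcing τ k S s))

lemma execUpdate_of_ne {c : Config n M} {forced : Bool}
    (h : τ ≠ (c.sub k).tCeil ∧ forced = false) : P.execUpdate τ k forced c = c := by
  rw [execUpdate, if_pos h]

lemma execUpdate_of_eq {c : Config n M} {forced : Bool}
    (h : τ = (c.sub k).tFloor) : P.execUpdate τ k forced c = c := by
  rw [execUpdate, if_pos h]
  split_ifs <;> rfl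

open Classical in
lemma execUpdate_of_run {c : Config n M} {forced : Bool}
    (h : ¬ (τ ≠ (c.sub k).tCeil ∧ forced = false)) (h' : τ ≠ (c.sub k).tFloor) :
    P.execUpdate τ k forced c =
      { sub := Function.update c.sub k (P.updated τ k (c.sub k))
        queue := c.queue + {P.pushEvent τ k (c.sub k) .left, P.pushEvent τ k (c.sub k) .right} +
          (if τ < (P.updated τ k (c.sub k)).tCeil then
            {((P.updated τ k (c.sub k)).tCeil, .update k false)} else 0)
        trace := c.trace ∪
          {e | ∃ j ∈ P.cells k, e = (j, (τ : ℝ) * P.dt, (P.updated τ k (c.sub k)).u j)} } := by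
  rw [execUpdate, if_neg h, if_neg h']
  rfl

/-! ### The effect of a push on a submesh -/

/-- The state of submesh `k` after a push on side `s` at time `τ`. -/
def received (τ : ℕ) (k : Fin M) (s : Side) (msg : ℝ) (S : Submesh n) : Submesh n :=
  let S₁ := P.accumulate τ k s S
  let i := S₁.bdry s
  let S₂ := S₁.setBdry s { i with
    u := msg
    tFloor := τ
    tSync := if τ = S₁.tFloor then τ else i.tSync }
  let S₃ := P.updateKBdry τ k s S₂
  { S₃ with tCeil := P.computeTNext k S₃ }

open Classical in
lemma execPushFlux_eq (msg : ℝ) (force : Bool) (c : Config n M) :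
    P.execPushFlux τ k s msg force c =
      let c₁ : Config n M :=
        { c with sub := Function.update c.sub k (P.received τ k s msg (c.sub k)) }
      let c₂ := if force = true ∨ (P.received τ k s msg (c.sub k)).tCeil ≤ τ then
        P.execUpdate τ k true c₁ else c₁
      { c₂ with
        queue := c₂.queue +
          (if τ < (c₂.sub k).tCeil then {((c₂.sub k).tCeil, .update k false)} else 0) } := rfl

variable {P} {msg : ℝ}

lemma received_tFloor : (P.received τ k s msg S).tFloor = S.tFloor := rfl

lemma received_u : (P.received τ k s msg S).u = S.u := rfl

lemma received_bdry_of_ne (h : s' ≠ s) : (P.received τ k s msg S).bdry s' = S.bdry s' := by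
  simp [received, updateKBdry_bdry_of_ne h, Submesh.setBdry_bdry_of_ne _ _ h,
    accumulate_bdry_of_ne h]

lemma received_bdry_tFloor : ((P.received τ k s msg S).bdry s).tFloor = τ := by
  simp [received]

lemma received_bdry_u : ((P.received τ k s msg S).bdry s).u = msg := by
  simp [received]

lemma received_bdry_sumF :
    ((P.received τ k s msg S).bdry s).sumF = P.fluxUpTo τ k s S := by
  simp [received, accumulate_bdry_sumF_same]

lemma received_bdry_tSync : ((P.received τ k s msg S).bdry s).tSync =
    if τ = S.tFloor then τ else (S.bdry s).tSync := by
  simp [received]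

lemma received_bdry_Kint : ((P.received τ k s msg S).bdry s).Kint =
    if S.tFloor = τ then P.intNow k (P.received τ k s msg S) s
      else max (S.bdry s).Kint (P.intNow k (P.received τ k s msg S) s) := by
  have h : ∀ S' : Submesh n, SameView S' (P.received τ k s msg S) s →
      P.intNow k S' s = P.intNow k (P.received τ k s msg S) s := fun S' h => intNow_congr h
  conv_lhs => rw [received]
  simp only [updateKBdry_bdry_Kint_same]
  rw [h _ ⟨by simp [received], by simp [received]⟩]
  simp

lemma received_bdry_Kext : ((P.received τ k s msg S).bdry s).Kext =
    if ((P.received τ k s msg S).bdry s).tSync = τ then P.extNow k (P.received τ k s msg S) s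
      else max (S.bdry s).Kext (P.extNow k (P.received τ k s msg S) s) := by
  have h : ∀ S' : Submesh n, SameView S' (P.received τ k s msg S) s →
      P.extNow k S' s = P.extNow k (P.received τ k s msg S) s := fun S' h => extNow_congr h
  rw [received_bdry_tSync]
  conv_lhs => rw [received]
  simp only [updateKBdry_bdry_Kext_same]
  rw [h _ ⟨by simp [received], by simp [received]⟩]
  simp

lemma computeTNextBdry_congr (h : S.tFloor = S'.tFloor) (hs : (S.bdry s).tSync = (S'.bdry s).tSync)
    (hi : (S.bdry s).Kint = (S'.bdry s).Kint) (he : (S.bdry s).Kext = (S'.bdry s).Kext) :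
    P.computeTNextBdry S s = P.computeTNextBdry S' s := by
  simp only [computeTNextBdry, h, hs, hi, he]

lemma received_tCeil : (P.received τ k s msg S).tCeil =
    P.computeTNext k (P.received τ k s msg S) := rfl

lemma updated_tFloor : (P.updated τ k S).tFloor = τ := rfl

lemma updated_u : (P.updated τ k S).u = (P.advance τ k S).u := rfl

lemma updated_bdry : (P.updated τ k S).bdry s = { (P.advance τ k S).bdry s with
    tSync := if P.forcing τ k S s = true then τ else ((P.advance τ k S).bdry s).tSync } := rfl

lemma updated_bdry_tFloor : ((P.updated τ k S).bdry s).tFloor = (S.bdry s).tFloor := by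
  rw [updated_bdry]
  exact advance_bdry_tFloor

lemma updated_bdry_u : ((P.updated τ k S).bdry s).u = (S.bdry s).u := by
  rw [updated_bdry]
  exact advance_bdry_u

lemma updated_bdry_sumF : ((P.updated τ k S).bdry s).sumF = 0 := by
  rw [updated_bdry]
  exact advance_bdry_sumF

lemma sameView_advance_updated : SameView (P.advance τ k S) (P.updated τ k S) s :=
  ⟨by rw [updated_u], by rw [updated_bdry]⟩

lemma updated_bdry_tSync : ((P.updated τ k S).bdry s).tSync =
    if P.forcing τ k S s = true ∨ (S.bdry s).tFloor = τ then τ else (S.bdry s).tSync := by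
  rw [updated_bdry]
  by_cases h : P.forcing τ k S s = true <;> simp [h, advance_bdry_tSync]

lemma updated_bdry_Kint :
    ((P.updated τ k S).bdry s).Kint = P.intNow k (P.updated τ k S) s := by
  rw [← intNow_congr sameView_advance_updated, ← advance_bdry_Kint, updated_bdry]

lemma updated_bdry_Kext : ((P.updated τ k S).bdry s).Kext =
    if ((P.advance τ k S).bdry s).tSync = τ then P.extNow k (P.updated τ k S) s
      else max (S.bdry s).Kext (P.extNow k (P.updated τ k S) s) := by
  rw [← extNow_congr sameView_advance_updated, ← advance_bdry_Kext, updated_bdry]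

lemma updated_tCeil : (P.updated τ k S).tCeil = P.computeTNext k (P.advance τ k S) := rfl

/-- The plan is made before a forcing push resets `tSync`. This makes no difference if nothing is
forced on that side, or if `tSync` was already set to τ because the neighbor is known to be at τ. -/
lemma computeTNextBdry_advance
    (h : P.forcing τ k S s = false ∨ (S.bdry s).tFloor = τ) :
    P.computeTNextBdry (P.advance τ k S) s = P.computeTNextBdry (P.updated τ k S) s := by
  refine computeTNextBdry_congr rfl ?_ (by rw [updated_bdry]) (by rw [updated_bdry])
  rw [advance_bdry_tSync, updated_bdry_tSync]
  rcases h with h | h <;> simp [h]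

lemma computeTNextInt_advance :
    P.computeTNextInt k (P.advance τ k S) = P.computeTNextInt k (P.updated τ k S) := rfl

lemma lt_computeTNextBdry_of_not_forcing (h : P.forcing τ k S s = false) :
    τ < P.computeTNextBdry (P.updated τ k S) s := by
  rw [← computeTNextBdry_advance (Or.inl h)]
  simp only [forcing, decide_eq_false_iff_not, not_or, not_le] at h
  exact h.2

lemma tFloor_le_of_not_forcing (h : P.forcing τ k S s = false) (h' : (S.bdry s).tFloor ≠ τ) :
    (S.bdry s).tFloor ≤ (S.bdry s).tSync := by
  simp only [forcing, decide_eq_false_iff_not, not_or, not_lt, advance_bdry_tSync,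
    advance_bdry_tFloor, h', if_false] at h
  exact h.1

end Local

end Sim

end LocalTimestepping

namespace LocalTimestepping

namespace Sim

variable {n M : ℕ} [NeZero n] [NeZero M] (P : Sim n M)

/-! ### Neighbors -/

lemma neigh_neigh_opp (k : Fin M) (s : Side) : neigh (neigh k s) s.opp = k := by
  cases s <;> simp [neigh, Side.opp]

/-- Changing the state of k leaves its neighbors alone. For M = 2 the two neighbors coincide, so a
push must be addressed to a submesh together with a side. -/
lemma neigh_ne (hM : 2 ≤ M) (k : Fin M) (s : Side) : neigh k s ≠ k := by
  have h1 : (1 : Fin M) ≠ 0 := by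
    rw [ne_eq, Fin.ext_iff, Fin.val_one', Fin.val_zero, Nat.mod_eq_of_lt hM]
    exact one_ne_zero
  cases s
  · simpa [neigh, sub_eq_self] using h1
  · simpa [neigh] using h1

/-- The cell beyond side `s` of submesh `k`. -/
def outer (k : Fin M) : Side → Fin n
  | .left => P.first k - 1
  | .right => P.last k + 1

lemma outer_eq (k : Fin M) (s : Side) : P.outer k s = P.bdryCell (neigh k s) s.opp := by
  cases s
  · exact P.first_sub_one k
  · exact P.last_add_one k

lemma bdryCell_mem (k : Fin M) (s : Side) : P.bdryCell k s ∈ P.cells k := by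
  cases s
  · exact P.first_mem k
  · exact P.last_mem k

lemma outer_mem (k : Fin M) (s : Side) : P.outer k s ∈ P.cells (neigh k s) :=
  P.outer_eq k s ▸ P.bdryCell_mem _ _

lemma outer_neigh (k : Fin M) (s : Side) : P.outer (neigh k s) s.opp = P.bdryCell k s := by
  rw [outer_eq, neigh_neigh_opp, Side.opp_opp]

/-- The value of the bound at the interface on side `s` for given cell averages. -/
def extV (k : Fin M) (s : Side) (v : Fin n → ℝ) : ℝ :=
  match s with
  | .left => -cellC P.F P.dx (P.first k) v
  | .right => cellD P.F P.dx (P.last k) v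

/-- The value of the bound at the interior interface next to side `s` for given cell averages. -/
def intV (k : Fin M) (s : Side) (v : Fin n → ℝ) : ℝ :=
  match s with
  | .left => cellD P.F P.dx (P.first k) v
  | .right => -cellC P.F P.dx (P.last k) v

/-- The flux through side `s` for given cell averages. -/
def fluxV (k : Fin M) (s : Side) (v : Fin n → ℝ) : ℝ :=
  match s with
  | .left => P.F (v (P.first k - 1)) (v (P.first k))
  | .right => P.F (v (P.last k)) (v (P.last k + 1))

/-! ### Bounds and fluxes seen by a submesh, in terms of the global cell averages -/

section View

variable {P} {k : Fin M} {S : Submesh n} {s : Side} {v : Fin n → ℝ}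

lemma extNow_eq (hu : ∀ j ∈ P.cells k, S.u j = v j) (hb : (S.bdry s).u = v (P.outer k s)) :
    P.extNow k S s = P.extV k s v := by
  have h1 := P.first_mem k
  have h2 := P.last_mem k
  have h3 := P.add_one_mem h1 (P.first_ne_last k)
  have h4 := P.sub_one_mem h2 (P.first_ne_last k).symm
  cases s
  · simp only [extNow, negC, uLeft, uRight, P.first_ne_last k, if_true, if_false, hb, extV, cellC,
      hu _ h1, hu _ h3, outer]
  · simp only [extNow, posD, uLeft, uRight, (P.first_ne_last k).symm, if_true, if_false, hb, extV,
      cellD, hu _ h2, hu _ h4, outer]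

lemma intNow_eq (hu : ∀ j ∈ P.cells k, S.u j = v j) (hb : (S.bdry s).u = v (P.outer k s)) :
    P.intNow k S s = P.intV k s v := by
  have h1 := P.first_mem k
  have h2 := P.last_mem k
  have h3 := P.add_one_mem h1 (P.first_ne_last k)
  have h4 := P.sub_one_mem h2 (P.first_ne_last k).symm
  cases s
  · simp only [intNow, posD, uLeft, uRight, P.first_ne_last k, if_true, if_false, hb, intV, cellD,
      hu _ h1, hu _ h3, outer]
  · simp only [intNow, negC, uLeft, uRight, (P.first_ne_last k).symm, if_true, if_false, hb, intV,
      cellC, hu _ h2, hu _ h4, outer]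

lemma bdryFlux_eq (hu : ∀ j ∈ P.cells k, S.u j = v j) (hb : (S.bdry s).u = v (P.outer k s)) :
    P.bdryFlux k S s = P.fluxV k s v := by
  cases s
  · simp only [bdryFlux, fluxV, hb, hu _ (P.first_mem k), outer]
  · simp only [bdryFlux, fluxV, hb, hu _ (P.last_mem k), outer]

lemma negC_eq (hu : ∀ j ∈ P.cells k, S.u j = v j) {j : Fin n} (hj : j ∈ P.cells k)
    (h1 : j ≠ P.first k) (h2 : j ≠ P.last k) : P.negC k S j = -cellC P.F P.dx j v := by
  simp only [negC, uLeft, uRight, h1, h2, if_false, cellC, hu _ hj, hu _ (P.add_one_mem hj h2),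
    hu _ (P.sub_one_mem hj h1)]

lemma posD_eq (hu : ∀ j ∈ P.cells k, S.u j = v j) {j : Fin n} (hj : j ∈ P.cells k)
    (h1 : j ≠ P.first k) (h2 : j ≠ P.last k) : P.posD k S j = cellD P.F P.dx j v := by
  simp only [posD, uLeft, uRight, h1, h2, if_false, cellD, hu _ hj, hu _ (P.add_one_mem hj h2),
    hu _ (P.sub_one_mem hj h1)]

end View

/-! ### Admissible simulations -/

/-- The standing assumptions on a simulation whose values stay in `[lo, hi]`. -/
structure Admissible (f : ℝ → ℝ) (lo hi : ℝ) : Prop where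
  two_le : 2 ≤ M
  flux : IsNumericalFlux f P.F
  dt_pos : 0 < P.dt
  half : HalfCFL P.F (Set.Icc lo hi) P.dt P.minDx

section Bounds

variable {P} {f : ℝ → ℝ} {lo hi : ℝ} {k : Fin M} {S : Submesh n} {s : Side} {τ t : ℕ}

lemma Admissible.negC_nonneg (hP : P.Admissible f lo hi) (j : Fin n) : 0 ≤ P.negC k S j :=
  neg_nonneg.2 (coeffC_nonpos hP.flux (P.dx_pos j) _ _ _)

lemma Admissible.posD_nonneg (hP : P.Admissible f lo hi) (j : Fin n) : 0 ≤ P.posD k S j :=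
  coeffD_nonneg hP.flux (P.dx_pos j) _ _ _

lemma Admissible.extNow_nonneg (hP : P.Admissible f lo hi) : 0 ≤ P.extNow k S s := by
  cases s
  · exact hP.negC_nonneg _
  · exact hP.posD_nonneg _

lemma Admissible.intNow_nonneg (hP : P.Admissible f lo hi) : 0 ≤ P.intNow k S s := by
  cases s
  · exact hP.posD_nonneg _
  · exact hP.negC_nonneg _

lemma Admissible.negC_cellC_nonneg (hP : P.Admissible f lo hi) (j : Fin n) (v : Fin n → ℝ) :
    0 ≤ -cellC P.F P.dx j v :=
  neg_nonneg.2 (coeffC_nonpos hP.flux (P.dx_pos j) _ _ _)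

lemma Admissible.cellD_nonneg (hP : P.Admissible f lo hi) (j : Fin n) (v : Fin n → ℝ) :
    0 ≤ cellD P.F P.dx j v :=
  coeffD_nonneg hP.flux (P.dx_pos j) _ _ _

lemma Admissible.extV_nonneg (hP : P.Admissible f lo hi) (v : Fin n → ℝ) :
    0 ≤ P.extV k s v := by
  cases s
  · exact hP.negC_cellC_nonneg _ _
  · exact hP.cellD_nonneg _ _

section InRange

variable (hP : P.Admissible f lo hi) (hu : ∀ j ∈ P.cells k, S.u j ∈ Set.Icc lo hi)
  (hb : ∀ s, (S.bdry s).u ∈ Set.Icc lo hi)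

include hu hb

lemma uLeft_mem {j : Fin n} (hj : j ∈ P.cells k) : P.uLeft k S j ∈ Set.Icc lo hi := by
  rw [uLeft]
  split_ifs with h
  · exact hb _
  · exact hu _ (P.sub_one_mem hj h)

lemma uRight_mem {j : Fin n} (hj : j ∈ P.cells k) : P.uRight k S j ∈ Set.Icc lo hi := by
  rw [uRight]
  split_ifs with h
  · exact hb _
  · exact hu _ (P.add_one_mem hj h)

include hP

lemma Admissible.dt_mul_negC_le {j : Fin n} (hj : j ∈ P.cells k) :
    P.dt * P.negC k S j ≤ 1 / 2 :=
  mul_neg_coeffC_le hP.half hP.dt_pos (P.dx_pos j) (P.minDx_le j) (uLeft_mem hu hb hj) (hu _ hj)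
    (uRight_mem hu hb hj)

lemma Admissible.dt_mul_posD_le {j : Fin n} (hj : j ∈ P.cells k) :
    P.dt * P.posD k S j ≤ 1 / 2 :=
  mul_coeffD_le hP.half hP.dt_pos (P.dx_pos j) (P.minDx_le j) (uLeft_mem hu hb hj) (hu _ hj)
    (uRight_mem hu hb hj)

lemma Admissible.dt_mul_extNow_le : P.dt * P.extNow k S s ≤ 1 / 2 := by
  cases s
  · exact hP.dt_mul_negC_le hu hb (P.first_mem k)
  · exact hP.dt_mul_posD_le hu hb (P.last_mem k)

lemma Admissible.dt_mul_intNow_le : P.dt * P.intNow k S s ≤ 1 / 2 := by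
  cases s
  · exact hP.dt_mul_posD_le hu hb (P.first_mem k)
  · exact hP.dt_mul_negC_le hu hb (P.last_mem k)

end InRange

/-! ### The planned update times -/

lemma computeTNextBdry_le_N : P.computeTNextBdry S s ≤ P.N := Nat.findGreatest_le _

lemma computeTNext_le_N : P.computeTNext k S ≤ P.N :=
  (min_le_left _ _).trans ((min_le_left _ _).trans computeTNextBdry_le_N)

lemma computeTNext_le_bdry (s : Side) : P.computeTNext k S ≤ P.computeTNextBdry S s := by
  cases s
  · exact (min_le_left _ _).trans (min_le_left _ _)
  · exact (min_le_left _ _).trans (min_le_right _ _)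

lemma computeTNext_le_int : P.computeTNext k S ≤ P.computeTNextInt k S := min_le_right _ _

lemma lt_computeTNext (hb : ∀ s, τ < P.computeTNextBdry S s) (hi : τ < P.computeTNextInt k S) :
    τ < P.computeTNext k S :=
  lt_min (lt_min (hb _) (hb _)) hi

lemma mul_le_of_le_of_nonneg {a b c K B : ℝ} (hab : a ≤ b) (hK : 0 ≤ K) (h : (b - c) * K ≤ B) :
    (a - c) * K ≤ B :=
  (mul_le_mul_of_nonneg_right (by linarith) hK).trans h

/-- Time 0 is always allowed, because the bounds are nonnegative and 0 precedes the reference times.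
Hence `Nat.findGreatest` returns an allowed time, and earlier times inherit the inequalities. -/
lemma le_half_of_le_computeTNextBdry (hdt : 0 < P.dt) (hi : 0 ≤ (S.bdry s).Kint)
    (he : 0 ≤ (S.bdry s).Kext) (h : t ≤ P.computeTNextBdry S s) :
    ((t : ℝ) - (S.bdry s).tSync) * (P.dt * (S.bdry s).Kext) ≤ 1 / 2 ∧
      ((t : ℝ) - S.tFloor) * (P.dt * (S.bdry s).Kint) ≤ 1 / 2 := by
  classical
  have h0 : ∀ (c : ℕ) (K : ℝ), 0 ≤ K → (((0 : ℕ) : ℝ) - c) * P.dt * K ≤ 1 / 2 := by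
    intro c K hK
    have h1 : (0 : ℝ) ≤ (c : ℝ) * P.dt * K := by positivity
    push_cast
    linarith
  have hspec := Nat.findGreatest_spec (P := fun t : ℕ =>
    ((t : ℝ) - (S.bdry s).tSync) * P.dt * (S.bdry s).Kext ≤ 1 / 2 ∧
      ((t : ℝ) - S.tFloor) * P.dt * (S.bdry s).Kint ≤ 1 / 2) (Nat.zero_le P.N)
    ⟨h0 _ _ he, h0 _ _ hi⟩
  simp only [mul_assoc] at hspec
  have ht : (t : ℝ) ≤ P.computeTNextBdry S s := by exact_mod_cast h
  refine ⟨mul_le_of_le_of_nonneg ht (by positivity) ?_,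
    mul_le_of_le_of_nonneg ht (by positivity) ?_⟩
  · simpa only [computeTNextBdry, mul_assoc] using hspec.1
  · simpa only [computeTNextBdry, mul_assoc] using hspec.2

/-- With both reference times at τ, one further step costs a single `dt`, which `HalfCFL` permits
for values in range. This is what keeps synchronized submeshes from stalling. -/
lemma lt_computeTNextBdry (hN : τ < P.N) (hf : S.tFloor = τ) (hs : (S.bdry s).tSync = τ)
    (hi : P.dt * (S.bdry s).Kint ≤ 1 / 2) (he : P.dt * (S.bdry s).Kext ≤ 1 / 2) :
    τ < P.computeTNextBdry S s := by
  classical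
  refine Nat.lt_of_succ_le (Nat.le_findGreatest hN ?_)
  rw [hf, hs]
  push_cast
  simpa only [add_sub_cancel_left, one_mul] using And.intro he hi

lemma Admissible.le_half_of_le_computeTNextInt (hP : P.Admissible f lo hi)
    (h : t ≤ P.computeTNextInt k S) {j : Fin n} (hj : j ∈ P.cells k) (h1 : j ≠ P.first k)
    (h2 : j ≠ P.last k) :
    ((t : ℝ) - S.tFloor) * (P.dt * P.negC k S j) ≤ 1 / 2 ∧
      ((t : ℝ) - S.tFloor) * (P.dt * P.posD k S j) ≤ 1 / 2 := by
  classical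
  have hdt := hP.dt_pos
  have hm0 : ∀ j, 0 ≤ max (P.negC k S j) (P.posD k S j) := fun j =>
    le_max_of_le_left (hP.negC_nonneg j)
  have hspec := Nat.findGreatest_spec (P := fun t : ℕ => ∀ j ∈ P.cells k, j ≠ P.first k →
    j ≠ P.last k → ((t : ℝ) - S.tFloor) * P.dt * max (P.negC k S j) (P.posD k S j) ≤ 1 / 2)
    (Nat.zero_le P.N) (by
      intro j _ _ _
      have h1 : (0 : ℝ) ≤ (S.tFloor : ℝ) * P.dt * max (P.negC k S j) (P.posD k S j) :=
        mul_nonneg (by positivity) (hm0 j)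
      push_cast
      linarith)
  have hmax : ((t : ℝ) - S.tFloor) * (P.dt * max (P.negC k S j) (P.posD k S j)) ≤ 1 / 2 := by
    refine mul_le_of_le_of_nonneg (b := P.computeTNextInt k S) (by exact_mod_cast h)
      (mul_nonneg hdt.le (hm0 j)) ?_
    simpa only [computeTNextInt, mul_assoc] using hspec j hj h1 h2
  have aux : ∀ X, 0 ≤ X → X ≤ max (P.negC k S j) (P.posD k S j) →
      ((t : ℝ) - S.tFloor) * (P.dt * X) ≤ 1 / 2 := by
    intro X hX0 hX
    rcases le_total 0 ((t : ℝ) - S.tFloor) with h0 | h0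
    · refine le_trans ?_ hmax
      gcongr
    · exact (mul_nonpos_of_nonpos_of_nonneg h0 (by positivity)).trans (by norm_num)
  exact ⟨aux _ (hP.negC_nonneg j) (le_max_left _ _), aux _ (hP.posD_nonneg j) (le_max_right _ _)⟩

lemma Admissible.lt_computeTNextInt (hP : P.Admissible f lo hi) (hN : τ < P.N)
    (hf : S.tFloor = τ) (hu : ∀ j ∈ P.cells k, S.u j ∈ Set.Icc lo hi)
    (hb : ∀ s, (S.bdry s).u ∈ Set.Icc lo hi) : τ < P.computeTNextInt k S := by
  classical
  refine Nat.lt_of_succ_le (Nat.le_findGreatest hN ?_)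
  intro j hj _ _
  rw [hf]
  push_cast
  rw [add_sub_cancel_left, one_mul, mul_max_of_nonneg _ _ hP.dt_pos.le]
  exact max_le (hP.dt_mul_negC_le hu hb hj) (hP.dt_mul_posD_le hu hb hj)

/-- Needed because forcing moves `tSync` forward after `tCeil` has been computed: the plan already
stored is then at worst too cautious. -/
lemma computeTNextBdry_mono_tSync {S S' : Submesh n} (hdt : 0 < P.dt) (hf : S'.tFloor = S.tFloor)
    (hs : (S.bdry s).tSync ≤ (S'.bdry s).tSync) (hi : (S'.bdry s).Kint = (S.bdry s).Kint)
    (he : (S'.bdry s).Kext = (S.bdry s).Kext) (he0 : 0 ≤ (S.bdry s).Kext) :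
    P.computeTNextBdry S s ≤ P.computeTNextBdry S' s := by
  classical
  refine Nat.findGreatest_mono_left (fun t ht => ?_) P.N
  rw [hf, hi, he]
  refine ⟨le_trans ?_ ht.1, ht.2⟩
  have : ((S.bdry s).tSync : ℝ) ≤ (S'.bdry s).tSync := by exact_mod_cast hs
  gcongr

end Bounds

/-! ### The maximum principle -/

/-- A forward Euler step under a CFL condition on each side keeps the values in `[lo, hi]`. -/
lemma Admissible.step_mem_Icc {P : Sim n M} {f : ℝ → ℝ} {lo hi : ℝ} (hP : P.Admissible f lo hi)
    {V : ℕ → Fin n → ℝ} {j : Fin n} {a b : ℕ} (hab : a < b)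
    (hV : ∀ t i, t < b → V t i ∈ Set.Icc lo hi) (hconst : ∀ t, a ≤ t → t < b → V t j = V a j)
    (hC : ∀ t, a ≤ t → t < b → ((b : ℝ) - a) * (P.dt * -cellC P.F P.dx j (V t)) ≤ 1 / 2)
    (hD : ∀ t, a ≤ t → t < b → ((b : ℝ) - a) * (P.dt * cellD P.F P.dx j (V t)) ≤ 1 / 2) :
    V a j + P.dt / P.dx j * ∑ t ∈ Finset.Ico a b,
      (P.F (V t (j - 1)) (V a j) - P.F (V a j) (V t (j + 1))) ∈ Set.Icc lo hi := by
  have hba : (0 : ℝ) < (b : ℝ) - a := sub_pos.2 (by exact_mod_cast hab)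
  set p : ℕ → ℝ := fun t => P.dt * cellD P.F P.dx j (V t)
  set q : ℕ → ℝ := fun t => P.dt * -cellC P.F P.dx j (V t)
  have hp0 : ∀ t, 0 ≤ p t := fun t => mul_nonneg hP.dt_pos.le (hP.cellD_nonneg _ _)
  have hq0 : ∀ t, 0 ≤ q t := fun t => mul_nonneg hP.dt_pos.le (hP.negC_cellC_nonneg _ _)
  have hterm : P.dt / P.dx j * ∑ t ∈ Finset.Ico a b,
      (P.F (V t (j - 1)) (V a j) - P.F (V a j) (V t (j + 1))) =
      ∑ t ∈ Finset.Ico a b, (p t * (V t (j + 1) - V a j) + q t * (V t (j - 1) - V a j)) := by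
    rw [Finset.mul_sum]
    refine Finset.sum_congr rfl fun t ht => ?_
    rw [Finset.mem_Ico] at ht
    have e1 := coeffC_mul (F := P.F) (P.dx_pos j) (V t (j - 1)) (V t j) (V t (j + 1))
    have e2 := coeffD_mul (F := P.F) (P.dx_pos j) (V t (j - 1)) (V t j) (V t (j + 1))
    have e3 : p t * (V t (j + 1) - V t j) + q t * (V t (j - 1) - V t j) =
        P.dt * (coeffD P.F (P.dx j) (V t (j - 1)) (V t j) (V t (j + 1)) *
          (V t (j + 1) - V t j)) +
        P.dt * (coeffC P.F (P.dx j) (V t (j - 1)) (V t j) (V t (j + 1)) *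
          (V t j - V t (j - 1))) := by
      simp only [p, q, cellC, cellD]
      ring
    rw [← hconst t ht.1 ht.2, e3, e1, e2]
    ring
  -- Each of p and q is at most 1 / (2(b - a)), so the weights over the whole step sum to at most 1
  -- and the new value is a convex combination of old ones.
  have hsum : ∑ t ∈ Finset.Ico a b, (p t + q t) ≤ 1 := by
    have h1 : ((b : ℝ) - a) * ∑ t ∈ Finset.Ico a b, (p t + q t) ≤ (b : ℝ) - a := by
      rw [Finset.mul_sum]
      refine (Finset.sum_le_card_nsmul _ _ 1 fun t ht => ?_).trans_eq ?_
      · rw [Finset.mem_Ico] at ht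
        have e1 : ((b : ℝ) - a) * q t ≤ 1 / 2 := hC t ht.1 ht.2
        have e2 : ((b : ℝ) - a) * p t ≤ 1 / 2 := hD t ht.1 ht.2
        linarith
      · rw [nsmul_eq_mul, Nat.card_Ico, Nat.cast_sub hab.le, mul_one]
    by_contra hcon
    nlinarith
  have hw := hV a j hab
  rw [hterm]
  constructor
  · have : (∑ t ∈ Finset.Ico a b, (p t + q t)) * (lo - V a j) ≤
        ∑ t ∈ Finset.Ico a b, (p t * (V t (j + 1) - V a j) + q t * (V t (j - 1) - V a j)) := by
      rw [Finset.sum_mul]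
      refine Finset.sum_le_sum fun t ht => ?_
      rw [Finset.mem_Ico] at ht
      have h1 := mul_le_mul_of_nonneg_left (hV t (j + 1) ht.2).1 (hp0 t)
      have h2 := mul_le_mul_of_nonneg_left (hV t (j - 1) ht.2).1 (hq0 t)
      linarith
    nlinarith [hw.1]
  · have : ∑ t ∈ Finset.Ico a b, (p t * (V t (j + 1) - V a j) + q t * (V t (j - 1) - V a j)) ≤
        (∑ t ∈ Finset.Ico a b, (p t + q t)) * (hi - V a j) := by
      rw [Finset.sum_mul]
      refine Finset.sum_le_sum fun t ht => ?_
      rw [Finset.mem_Ico] at ht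
      have h1 := mul_le_mul_of_nonneg_left (hV t (j + 1) ht.2).2 (hp0 t)
      have h2 := mul_le_mul_of_nonneg_left (hV t (j - 1) ht.2).2 (hq0 t)
      linarith
    nlinarith [hw.2]

/-! ### The invariant of the simulation -/

/-- The recorded history up to time `τ`: `T k` are the timestamps of submesh `k`, and `V t j` is the
value of cell `j` at time `t`. -/
structure Hist (lo hi : ℝ) (U₀ : Fin n → ℝ) (τ : ℕ) (T : Fin M → Set ℕ) (V : ℕ → Fin n → ℝ) :
    Prop where
  zero_mem : ∀ k, 0 ∈ T k
  le_now : ∀ k, ∀ t ∈ T k, t ≤ τ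
  const : ∀ k, ∀ j ∈ P.cells k, ∀ t, t + 1 ∉ T k → V (t + 1) j = V t j
  init : V 0 = U₀
  range : ∀ t j, V t j ∈ Set.Icc lo hi
  euler : ∀ k, ∀ j ∈ P.cells k, ∀ a b, a ∈ T k → IsNextIn (T k) a b →
    V b j = V a j + P.dt / P.dx j *
      ∑ t ∈ Finset.Ico a b, (P.F (V t (j - 1)) (V a j) - P.F (V a j) (V t (j + 1)))
  cflInt : ∀ k, ∀ j ∈ P.cells k, ∀ t a b, IsPrevIn (T k) t a → IsNextIn (T k) t b →
    ((b : ℝ) - a) * (P.dt * -cellC P.F P.dx j (V t)) ≤ 1 / 2 ∧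
      ((b : ℝ) - a) * (P.dt * cellD P.F P.dx j (V t)) ≤ 1 / 2
  cflExt : ∀ k s t σ b, IsPrevIn (T k ∩ T (neigh k s)) t σ → IsNextIn (T k) t b →
    ((b : ℝ) - σ) * (P.dt * P.extV k s (V t)) ≤ 1 / 2

/-- A push to submesh `k` on side `s` is in flight. -/
def Pending (Push : Fin M → Side → ℝ → Bool → Prop) (k : Fin M) (s : Side) : Prop :=
  ∃ m f, Push k s m f

/-- Submesh `k` is about to update, or there is a forcing push in flight to it on side `s`. -/
def Forced (A : Fin M → Prop) (Push : Fin M → Side → ℝ → Bool → Prop) (k : Fin M) (s : Side) :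
    Prop :=
  A k ∨ ∃ m, Push k s m true

/-- Submesh `k` will receive a push on side `s` at the current time `τ`. -/
def WillReceive (τ : ℕ) (A : Fin M → Prop) (Push : Fin M → Side → ℝ → Bool → Prop)
    (sub : Fin M → Submesh n) (k : Fin M) (s : Side) : Prop :=
  Pending Push k s ∨ (Forced A Push (neigh k s) s.opp ∧ (sub (neigh k s)).tFloor < τ)

/-- The CFL condition of submesh `k` for a step from its last update to time `τ`. -/
def SafeAt (τ : ℕ) (V : ℕ → Fin n → ℝ) (k : Fin M) (S : Submesh n) : Prop :=
  ∀ t, S.tFloor ≤ t → t < τ →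
    (∀ s, ((τ : ℝ) - (S.bdry s).tSync) * (P.dt * P.extV k s (V t)) ≤ 1 / 2 ∧
      ((τ : ℝ) - S.tFloor) * (P.dt * P.intV k s (V t)) ≤ 1 / 2) ∧
    ∀ j ∈ P.cells k, j ≠ P.first k → j ≠ P.last k →
      ((τ : ℝ) - S.tFloor) * (P.dt * -cellC P.F P.dx j (V t)) ≤ 1 / 2 ∧
      ((τ : ℝ) - S.tFloor) * (P.dt * cellD P.F P.dx j (V t)) ≤ 1 / 2

/-- What submesh `k` in state `S` knows about its neighbor on side `s` is consistent with the
history. -/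
structure SideInv (τ : ℕ) (A : Fin M → Prop) (Push : Fin M → Side → ℝ → Bool → Prop)
    (T : Fin M → Set ℕ) (V : ℕ → Fin n → ℝ) (k : Fin M) (s : Side) (S : Submesh n) : Prop where
  nb_mem : (S.bdry s).tFloor ∈ T (neigh k s)
  -- The only timestamp of the neighbor that may be unknown to k is the current one, and then the
  -- push announcing it is in flight.
  nb_gap : ∀ t ∈ T (neigh k s), t ≤ (S.bdry s).tFloor ∨ (t = τ ∧ Pending Push k s)
  nb_u : (S.bdry s).u = V (S.bdry s).tFloor (P.outer k s)
  push : ∀ m f, Push k s m f → τ ∈ T (neigh k s) ∧ m = V τ (P.outer k s)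
  sumF : (S.bdry s).sumF =
    ∑ t ∈ Finset.Ico S.tFloor (S.bdry s).tFloor, P.dt * P.fluxV k s (V t)
  Kint_ge : ∀ t, S.tFloor ≤ t → t < τ → P.intV k s (V t) ≤ (S.bdry s).Kint
  Kint_now : P.intNow k S s ≤ (S.bdry s).Kint
  Kext_ge : ∀ t, (S.bdry s).tSync ≤ t → t < τ → P.extV k s (V t) ≤ (S.bdry s).Kext
  Kext_now : P.extNow k S s ≤ (S.bdry s).Kext
  sync_mem : (S.bdry s).tSync ∈ T k
  -- The sender of a forcing push records a synchronization at τ before the neighbor has followed.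
  sync_mem_nb : (S.bdry s).tSync ∈ T (neigh k s) ∨
    ((S.bdry s).tSync = τ ∧ Forced A Push (neigh k s) s.opp)
  sync_max : ∀ t ∈ T k, t ∈ T (neigh k s) → t ≤ (S.bdry s).tSync ∨ (t = τ ∧ Pending Push k s)
  -- A common time may be missing only next to a fresh timestamp τ, and only if the other side is
  -- compelled to update at τ as well.
  ordered : ∀ p ∈ T k, ∀ q ∈ T (neigh k s),
    (∃ r, r ∈ T k ∧ r ∈ T (neigh k s) ∧ min p q ≤ r ∧ r ≤ max p q) ∨
    (p = τ ∧ Forced A Push (neigh k s) s.opp) ∨ (q = τ ∧ Forced A Push k s)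

/-- The invariant of the simulation at time `τ`. The submeshes in `A` are about to update; `Push`
and `Upd` are the pushes at time `τ` and the unforced updates in the event queue. -/
structure Inv (lo hi : ℝ) (U₀ : Fin n → ℝ) (τ : ℕ) (A : Fin M → Prop)
    (Push : Fin M → Side → ℝ → Bool → Prop) (Upd : Fin M → ℕ → Prop) (sub : Fin M → Submesh n)
    (T : Fin M → Set ℕ) (V : ℕ → Fin n → ℝ) : Prop extends P.Hist lo hi U₀ τ T V where
  floor_mem : ∀ k, (sub k).tFloor ∈ T k
  le_floor : ∀ k, ∀ t ∈ T k, t ≤ (sub k).tFloor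
  u_eq : ∀ k, ∀ j ∈ P.cells k, (sub k).u j = V (sub k).tFloor j
  side : ∀ k s, P.SideInv τ A Push T V k s (sub k)
  safe : ∀ k, (sub k).tFloor < τ → P.SafeAt τ V k (sub k)
  -- Only an inequality, since forcing may move `tSync` after the plan was made.
  ceil_le : ∀ k, (sub k).tCeil ≤ P.computeTNext k (sub k)
  awake : ∀ k, (sub k).tFloor < τ → A k ∨ Upd k (sub k).tCeil
  -- This clause and the next exclude stalling: a submesh at τ that has no later plan is still going
  -- to receive a push at τ and will then plan again.
  side_ok : ∀ k, (sub k).tFloor = τ → τ < P.N → ∀ s,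
    τ < P.computeTNextBdry (sub k) s ∨ WillReceive τ A Push sub k s
  ceil_ok : ∀ k, (sub k).tFloor = τ → τ < P.N →
    (τ < (sub k).tCeil ∧ Upd k (sub k).tCeil) ∨ ∃ s, WillReceive τ A Push sub k s

end Sim

end LocalTimestepping

namespace LocalTimestepping

namespace Sim

variable {n M : ℕ} [NeZero n] [NeZero M] {P : Sim n M} {f : ℝ → ℝ} {lo hi : ℝ} {U₀ : Fin n → ℝ}
  {τ : ℕ} {A A' : Fin M → Prop} {Push Push' : Fin M → Side → ℝ → Bool → Prop}
  {Upd Upd' : Fin M → ℕ → Prop} {sub : Fin M → Submesh n} {T : Fin M → Set ℕ}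
  {V : ℕ → Fin n → ℝ} {k : Fin M} {s : Side} {S S' : Submesh n}

/-! ### Consequences of the invariant -/

lemma SideInv.u_eq_of_gap (h : P.SideInv τ A Push T V k s S) (hH : P.Hist lo hi U₀ τ T V) {t : ℕ}
    (ht : (S.bdry s).tFloor ≤ t)
    (hgap : ∀ r ∈ T (neigh k s), r ≤ t → r ≤ (S.bdry s).tFloor) :
    (S.bdry s).u = V t (P.outer k s) := by
  rw [h.nb_u]
  exact (eq_of_const (v := fun t => V t (P.outer k s))
    (hH.const _ _ (P.outer_mem k s)) ht hgap).symm

lemma SideInv.u_eq_of_lt (h : P.SideInv τ A Push T V k s S) (hH : P.Hist lo hi U₀ τ T V) {t : ℕ}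
    (ht : (S.bdry s).tFloor ≤ t) (htτ : t < τ) : (S.bdry s).u = V t (P.outer k s) :=
  h.u_eq_of_gap hH ht fun r hr hrt => (h.nb_gap r hr).resolve_right fun h => by omega

lemma SideInv.u_mem (h : P.SideInv τ A Push T V k s S) (hH : P.Hist lo hi U₀ τ T V) :
    (S.bdry s).u ∈ Set.Icc lo hi := by
  rw [h.nb_u]
  exact hH.range _ _

lemma SideInv.Kint_nonneg (h : P.SideInv τ A Push T V k s S) (hP : P.Admissible f lo hi) :
    0 ≤ (S.bdry s).Kint := hP.intNow_nonneg.trans h.Kint_now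

lemma SideInv.Kext_nonneg (h : P.SideInv τ A Push T V k s S) (hP : P.Admissible f lo hi) :
    0 ≤ (S.bdry s).Kext := hP.extNow_nonneg.trans h.Kext_now

/-- The stored integral reaches up to the neighbor's last known update, or is empty if the submesh
itself updated later. From the later of the two times until τ the flux is constant. -/
lemma SideInv.fluxUpTo_eq (h : P.SideInv τ A Push T V k s S) (hH : P.Hist lo hi U₀ τ T V)
    (hτ : S.tFloor ≤ τ) (hu : ∀ t, S.tFloor ≤ t → ∀ j ∈ P.cells k, S.u j = V t j) :
    P.fluxUpTo τ k s S = ∑ t ∈ Finset.Ico S.tFloor τ, P.dt * P.fluxV k s (V t) := by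
  have hnb : (S.bdry s).tFloor ≤ τ := hH.le_now _ _ h.nb_mem
  have h1 : ∑ t ∈ Finset.Ico (max (S.bdry s).tFloor S.tFloor) τ, P.dt * P.fluxV k s (V t) =
      ((τ : ℝ) - max (S.bdry s).tFloor S.tFloor) * P.dt * P.bdryFlux k S s := by
    rw [Finset.sum_congr rfl (g := fun _ => P.dt * P.bdryFlux k S s)]
    · rw [Finset.sum_const, Nat.card_Ico, nsmul_eq_mul, Nat.cast_sub (max_le hnb hτ), Nat.cast_max]
      ring
    · intro t ht
      rw [Finset.mem_Ico, max_le_iff] at ht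
      rw [bdryFlux_eq (hu t ht.1.2) (h.u_eq_of_lt hH ht.1.1 ht.2)]
  rw [fluxUpTo, h.sumF, ← h1]
  rcases le_total (S.bdry s).tFloor S.tFloor with hle | hle
  · rw [Finset.Ico_eq_empty_of_le hle, Finset.sum_empty, zero_add, max_eq_right hle]
  · rw [max_eq_left hle, Finset.sum_Ico_consecutive _ hle hnb]

/-- Transfer of the invariant of a side when other parts of the configuration change. -/
lemma SideInv.transfer (h : P.SideInv τ A Push T V k s S) (hf : S'.tFloor = S.tFloor)
    (hu : S'.u = S.u) (hb : S'.bdry s = S.bdry s)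
    (hpush : ∀ m f, Push' k s m f → Push k s m f)
    (hpend : Pending Push k s → Pending Push' k s)
    (hf1 : Forced A Push (neigh k s) s.opp → Forced A' Push' (neigh k s) s.opp ∨ τ ∈ T (neigh k s))
    (hf2 : Forced A Push k s → Forced A' Push' k s ∨ τ ∈ T k) :
    P.SideInv τ A' Push' T V k s S' where
  nb_mem := hb ▸ h.nb_mem
  nb_gap := by
    rw [hb]
    exact fun t ht => (h.nb_gap t ht).imp id fun h => ⟨h.1, hpend h.2⟩
  nb_u := hb ▸ h.nb_u
  push := fun m f hm => h.push m f (hpush m f hm)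
  sumF := by rw [hb, hf, h.sumF]
  Kint_ge := by rw [hb, hf]; exact h.Kint_ge
  Kint_now := by
    rw [hb, intNow_congr (S' := S) ⟨hu, by rw [hb]⟩]
    exact h.Kint_now
  Kext_ge := by rw [hb]; exact h.Kext_ge
  Kext_now := by
    rw [hb, extNow_congr (S' := S) ⟨hu, by rw [hb]⟩]
    exact h.Kext_now
  sync_mem := hb ▸ h.sync_mem
  sync_mem_nb := by
    rw [hb]
    rcases h.sync_mem_nb with h' | ⟨h1, h2⟩
    · exact Or.inl h'
    · rcases hf1 h2 with h3 | h3
      · exact Or.inr ⟨h1, h3⟩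
      · exact Or.inl (h1 ▸ h3)
  sync_max := by
    rw [hb]
    exact fun t ht ht' => (h.sync_max t ht ht').imp id fun h => ⟨h.1, hpend h.2⟩
  ordered := by
    intro p hp q hq
    rcases h.ordered p hp q hq with h' | ⟨rfl, h'⟩ | ⟨rfl, h'⟩
    · exact Or.inl h'
    · rcases hf1 h' with h3 | h3
      · exact Or.inr (Or.inl ⟨rfl, h3⟩)
      · exact Or.inl ⟨p, hp, h3, min_le_left _ _, le_max_left _ _⟩
    · rcases hf2 h' with h3 | h3
      · exact Or.inr (Or.inr ⟨rfl, h3⟩)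
      · exact Or.inl ⟨q, h3, hq, min_le_right _ _, le_max_right _ _⟩

namespace Inv

lemma floor_le_now (h : P.Inv lo hi U₀ τ A Push Upd sub T V) (k : Fin M) : (sub k).tFloor ≤ τ :=
  h.le_now k _ (h.floor_mem k)

lemma u_eq_of_le (h : P.Inv lo hi U₀ τ A Push Upd sub T V) (k : Fin M) (t : ℕ)
    (ht : (sub k).tFloor ≤ t) (j : Fin n) (hj : j ∈ P.cells k) : (sub k).u j = V t j := by
  rw [h.u_eq k j hj]
  exact (eq_of_const (v := fun t => V t j) (h.const k j hj) ht
    fun r hr _ => h.le_floor k r hr).symm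

lemma u_mem (h : P.Inv lo hi U₀ τ A Push Upd sub T V) (k : Fin M) (j : Fin n)
    (hj : j ∈ P.cells k) : (sub k).u j ∈ Set.Icc lo hi := by
  rw [h.u_eq k j hj]
  exact h.range _ _

lemma bdry_u_mem (h : P.Inv lo hi U₀ τ A Push Upd sub T V) (k : Fin M) (s : Side) :
    ((sub k).bdry s).u ∈ Set.Icc lo hi := (h.side k s).u_mem h.toHist

lemma floor_eq_iff (h : P.Inv lo hi U₀ τ A Push Upd sub T V) (k : Fin M) :
    (sub k).tFloor = τ ↔ τ ∈ T k :=
  ⟨fun e => e ▸ h.floor_mem k, fun e => le_antisymm (h.floor_le_now k) (h.le_floor k τ e)⟩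

lemma sync_le_floor (h : P.Inv lo hi U₀ τ A Push Upd sub T V) (k : Fin M) (s : Side) :
    ((sub k).bdry s).tSync ≤ (sub k).tFloor := h.le_floor k _ (h.side k s).sync_mem

/-! ### Advancing the time -/

/-- When no push is in flight, the time may be advanced up to the next planned update. -/
lemma advance (h : P.Inv lo hi U₀ τ (fun _ => False) Push Upd sub T V)
    (hP : P.Admissible f lo hi) {τ' : ℕ} (hτ : τ < τ') (hN : τ < P.N)
    (hno : ∀ k s m f, ¬ Push k s m f) (hno' : ∀ k s m f, ¬ Push' k s m f)
    (hU : ∀ k t, Upd k t → τ' ≤ t) :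
    P.Inv lo hi U₀ τ' (fun _ => False) Push' Upd sub T V := by
  have hpend : ∀ k s, ¬ Pending Push k s := fun k s ⟨m, f, hm⟩ => hno k s m f hm
  have hforced : ∀ k s, ¬ Forced (fun _ => False) Push k s := by
    rintro k s (h' | ⟨m, hm⟩)
    · exact h'
    · exact hno k s m _ hm
  have hrec : ∀ k s, ¬ WillReceive τ (fun _ => False) Push sub k s := by
    rintro k s (h' | h')
    · exact hpend k s h'
    · exact hforced _ _ h'.1
  have hupd : ∀ k, Upd k (sub k).tCeil := by
    intro k
    rcases (h.floor_le_now k).lt_or_eq with hlt | heq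
    · exact (h.awake k hlt).resolve_left id
    · exact ((h.ceil_ok k heq hN).resolve_right fun ⟨s, hs⟩ => hrec k s hs).2
  -- Every submesh has its planned update in the queue, so the new time lies within every plan; with
  -- the running maxima this yields the `safe` clause.
  have hceil : ∀ k, τ' ≤ P.computeTNext k (sub k) := fun k => (hU k _ (hupd k)).trans (h.ceil_le k)
  have houter : ∀ k s t, ((sub k).bdry s).tFloor ≤ t →
      ((sub k).bdry s).u = V t (P.outer k s) := fun k s t ht =>
    (h.side k s).u_eq_of_gap h.toHist ht fun r hr _ =>
      ((h.side k s).nb_gap r hr).resolve_right fun h' => hpend k s h'.2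
  have hnb : ∀ k s, ((sub k).bdry s).tFloor ≤ τ := fun k s => h.le_now _ _ (h.side k s).nb_mem
  -- From τ onward neither the submesh nor its neighbors change in `V`, and no push is outstanding,
  -- so the coefficients are those computed from the stored data.
  have hKint : ∀ k s t, (sub k).tFloor ≤ t → P.intV k s (V t) ≤ ((sub k).bdry s).Kint := by
    intro k s t h1
    by_cases h3 : t < τ
    · exact (h.side k s).Kint_ge t h1 h3
    · rw [← intNow_eq (h.u_eq_of_le k t h1) (houter k s t ((hnb k s).trans (not_lt.1 h3)))]
      exact (h.side k s).Kint_now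
  have hKext : ∀ k s t, ((sub k).bdry s).tSync ≤ t →
      P.extV k s (V t) ≤ ((sub k).bdry s).Kext := by
    intro k s t h1
    by_cases h3 : t < τ
    · exact (h.side k s).Kext_ge t h1 h3
    · rw [← extNow_eq (h.u_eq_of_le k t ((h.floor_le_now k).trans (not_lt.1 h3)))
        (houter k s t ((hnb k s).trans (not_lt.1 h3)))]
      exact (h.side k s).Kext_now
  exact
  { zero_mem := h.zero_mem
    le_now := fun k t ht => (h.le_now k t ht).trans hτ.le
    const := h.const
    init := h.init
    range := h.range
    euler := h.euler
    cflInt := h.cflInt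
    cflExt := h.cflExt
    floor_mem := h.floor_mem
    le_floor := h.le_floor
    u_eq := h.u_eq
    side := fun k s =>
      { nb_mem := (h.side k s).nb_mem
        nb_gap := fun t ht => Or.inl
          (((h.side k s).nb_gap t ht).resolve_right fun h' => hpend k s h'.2)
        nb_u := (h.side k s).nb_u
        push := fun m f hm => absurd hm (hno' k s m f)
        sumF := (h.side k s).sumF
        Kint_ge := fun t h1 _ => hKint k s t h1
        Kint_now := (h.side k s).Kint_now
        Kext_ge := fun t h1 _ => hKext k s t h1
        Kext_now := (h.side k s).Kext_now
        sync_mem := (h.side k s).sync_mem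
        sync_mem_nb := Or.inl ((h.side k s).sync_mem_nb.resolve_right fun h' => hforced _ _ h'.2)
        sync_max := fun t ht ht' => Or.inl
          (((h.side k s).sync_max t ht ht').resolve_right fun h' => hpend k s h'.2)
        ordered := fun p hp q hq => Or.inl (((h.side k s).ordered p hp q hq).resolve_right
          fun h' => h'.elim (fun h' => hforced _ _ h'.2) fun h' => hforced _ _ h'.2) }
    safe := by
      intro k _ t h1 h2
      have hτ'f : ((sub k).tFloor : ℝ) ≤ τ' := by
        exact_mod_cast (h.floor_le_now k).trans hτ.le
      have hdt := hP.dt_pos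
      refine ⟨fun s => ?_, fun j hj hj1 hj2 => ?_⟩
      · obtain ⟨e1, e2⟩ := le_half_of_le_computeTNextBdry hdt ((h.side k s).Kint_nonneg hP)
          ((h.side k s).Kext_nonneg hP) ((hceil k).trans (computeTNext_le_bdry s))
        have hsf : (((sub k).bdry s).tSync : ℝ) ≤ (sub k).tFloor := by
          exact_mod_cast h.sync_le_floor k s
        constructor
        · refine le_trans (mul_le_mul_of_nonneg_left (mul_le_mul_of_nonneg_left
            (hKext k s t ((h.sync_le_floor k s).trans h1)) hdt.le) (by linarith)) e1
        · exact le_trans (mul_le_mul_of_nonneg_left (mul_le_mul_of_nonneg_left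
            (hKint k s t h1) hdt.le) (by linarith)) e2
      · have e := hP.le_half_of_le_computeTNextInt ((hceil k).trans computeTNext_le_int) hj hj1 hj2
        rwa [negC_eq (h.u_eq_of_le k t h1) hj hj1 hj2,
          posD_eq (h.u_eq_of_le k t h1) hj hj1 hj2] at e
    ceil_le := h.ceil_le
    awake := fun k _ => Or.inr (hupd k)
    side_ok := fun k hk => by have := h.floor_le_now k; omega
    ceil_ok := fun k hk => by have := h.floor_le_now k; omega }

/-! ### Receiving a push -/

/-- Delivery of a push changes what k knows but adds no timestamp. If k is still behind τ and is
forced or has exhausted its plan, it joins `A` and must update at once; if it is already at τ,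
delivery completes a synchronization. -/
lemma receive (h : P.Inv lo hi U₀ τ (fun _ => False) Push Upd sub T V)
    (hP : P.Admissible f lo hi) {msg : ℝ} {force : Bool} (hpush : Push k s msg force)
    (hP1 : ∀ k' s' m f, Push' k' s' m f → Push k' s' m f)
    (hP2 : ∀ k' s' m f, Push k' s' m f →
      Push' k' s' m f ∨ (k' = k ∧ s' = s ∧ m = msg ∧ f = force))
    (hA : A k → (sub k).tFloor < τ)
    (hAf : force = true → (sub k).tFloor < τ → A k)
    (hAc : (P.received τ k s msg (sub k)).tCeil ≤ τ → (sub k).tFloor < τ → A k)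
    (hU : ∀ k' t, Upd k' t → Upd' k' t)
    (hUk : τ < (P.received τ k s msg (sub k)).tCeil → ¬ A k →
      Upd' k (P.received τ k s msg (sub k)).tCeil) :
    P.Inv lo hi U₀ τ A Push' Upd' (Function.update sub k (P.received τ k s msg (sub k))) T V := by
  set S := sub k with hS
  set S' := P.received τ k s msg S with hS'
  obtain ⟨hτnb, hmsg⟩ := (h.side k s).push msg force hpush
  have hne := neigh_ne hP.two_le
  have hsub : ∀ k', (Function.update sub k S' k').tFloor = (sub k').tFloor := by
    intro k'
    by_cases hk : k' = k
    · subst hk; simp [hS', received_tFloor, hS]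
    · rw [Function.update_of_ne hk]
  have hsubu : ∀ k', (Function.update sub k S' k').u = (sub k').u := by
    intro k'
    by_cases hk : k' = k
    · subst hk; simp [hS', received_u, hS]
    · rw [Function.update_of_ne hk]
  have hforced : ∀ k' s', Forced (fun _ => False) Push k' s' →
      Forced A Push' k' s' ∨ τ ∈ T k' := by
    rintro k' s' (h' | ⟨m, hm⟩)
    · exact h'.elim
    · rcases hP2 k' s' m true hm with h' | ⟨rfl, rfl, -, hf⟩
      · exact Or.inl (Or.inr ⟨m, h'⟩)
      · rcases (h.floor_le_now k').lt_or_eq with hlt | heq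
        · exact Or.inl (Or.inl (hAf hf.symm hlt))
        · exact Or.inr ((h.floor_eq_iff k').1 heq)
  have hpend : ∀ k' s', ¬ (k' = k ∧ s' = s) → Pending Push k' s' → Pending Push' k' s' := by
    rintro k' s' hks ⟨m, f, hm⟩
    rcases hP2 k' s' m f hm with h' | ⟨h1, h2, -⟩
    · exact ⟨m, f, h'⟩
    · exact absurd ⟨h1, h2⟩ hks
  have hwill : ∀ k' s', ¬ (k' = k ∧ s' = s) → WillReceive τ (fun _ => False) Push sub k' s' →
      WillReceive τ A Push' (Function.update sub k S') k' s' := by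
    rintro k' s' hks (h' | ⟨h1, h2⟩)
    · exact Or.inl (hpend k' s' hks h')
    · refine Or.inr ⟨(hforced _ _ h1).resolve_right fun h3 => ?_, by rwa [hsub]⟩
      have := (h.floor_eq_iff _).2 h3
      omega
  have hbu : ∀ s', (S'.bdry s').u ∈ Set.Icc lo hi := by
    intro s'
    by_cases hs : s' = s
    · subst hs
      rw [hS', received_bdry_u, hmsg]
      exact h.range _ _
    · rw [hS', received_bdry_of_ne hs]
      exact h.bdry_u_mem k s'
  have huu : ∀ j ∈ P.cells k, S'.u j ∈ Set.Icc lo hi := fun j hj => by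
    rw [hS', received_u]
    exact h.u_mem k j hj
  have hSf : S'.tFloor = S.tFloor := received_tFloor
  -- On the receiving side of a submesh already at τ, both running bounds restart from their present
  -- values, so a further `dt` is allowed; the other side keeps its previous alternative.
  have hside : ∀ s', S.tFloor = τ → τ < P.N → τ < P.computeTNextBdry S' s' ∨
      WillReceive τ A Push' (Function.update sub k S') k s' := by
    intro s' hk hN
    by_cases hs : s' = s
    · subst hs
      left
      have hsync : (S'.bdry s').tSync = τ := by rw [hS', received_bdry_tSync, if_pos hk.symm]
      refine lt_computeTNextBdry hN (hSf.trans hk) hsync ?_ ?_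
      · rw [hS', received_bdry_Kint, if_pos hk]
        exact hP.dt_mul_intNow_le huu hbu
      · rw [hS', received_bdry_Kext, if_pos hsync]
        exact hP.dt_mul_extNow_le huu hbu
    · refine (h.side_ok k hk hN s').imp (fun h' => ?_) (hwill k s' fun h' => hs h'.2)
      rwa [computeTNextBdry_congr (S' := S) hSf] <;> rw [hS', received_bdry_of_ne hs]
  have hself : P.SideInv τ A Push' T V k s S' := by
    have hI := h.side k s
    refine
    { nb_mem := ?_, nb_gap := ?_, nb_u := ?_, push := ?_, sumF := ?_, Kint_ge := ?_
      Kint_now := ?_, Kext_ge := ?_, Kext_now := ?_, sync_mem := ?_, sync_mem_nb := ?_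
      sync_max := ?_, ordered := ?_ }
    · rwa [hS', received_bdry_tFloor]
    · intro t ht
      rw [hS', received_bdry_tFloor]
      exact Or.inl (h.le_now _ t ht)
    · rw [hS', received_bdry_tFloor, received_bdry_u, hmsg]
    · exact fun m f hm => hI.push m f (hP1 k s m f hm)
    · rw [hS', received_bdry_sumF, received_bdry_tFloor, received_tFloor]
      exact hI.fluxUpTo_eq h.toHist (h.floor_le_now k) (h.u_eq_of_le k)
    · intro t h1 h2
      rw [hSf] at h1
      rw [hS', received_bdry_Kint, if_neg (by omega)]
      exact le_max_of_le_left (hI.Kint_ge t h1 h2)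
    · rw [hS', received_bdry_Kint]
      split_ifs
      · exact le_rfl
      · exact le_max_right _ _
    · intro t h1 h2
      rw [hS', received_bdry_Kext, if_neg (show ¬ (S'.bdry s).tSync = τ by omega)]
      rw [hS', received_bdry_tSync] at h1
      split_ifs at h1
      · omega
      · exact le_max_of_le_left (hI.Kext_ge t h1 h2)
    · rw [hS', received_bdry_Kext]
      split_ifs
      · exact le_rfl
      · exact le_max_right _ _
    · rw [hS', received_bdry_tSync]
      split_ifs with h'
      · exact (h.floor_eq_iff k).1 h'.symm
      · exact hI.sync_mem
    · left
      rw [hS', received_bdry_tSync]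
      split_ifs with h'
      · exact hτnb
      -- A recorded synchronization at τ that waited for the neighbor is now justified: the push
      -- itself proves that the neighbor has updated at τ.
      · rcases hI.sync_mem_nb with h1 | ⟨h1, -⟩
        · exact h1
        · rwa [← h1] at hτnb
    · intro t ht ht'
      left
      rw [hS', received_bdry_tSync]
      split_ifs with h'
      · exact h.le_now k t ht
      · refine (hI.sync_max t ht ht').resolve_right fun h2 => h' ?_
        exact ((h.floor_eq_iff k).2 (h2.1 ▸ ht)).symm
    · intro p hp q hq
      rcases hI.ordered p hp q hq with h' | ⟨rfl, h'⟩ | ⟨rfl, h'⟩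
      · exact Or.inl h'
      · exact Or.inl ⟨p, hp, hτnb, min_le_left _ _, le_max_left _ _⟩
      · rcases hforced k s h' with h3 | h3
        · exact Or.inr (Or.inr ⟨rfl, h3⟩)
        · exact Or.inl ⟨q, h3, hq, min_le_right _ _, le_max_right _ _⟩
  exact
  { toHist := h.toHist
    floor_mem := fun k' => hsub k' ▸ h.floor_mem k'
    le_floor := fun k' => by rw [hsub]; exact h.le_floor k'
    u_eq := fun k' => by rw [hsub, hsubu]; exact h.u_eq k'
    side := by
      intro k' s'
      by_cases hks : k' = k ∧ s' = s
      · obtain ⟨rfl, rfl⟩ := hks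
        rw [Function.update_self]
        exact hself
      · refine (h.side k' s').transfer (hsub k') (hsubu k') ?_ (hP1 k' s') (hpend k' s' hks)
          (hforced _ _) (hforced _ _)
        by_cases hk : k' = k
        · subst hk
          rw [Function.update_self, hS', received_bdry_of_ne fun hs => hks ⟨rfl, hs⟩]
        · rw [Function.update_of_ne hk]
    safe := by
      intro k' hk'
      rw [hsub] at hk'
      have hsafe := h.safe k' hk'
      by_cases hk : k' = k
      · subst hk
        rw [Function.update_self]
        have hsync : ∀ s', (S'.bdry s').tSync = (S.bdry s').tSync := by
          intro s'
          by_cases hs : s' = s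
          · subst hs
            rw [hS', received_bdry_tSync, if_neg (show ¬ τ = (sub k').tFloor by omega)]
          · rw [hS', received_bdry_of_ne hs]
        simp only [SafeAt, hsync, hSf]
        exact hsafe
      · rwa [Function.update_of_ne hk]
    ceil_le := by
      intro k'
      by_cases hk : k' = k
      · subst hk
        rw [Function.update_self, hS', received_tCeil]
      · rw [Function.update_of_ne hk]
        exact h.ceil_le k'
    awake := by
      intro k' hk'
      rw [hsub] at hk'
      by_cases hk : k' = k
      · subst hk
        rw [Function.update_self]
        by_cases hAk : A k'
        · exact Or.inl hAk
        · right
          refine hUk ?_ hAk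
          by_contra hcon
          exact hAk (hAc (not_lt.1 hcon) hk')
      · rw [Function.update_of_ne hk]
        exact Or.inr (hU _ _ ((h.awake k' hk').resolve_left id))
    side_ok := by
      intro k' hk' hN s'
      rw [hsub] at hk'
      by_cases hk : k' = k
      · subst hk
        rw [Function.update_self]
        exact hside s' hk' hN
      · rw [Function.update_of_ne hk]
        exact (h.side_ok k' hk' hN s').imp id (hwill k' s' fun h' => hk h'.1)
    ceil_ok := by
      intro k' hk' hN
      rw [hsub] at hk'
      by_cases hk : k' = k
      · subst hk
        rw [Function.update_self]
        by_cases hex : ∃ s', WillReceive τ A Push' (Function.update sub k' S') k' s'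
        · exact Or.inr hex
        · left
          have hlt : τ < S'.tCeil := by
            rw [hS', received_tCeil]
            refine lt_computeTNext (fun s' => ?_) ?_
            · exact (hside s' hk' hN).resolve_right fun h' => hex ⟨s', h'⟩
            · exact hP.lt_computeTNextInt hN (hSf.trans hk') huu hbu
          exact ⟨hlt, hUk hlt fun hAk => (hA hAk).ne hk'⟩
      · rw [Function.update_of_ne hk]
        exact (h.ceil_ok k' hk' hN).imp (fun h' => ⟨h'.1, hU _ _ h'.2⟩)
          fun ⟨s', h'⟩ => ⟨s', hwill k' s' (fun h' => hk h'.1) h'⟩ }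

end Inv

end Sim

end LocalTimestepping

namespace LocalTimestepping

lemma IsPrevIn.of_agree {A A' : Set ℕ} {τ t a : ℕ} (h : IsPrevIn A' t a) (ht : t < τ)
    (hA : ∀ r < τ, r ∈ A' ↔ r ∈ A) : IsPrevIn A t a :=
  ⟨(hA a (h.2.1.trans_lt ht)).1 h.1, h.2.1,
    fun s hs hst => h.2.2 s ((hA s (hst.trans_lt ht)).2 hs) hst⟩

lemma IsNextIn.of_subset {A A' : Set ℕ} {t b : ℕ} (h : IsNextIn A' t b) (hb : b ∈ A)
    (hA : A ⊆ A') : IsNextIn A t b :=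
  ⟨hb, h.2.1, fun s hs hts => h.2.2 s (hA hs) hts⟩

namespace Sim

variable {n M : ℕ} [NeZero n] [NeZero M] {P : Sim n M} {f : ℝ → ℝ} {lo hi : ℝ} {U₀ : Fin n → ℝ}
  {τ : ℕ} {A : Fin M → Prop} {Push Push' : Fin M → Side → ℝ → Bool → Prop}
  {Upd Upd' : Fin M → ℕ → Prop} {sub : Fin M → Submesh n} {T : Fin M → Set ℕ}
  {V : ℕ → Fin n → ℝ} {k : Fin M} {S : Submesh n}

/-! ### Performing an update -/

/-- At a boundary cell the external bound is measured from `tSync`, which is no later than the last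
update and therefore gives the stronger inequality. -/
lemma SafeAt.cells (h : P.SafeAt τ V k S) (hP : P.Admissible f lo hi)
    (hs : ∀ s, (S.bdry s).tSync ≤ S.tFloor) {j : Fin n} (hj : j ∈ P.cells k) {t : ℕ}
    (h1 : S.tFloor ≤ t) (h2 : t < τ) :
    ((τ : ℝ) - S.tFloor) * (P.dt * -cellC P.F P.dx j (V t)) ≤ 1 / 2 ∧
      ((τ : ℝ) - S.tFloor) * (P.dt * cellD P.F P.dx j (V t)) ≤ 1 / 2 := by
  obtain ⟨hb, hin⟩ := h t h1 h2
  have hext : ∀ s, ((τ : ℝ) - S.tFloor) * (P.dt * P.extV k s (V t)) ≤ 1 / 2 := by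
    intro s
    refine le_trans (mul_le_mul_of_nonneg_right ?_ (mul_nonneg hP.dt_pos.le
      (hP.extV_nonneg _))) (hb s).1
    have : ((S.bdry s).tSync : ℝ) ≤ S.tFloor := by exact_mod_cast hs s
    linarith
  by_cases hj1 : j = P.first k
  · subst hj1
    exact ⟨hext .left, (hb .left).2⟩
  by_cases hj2 : j = P.last k
  · subst hj2
    exact ⟨(hb .right).2, hext .right⟩
  exact hin j hj hj1 hj2

/-- The timestamps after an update of submesh `k` at time `τ`. -/
def insertTime (T : Fin M → Set ℕ) (k : Fin M) (τ : ℕ) : Fin M → Set ℕ :=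
  Function.update T k (insert τ (T k))

open Classical in
/-- The history of values after an update of submesh `k` to the values `u` at time `τ`. -/
def overwrite (P : Sim n M) (V : ℕ → Fin n → ℝ) (k : Fin M) (τ : ℕ) (u : Fin n → ℝ) :
    ℕ → Fin n → ℝ :=
  fun t j => if j ∈ P.cells k ∧ τ ≤ t then u j else V t j

section Overwrite

variable {k' : Fin M} {t : ℕ} {j : Fin n} {u : Fin n → ℝ}

lemma insertTime_of_ne (h : k' ≠ k) : insertTime T k τ k' = T k' :=
  Function.update_of_ne h _ _

lemma mem_insertTime_self : t ∈ insertTime T k τ k ↔ t = τ ∨ t ∈ T k := by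
  simp [insertTime]

lemma subset_insertTime : T k' ⊆ insertTime T k τ k' := by
  intro t ht
  by_cases h : k' = k
  · subst h
    exact mem_insertTime_self.2 (Or.inr ht)
  · rwa [insertTime_of_ne h]

lemma mem_insertTime_of_ne (h : t ≠ τ) : t ∈ insertTime T k τ k' ↔ t ∈ T k' := by
  by_cases hk : k' = k
  · subst hk
    simp [mem_insertTime_self, h]
  · rw [insertTime_of_ne hk]

lemma overwrite_of_lt (h : t < τ) : P.overwrite V k τ u t = V t := by
  funext j
  rw [overwrite, if_neg fun h' => by omega]

lemma overwrite_of_notMem (h : j ∉ P.cells k) : P.overwrite V k τ u t j = V t j := by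
  rw [overwrite, if_neg fun h' => h h'.1]

lemma overwrite_of_mem (h : j ∈ P.cells k) (ht : τ ≤ t) : P.overwrite V k τ u t j = u j := by
  rw [overwrite, if_pos ⟨h, ht⟩]

end Overwrite

namespace Inv

section Update

variable (h : P.Inv lo hi U₀ τ A Push Upd sub T V)

include h

/-- Boundary fluxes enter as accumulated integrals, interior fluxes as constants times the length of
the step. Both are the sums of the true fluxes over the step, as the submesh's own values are
frozen. -/
lemma updated_u_eq (hlt : (sub k).tFloor < τ) {j : Fin n} (hj : j ∈ P.cells k) :
    (P.updated τ k (sub k)).u j = V (sub k).tFloor j + P.dt / P.dx j *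
      ∑ t ∈ Finset.Ico (sub k).tFloor τ,
        (P.F (V t (j - 1)) (V (sub k).tFloor j) - P.F (V (sub k).tFloor j) (V t (j + 1))) := by
  have hflux : ∀ s, P.fluxUpTo τ k s (sub k) =
      ∑ t ∈ Finset.Ico (sub k).tFloor τ, P.dt * P.fluxV k s (V t) := fun s =>
    (h.side k s).fluxUpTo_eq h.toHist hlt.le (h.u_eq_of_le k)
  have hu := h.u_eq_of_le k
  have hself : ∀ i ∈ P.cells k, ∀ t, (sub k).tFloor ≤ t → V t i = V (sub k).tFloor i :=
    fun i hi t ht => by rw [← hu t ht i hi, ← hu _ le_rfl i hi]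
  have hconst : ∀ X : ℝ, ((τ : ℝ) - (sub k).tFloor) * P.dt * X =
      ∑ _t ∈ Finset.Ico (sub k).tFloor τ, P.dt * X := by
    intro X
    rw [Finset.sum_const, Nat.card_Ico, nsmul_eq_mul, Nat.cast_sub hlt.le]
    ring
  have hin : (if j = P.first k then P.fluxUpTo τ k .left (sub k)
      else ((τ : ℝ) - (sub k).tFloor) * P.dt * P.F ((sub k).u (j - 1)) ((sub k).u j)) =
      ∑ t ∈ Finset.Ico (sub k).tFloor τ, P.dt * P.F (V t (j - 1)) (V (sub k).tFloor j) := by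
    split_ifs with hj1
    · rw [hflux]
      refine Finset.sum_congr rfl fun t ht => ?_
      simp only [fluxV, ← hj1, hself j hj t (Finset.mem_Ico.1 ht).1]
    · rw [hconst]
      refine Finset.sum_congr rfl fun t ht => ?_
      rw [hu t (Finset.mem_Ico.1 ht).1 _ (P.sub_one_mem hj hj1), hu _ le_rfl j hj]
  have hout : (if j = P.last k then P.fluxUpTo τ k .right (sub k)
      else ((τ : ℝ) - (sub k).tFloor) * P.dt * P.F ((sub k).u j) ((sub k).u (j + 1))) =
      ∑ t ∈ Finset.Ico (sub k).tFloor τ, P.dt * P.F (V (sub k).tFloor j) (V t (j + 1)) := by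
    split_ifs with hj1
    · rw [hflux]
      refine Finset.sum_congr rfl fun t ht => ?_
      simp only [fluxV, ← hj1, hself j hj t (Finset.mem_Ico.1 ht).1]
    · rw [hconst]
      refine Finset.sum_congr rfl fun t ht => ?_
      rw [hu t (Finset.mem_Ico.1 ht).1 _ (P.add_one_mem hj hj1), hu _ le_rfl j hj]
  rw [updated_u, advance_u hj, hin, hout, hu _ le_rfl j hj, ← Finset.sum_sub_distrib,
    Finset.mul_sum, Finset.mul_sum]
  congr 1
  refine Finset.sum_congr rfl fun t _ => ?_
  ring

/-- A new timestamp closes just one step, from the last update to τ. Clauses about older steps do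
not see the overwritten values; those about the new one follow from `safe`, and its range from the
maximum principle. -/
lemma hist_update (hP : P.Admissible f lo hi) (hlt : (sub k).tFloor < τ) :
    P.Hist lo hi U₀ τ (insertTime T k τ)
      (P.overwrite V k τ (P.updated τ k (sub k)).u) := by
  have hsafe := h.safe k hlt
  have hTk : ∀ t ∈ T k, t < τ := fun t ht => (h.le_floor k t ht).trans_lt hlt
  have hcells : ∀ {k' : Fin M} {j : Fin n}, j ∈ P.cells k' → k' ≠ k → j ∉ P.cells k :=
    fun hj hne hj' => hne (P.cells_unique hj hj')
  have hagree : ∀ k', ∀ r < τ, r ∈ insertTime T k τ k' ↔ r ∈ T k' :=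
    fun k' r hr => mem_insertTime_of_ne hr.ne
  have hle : ∀ k', ∀ t ∈ insertTime T k τ k', t ≤ τ := by
    intro k' t ht
    by_cases hk : k' = k
    · subst hk
      rcases mem_insertTime_self.1 ht with rfl | ht
      · exact le_rfl
      · exact h.le_now _ _ ht
    · rw [insertTime_of_ne hk] at ht
      exact h.le_now _ _ ht
  have hnew : ∀ k' t b, IsNextIn (insertTime T k τ k') t b →
      (k' = k ∧ b = τ ∧ (sub k).tFloor ≤ t) ∨ IsNextIn (T k') t b := by
    intro k' t b hb
    by_cases hk : k' = k
    · subst hk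
      rcases mem_insertTime_self.1 hb.1 with rfl | hbT
      · refine Or.inl ⟨rfl, rfl, ?_⟩
        by_contra hcon
        have := hb.2.2 _ (subset_insertTime (h.floor_mem k')) (not_le.1 hcon)
        omega
      · exact Or.inr (hb.of_subset hbT subset_insertTime)
    · rw [insertTime_of_ne hk] at hb
      exact Or.inr hb
  refine
  { zero_mem := fun k' => subset_insertTime (h.zero_mem k'), le_now := hle, const := ?_
    init := ?_, range := ?_, euler := ?_, cflInt := ?_, cflExt := ?_ }
  · intro k' j hj t ht
    by_cases hk : k' = k
    · subst hk
      by_cases htτ : τ ≤ t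
      · rw [overwrite_of_mem hj htτ, overwrite_of_mem hj (by omega)]
      · have hne : t + 1 ≠ τ := fun e => ht (mem_insertTime_self.2 (Or.inl e))
        rw [overwrite_of_lt (by omega), overwrite_of_lt (by omega)]
        exact h.const _ j hj t fun h' => ht (subset_insertTime h')
    · rw [overwrite_of_notMem (hcells hj hk), overwrite_of_notMem (hcells hj hk)]
      exact h.const _ j hj t fun h' => ht (subset_insertTime h')
  · rw [overwrite_of_lt (by omega), h.init]
  · intro t j
    by_cases hj : j ∈ P.cells k ∧ τ ≤ t
    · rw [overwrite_of_mem hj.1 hj.2, h.updated_u_eq hlt hj.1]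
      refine hP.step_mem_Icc hlt (fun t i _ => h.range t i) (fun t h1 _ => ?_)
        (fun t h1 h2 => (hsafe.cells hP (h.sync_le_floor k) hj.1 h1 h2).1)
        (fun t h1 h2 => (hsafe.cells hP (h.sync_le_floor k) hj.1 h1 h2).2)
      rw [← h.u_eq_of_le k t h1 j hj.1, ← h.u_eq k j hj.1]
    · rw [overwrite, if_neg hj]
      exact h.range t j
  · intro k' j hj a b ha hb
    have haτ : a < τ := hb.2.1.trans_le (hle _ _ hb.1)
    have hsum : ∀ X : ℝ, ∑ t ∈ Finset.Ico a b,
        (P.F (P.overwrite V k τ (P.updated τ k (sub k)).u t (j - 1)) X -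
          P.F X (P.overwrite V k τ (P.updated τ k (sub k)).u t (j + 1))) =
        ∑ t ∈ Finset.Ico a b, (P.F (V t (j - 1)) X - P.F X (V t (j + 1))) := by
      intro X
      refine Finset.sum_congr rfl fun t ht => ?_
      rw [overwrite_of_lt ((Finset.mem_Ico.1 ht).2.trans_le (hle _ _ hb.1))]
    rw [hsum, overwrite_of_lt haτ]
    rcases hnew k' a b hb with ⟨rfl, rfl, hfa⟩ | hb'
    · obtain rfl : a = (sub k').tFloor :=
        le_antisymm (h.le_floor _ _ ((hagree _ _ haτ).1 ha)) hfa
      rw [overwrite_of_mem hj le_rfl, h.updated_u_eq hlt hj]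
    · rw [← h.euler k' j hj a b ((hagree _ _ haτ).1 ha) hb']
      by_cases hk : k' = k
      · subst hk
        rw [overwrite_of_lt (hTk b hb'.1)]
      · rw [overwrite_of_notMem (hcells hj hk)]
  · intro k' j hj t a b ha hb
    have htτ : t < τ := hb.2.1.trans_le (hle _ _ hb.1)
    rw [overwrite_of_lt htτ]
    have ha' := ha.of_agree htτ (hagree k')
    rcases hnew k' t b hb with ⟨rfl, rfl, hft⟩ | hb'
    · obtain rfl : a = (sub k').tFloor :=
        le_antisymm (h.le_floor _ _ ha'.1) (ha'.2.2 _ (h.floor_mem k') hft)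
      exact hsafe.cells hP (h.sync_le_floor _) hj hft htτ
    · exact h.cflInt k' j hj t a b ha' hb'
  · intro k' s t σ b hσ hb
    have htτ : t < τ := hb.2.1.trans_le (hle _ _ hb.1)
    rw [overwrite_of_lt htτ]
    have hσ' : IsPrevIn (T k' ∩ T (neigh k' s)) t σ := hσ.of_agree htτ fun r hr =>
      and_congr (hagree _ r hr) (hagree _ r hr)
    rcases hnew k' t b hb with ⟨rfl, rfl, hft⟩ | hb'
    · have hsf := h.sync_le_floor k' s
      have hmem := (h.side k' s).sync_mem_nb.resolve_right fun h' => by omega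
      -- The recorded synchronization is a common timestamp, hence not after the last common one σ;
      -- the bound measured from it implies the bound measured from σ.
      have hle' : (((sub k').bdry s).tSync : ℝ) ≤ σ := by
        exact_mod_cast hσ'.2.2 _ ⟨(h.side k' s).sync_mem, hmem⟩ (hsf.trans hft)
      refine le_trans (mul_le_mul_of_nonneg_right (by linarith) (mul_nonneg hP.dt_pos.le
        (hP.extV_nonneg _))) ((hsafe t hft htτ).1 s).1
    · exact h.cflExt k' s t σ b hσ' hb'

/-- Updating k clears the obligation `A k` and issues a push on both sides. Exceptions that waited
for k to reach τ are resolved by its new timestamp; new ones are covered by these pushes, which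
force the neighbor whenever local ordering or the next plan would otherwise fail. -/
lemma update (hP : P.Admissible f lo hi) (hA : ∀ k', A k' → k' = k) (hlt : (sub k).tFloor < τ)
    (hP1 : ∀ k' s' m f, Push k' s' m f → Push' k' s' m f)
    (hP2 : ∀ k' s' m f, Push' k' s' m f → Push k' s' m f ∨
      ∃ s : Side, k' = neigh k s ∧ s' = s.opp ∧
        m = (P.updated τ k (sub k)).u (P.bdryCell k s) ∧ f = P.forcing τ k (sub k) s)
    (hP3 : ∀ s : Side, Push' (neigh k s) s.opp ((P.updated τ k (sub k)).u (P.bdryCell k s))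
      (P.forcing τ k (sub k) s))
    (hU : ∀ k' t, Upd k' t → Upd' k' t)
    (hUk : τ < (P.updated τ k (sub k)).tCeil → Upd' k (P.updated τ k (sub k)).tCeil) :
    P.Inv lo hi U₀ τ (fun _ => False) Push' Upd'
      (Function.update sub k (P.updated τ k (sub k))) (insertTime T k τ)
      (P.overwrite V k τ (P.updated τ k (sub k)).u) := by
  have hH := h.hist_update hP hlt
  set S := sub k with hS
  set S' := P.updated τ k S with hS'
  set sub' := Function.update sub k S' with hsub'
  set T' := insertTime T k τ with hT'
  set V' := P.overwrite V k τ S'.u with hV'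
  have hne := neigh_ne (M := M) hP.two_le
  have hTk : ∀ t ∈ T k, t < τ := fun t ht => (h.le_floor k t ht).trans_lt hlt
  have hτk : τ ∈ T' k := mem_insertTime_self.2 (Or.inl rfl)
  have hout : ∀ {k' s}, neigh k' s ≠ k → P.outer k' s ∉ P.cells k := fun hk hmem =>
    hk (P.cells_unique (P.outer_mem _ _) hmem)
  have hself : sub' k = S' := Function.update_self _ _ _
  have hother : ∀ {k'}, k' ≠ k → sub' k' = sub k' := fun hk => Function.update_of_ne hk _ _
  have hpend : ∀ k' s, Pending Push k' s → Pending Push' k' s :=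
    fun k' s ⟨m, f, hm⟩ => ⟨m, f, hP1 _ _ _ _ hm⟩
  have hpendk : ∀ k' s, neigh k' s = k → Pending Push' k' s := by
    rintro k' s rfl
    have := hP3 s.opp
    rw [neigh_neigh_opp, Side.opp_opp] at this
    exact ⟨_, _, this⟩
  have hforced : ∀ k' s, Forced A Push k' s → Forced (fun _ => False) Push' k' s ∨ k' = k := by
    rintro k' s (h' | ⟨m, hm⟩)
    · exact Or.inr (hA k' h')
    · exact Or.inl (Or.inr ⟨m, hP1 _ _ _ _ hm⟩)
  have hwill : ∀ k' s, k' ≠ k → WillReceive τ A Push sub k' s →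
      WillReceive τ (fun _ => False) Push' sub' k' s := by
    rintro k' s - (h' | ⟨h1, h2⟩)
    · exact Or.inl (hpend _ _ h')
    · by_cases hnb : neigh k' s = k
      · exact Or.inl (hpendk _ _ hnb)
      · exact Or.inr ⟨(hforced _ _ h1).resolve_right hnb, by rwa [hother hnb]⟩
  have hsync_nb : ∀ s, (S.bdry s).tSync ∈ T (neigh k s) := fun s =>
    (h.side k s).sync_mem_nb.resolve_right fun h' => by
      have h1 : (S.bdry s).tSync = τ := h'.1
      have h2 : (S.bdry s).tSync ≤ S.tFloor := h.sync_le_floor k s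
      omega
  have hnbτ : ∀ s, (S.bdry s).tFloor = τ → τ ∈ T (neigh k s) := fun s e => e ▸ (h.side k s).nb_mem
  have hforcing : ∀ s, P.forcing τ k S s = true →
      Forced (fun _ => False) Push' (neigh k s) s.opp := fun s e =>
    Or.inr ⟨_, e ▸ hP3 s⟩
  -- Without forcing, and with the neighbor not known to be at τ, all its known timestamps lie at or
  -- before `tSync`, which is a common time. An unknown one can only be τ, now common too.
  have hord : ∀ s, ∀ q ∈ T (neigh k s),
      (∃ r, r ∈ T' k ∧ r ∈ T (neigh k s) ∧ q ≤ r ∧ r ≤ τ) ∨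
        Forced (fun _ => False) Push' (neigh k s) s.opp := by
    intro s q hq
    by_cases hf : P.forcing τ k S s = true
    · exact Or.inr (hforcing s hf)
    left
    by_cases hnb : (S.bdry s).tFloor = τ
    · exact ⟨τ, hτk, hnbτ s hnb, h.le_now _ _ hq, le_rfl⟩
    rcases (h.side k s).nb_gap q hq with hq' | ⟨rfl, -⟩
    · refine ⟨(S.bdry s).tSync, subset_insertTime (h.side k s).sync_mem, hsync_nb s,
        hq'.trans (tFloor_le_of_not_forcing (by simpa using hf) hnb),
        h.le_now _ _ (h.side k s).sync_mem⟩
    · exact ⟨q, hτk, hq, le_rfl, le_rfl⟩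
  have hu' : ∀ j ∈ P.cells k, S'.u j ∈ Set.Icc lo hi := fun j hj => by
    have := hH.range τ j
    rwa [hV', overwrite_of_mem hj le_rfl] at this
  have hb' : ∀ s, (S'.bdry s).u ∈ Set.Icc lo hi := fun s => by
    rw [hS', updated_bdry_u]
    exact h.bdry_u_mem k s
  have hside : ∀ s, τ < P.N →
      (τ < P.computeTNextBdry S' s ∧ (P.forcing τ k S s = false ∨ (S.bdry s).tFloor = τ)) ∨
        WillReceive τ (fun _ => False) Push' sub' k s := by
    intro s hN
    by_cases hf : P.forcing τ k S s = false
    · exact Or.inl ⟨lt_computeTNextBdry_of_not_forcing hf, Or.inl hf⟩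
    rw [Bool.not_eq_false] at hf
    by_cases hnb : (S.bdry s).tFloor = τ
    · refine Or.inl ⟨lt_computeTNextBdry hN updated_tFloor ?_ ?_ ?_, Or.inr hnb⟩
      · rw [hS', updated_bdry_tSync, if_pos (Or.inl hf)]
      · rw [hS', updated_bdry_Kint]
        exact hP.dt_mul_intNow_le hu' hb'
      · rw [hS', updated_bdry_Kext, advance_bdry_tSync, if_pos hnb, if_pos rfl]
        exact hP.dt_mul_extNow_le hu' hb'
    · right
      -- After forcing, a push comes back in either case: the neighbor has yet to update and will
      -- then answer, or it is already at τ and its own push is still in flight.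
      rcases (h.floor_le_now (neigh k s)).lt_or_eq with hlt' | heq
      · exact Or.inr ⟨hforcing s hf, by rwa [hother (hne k s)]⟩
      · refine Or.inl (hpend _ _ ?_)
        rcases (h.side k s).nb_gap τ ((h.floor_eq_iff _).1 heq) with h1 | h1
        · exact absurd (le_antisymm (h.le_now _ _ (h.side k s).nb_mem) h1) hnb
        · exact h1.2
  have hsideInv_self : ∀ s, P.SideInv τ (fun _ => False) Push' T' V' k s S' := by
    intro s
    have hI := h.side k s
    have hTnb : T' (neigh k s) = T (neigh k s) := insertTime_of_ne (hne k s)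
    have hVout : ∀ t, V' t (P.outer k s) = V t (P.outer k s) := fun t =>
      overwrite_of_notMem (hout (hne k s))
    have htnb : (S.bdry s).tFloor ≤ τ := h.le_now _ _ hI.nb_mem
    refine
    { nb_mem := ?_, nb_gap := ?_, nb_u := ?_, push := ?_, sumF := ?_, Kint_ge := ?_
      Kint_now := ?_, Kext_ge := ?_, Kext_now := ?_, sync_mem := ?_, sync_mem_nb := ?_
      sync_max := ?_, ordered := ?_ }
    · rw [hS', updated_bdry_tFloor, hTnb]
      exact hI.nb_mem
    · rw [hS', updated_bdry_tFloor, hTnb]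
      exact fun t ht => (hI.nb_gap t ht).imp id fun h => ⟨h.1, hpend _ _ h.2⟩
    · rw [hVout, hS', updated_bdry_tFloor, updated_bdry_u]
      exact hI.nb_u
    · intro m f hm
      rw [hTnb, hVout]
      rcases hP2 _ _ _ _ hm with h' | ⟨s', hk, -⟩
      · exact hI.push m f h'
      · exact absurd hk.symm (hne k s')
    · rw [hS', updated_bdry_sumF, updated_tFloor, updated_bdry_tFloor,
        Finset.Ico_eq_empty_of_le htnb, Finset.sum_empty]
    · intro t h1 h2
      rw [hS', updated_tFloor] at h1
      omega
    · rw [hS', updated_bdry_Kint]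
    · intro t h1 h2
      rw [hS', updated_bdry_tSync] at h1
      split_ifs at h1 with hc
      · omega
      · rw [not_or] at hc
        rw [hV', overwrite_of_lt h2, hS', updated_bdry_Kext, advance_bdry_tSync, if_neg hc.2,
          if_neg (by omega)]
        exact le_max_of_le_left (hI.Kext_ge t h1 h2)
    · rw [hS', updated_bdry_Kext]
      split_ifs
      · exact le_rfl
      · exact le_max_right _ _
    · rw [hS', updated_bdry_tSync]
      split_ifs
      · exact hτk
      · exact subset_insertTime hI.sync_mem
    · rw [hS', updated_bdry_tSync, hTnb]
      split_ifs with hc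
      · rcases hc with hc | hc
        · exact Or.inr ⟨rfl, hforcing s hc⟩
        · exact Or.inl (hnbτ s hc)
      · exact Or.inl (hsync_nb s)
    · intro t ht ht'
      rw [hTnb] at ht'
      have hle : t ≤ τ := hH.le_now _ _ ht
      rw [hS', updated_bdry_tSync]
      split_ifs with hc
      · exact Or.inl hle
      · rw [not_or] at hc
        rcases mem_insertTime_self.1 ht with rfl | ht
        · rcases hI.nb_gap t ht' with h1 | h1
          · exact absurd (le_antisymm htnb h1) hc.2
          · exact Or.inr ⟨rfl, hpend _ _ h1.2⟩
        · exact (hI.sync_max t ht ht').imp id fun h => ⟨h.1, hpend _ _ h.2⟩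
    · intro p hp q hq
      rw [hTnb] at hq ⊢
      have hqτ : q ≤ τ := h.le_now _ _ hq
      rcases mem_insertTime_self.1 hp with rfl | hp'
      · rcases hord s q hq with ⟨r, h1, h2, h3, h4⟩ | h'
        · exact Or.inl ⟨r, h1, h2, (min_le_right _ _).trans h3, h4.trans (le_max_left _ _)⟩
        · exact Or.inr (Or.inl ⟨rfl, h'⟩)
      · rcases hI.ordered p hp' q hq with ⟨r, h1, h2, h3⟩ | ⟨rfl, -⟩ | ⟨rfl, -⟩
        · exact Or.inl ⟨r, subset_insertTime h1, h2, h3⟩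
        · exact absurd (hTk _ hp') (lt_irrefl _)
        · exact Or.inl ⟨q, hτk, hq, min_le_right _ _, le_max_right _ _⟩
  have hsideInv_other : ∀ k' s, k' ≠ k →
      P.SideInv τ (fun _ => False) Push' T' V' k' s (sub k') := by
    intro k' s hk
    have hI := h.side k' s
    have hTk' : T' k' = T k' := insertTime_of_ne hk
    have hTnb : ∀ t ∈ T' (neigh k' s), t ∈ T (neigh k' s) ∨ (t = τ ∧ neigh k' s = k) := by
      intro t ht
      by_cases hnb : neigh k' s = k
      · rw [hnb] at ht ⊢
        exact (mem_insertTime_self.1 ht).symm.imp id fun h => ⟨h, rfl⟩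
      · rw [hT', insertTime_of_ne hnb] at ht
        exact Or.inl ht
    have htnb : ((sub k').bdry s).tFloor ≤ τ := h.le_now _ _ hI.nb_mem
    have hτnb : neigh k' s = k → τ ∈ T' (neigh k' s) := fun e => e ▸ hτk
    refine
    { nb_mem := subset_insertTime hI.nb_mem, nb_gap := ?_, nb_u := ?_, push := ?_, sumF := ?_
      Kint_ge := ?_, Kint_now := hI.Kint_now, Kext_ge := ?_, Kext_now := hI.Kext_now
      sync_mem := subset_insertTime hI.sync_mem, sync_mem_nb := ?_, sync_max := ?_
      ordered := ?_ }
    · intro t ht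
      rcases hTnb t ht with ht | ⟨rfl, hnb⟩
      · exact (hI.nb_gap t ht).imp id fun h => ⟨h.1, hpend _ _ h.2⟩
      · exact Or.inr ⟨rfl, hpendk _ _ hnb⟩
    · rw [hI.nb_u]
      by_cases hnb : neigh k' s = k
      · rw [hV', overwrite_of_lt (hTk _ (hnb ▸ hI.nb_mem))]
      · rw [hV', overwrite_of_notMem (hout hnb)]
    · intro m f hm
      rcases hP2 _ _ _ _ hm with h' | ⟨s', rfl, rfl, rfl, -⟩
      · obtain ⟨h1, h2⟩ := hI.push m f h'
        have hnb : neigh k' s ≠ k := fun e => lt_irrefl _ (hTk τ (e ▸ h1))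
        exact ⟨subset_insertTime h1, by rw [h2, hV', overwrite_of_notMem (hout hnb)]⟩
      · rw [neigh_neigh_opp, outer_neigh, hV', overwrite_of_mem (P.bdryCell_mem _ _) le_rfl]
        exact ⟨hτk, rfl⟩
    · rw [hI.sumF]
      refine Finset.sum_congr rfl fun t ht => ?_
      rw [hV', overwrite_of_lt ((Finset.mem_Ico.1 ht).2.trans_le htnb)]
    · intro t h1 h2
      rw [hV', overwrite_of_lt h2]
      exact hI.Kint_ge t h1 h2
    · intro t h1 h2
      rw [hV', overwrite_of_lt h2]
      exact hI.Kext_ge t h1 h2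
    · rcases hI.sync_mem_nb with h' | ⟨h1, h2⟩
      · exact Or.inl (subset_insertTime h')
      · rcases hforced _ _ h2 with h3 | h3
        · exact Or.inr ⟨h1, h3⟩
        · exact Or.inl (h1 ▸ hτnb h3)
    · intro t ht ht'
      rw [hTk'] at ht
      rcases hTnb t ht' with ht' | ⟨rfl, hnb⟩
      · exact (hI.sync_max t ht ht').imp id fun h => ⟨h.1, hpend _ _ h.2⟩
      · exact Or.inr ⟨rfl, hpendk _ _ hnb⟩
    · intro p hp q hq
      have hp' := hp
      rw [hTk'] at hp
      rcases hTnb q hq with hq' | ⟨rfl, hnb⟩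
      · rcases hI.ordered p hp q hq' with ⟨r, h1, h2, h3⟩ | ⟨rfl, h'⟩ | ⟨rfl, h'⟩
        · exact Or.inl ⟨r, subset_insertTime h1, subset_insertTime h2, h3⟩
        · rcases hforced _ _ h' with h3 | h3
          · exact Or.inr (Or.inl ⟨rfl, h3⟩)
          · exact Or.inl ⟨p, hp', hτnb h3, min_le_left _ _, le_max_left _ _⟩
        · exact Or.inr (Or.inr ⟨rfl, (hforced _ _ h').resolve_right hk⟩)
      · have hk' : neigh k s.opp = k' := by rw [← hnb, neigh_neigh_opp]
        have hord' := hord s.opp p (hk' ▸ hp)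
        rw [hk', Side.opp_opp] at hord'
        rcases hord' with ⟨r, h1, h2, h3, h4⟩ | h'
        · exact Or.inl ⟨r, subset_insertTime h2, hnb ▸ h1, (min_le_left _ _).trans h3,
            h4.trans (le_max_right _ _)⟩
        · exact Or.inr (Or.inr ⟨rfl, h'⟩)
  exact
  { toHist := hH
    floor_mem := by
      intro k'
      by_cases hk : k' = k
      · rw [hk, hself]
        exact hτk
      · rw [hother hk]
        exact subset_insertTime (h.floor_mem k')
    le_floor := by
      intro k' t ht
      by_cases hk : k' = k
      · rw [hk, hself]
        exact hH.le_now _ _ ht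
      · rw [hother hk]
        rw [hT', insertTime_of_ne hk] at ht
        exact h.le_floor k' t ht
    u_eq := by
      intro k' j hj
      by_cases hk : k' = k
      · rw [hk] at hj ⊢
        rw [hself, hV', overwrite_of_mem hj updated_tFloor.ge]
      · rw [hother hk, hV', overwrite_of_notMem fun hj' => hk (P.cells_unique hj hj')]
        exact h.u_eq k' j hj
    side := by
      intro k' s
      by_cases hk : k' = k
      · rw [hk, hself]
        exact hsideInv_self s
      · rw [hother hk]
        exact hsideInv_other k' s hk
    safe := by
      intro k' hk'
      by_cases hk : k' = k
      · rw [hk, hself] at hk'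
        exact absurd hk' (lt_irrefl _)
      · rw [hother hk] at hk' ⊢
        intro t h1 h2
        rw [hV', overwrite_of_lt h2]
        exact h.safe k' hk' t h1 h2
    ceil_le := by
      intro k'
      by_cases hk : k' = k
      · rw [hk, hself, hS', updated_tCeil]
        have hmono : ∀ s, P.computeTNextBdry (P.advance τ k S) s ≤ P.computeTNextBdry S' s := by
          intro s
          refine computeTNextBdry_mono_tSync hP.dt_pos rfl ?_ (by rw [hS', updated_bdry])
            (by rw [hS', updated_bdry]) ?_
          · rw [hS', updated_bdry]
            by_cases hf : P.forcing τ k S s = true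
            · simp only [hf, if_true, advance_bdry_tSync]
              split_ifs
              · exact le_rfl
              · exact h.le_now _ _ (h.side k s).sync_mem
            · simp only [hf, if_false, le_refl, Bool.false_eq_true]
          · have := (hsideInv_self s).Kext_nonneg hP
            rwa [hS', updated_bdry] at this
        exact min_le_min (min_le_min (hmono _) (hmono _)) computeTNextInt_advance.le
      · rw [hother hk]
        exact h.ceil_le k'
    awake := by
      intro k' hk'
      by_cases hk : k' = k
      · rw [hk, hself] at hk'
        exact absurd hk' (lt_irrefl _)
      · rw [hother hk] at hk' ⊢
        exact Or.inr (hU _ _ ((h.awake k' hk').resolve_left fun hAk => hk (hA _ hAk)))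
    side_ok := by
      intro k' hk' hN s
      by_cases hk : k' = k
      · subst hk
        rw [hself]
        exact (hside s hN).imp And.left id
      · rw [hother hk] at hk' ⊢
        exact (h.side_ok k' hk' hN s).imp id (hwill k' s hk)
    ceil_ok := by
      intro k' hk' hN
      by_cases hk : k' = k
      · subst hk
        rw [hself]
        by_cases hex : ∃ s, WillReceive τ (fun _ => False) Push' sub' k' s
        · exact Or.inr hex
        left
        have hlt' : τ < S'.tCeil := by
          rw [hS', updated_tCeil]
          refine lt_computeTNext (fun s => ?_) ?_
          · obtain ⟨h1, h2⟩ := (hside s hN).resolve_right fun h' => hex ⟨s, h'⟩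
            rwa [computeTNextBdry_advance h2]
          · rw [computeTNextInt_advance]
            exact hP.lt_computeTNextInt hN updated_tFloor hu' hb'
        exact ⟨hlt', hUk hlt'⟩
      · rw [hother hk] at hk' ⊢
        exact (h.ceil_ok k' hk' hN).imp (fun h' => ⟨h'.1, hU _ _ h'.2⟩)
          fun ⟨s, h'⟩ => ⟨s, hwill k' s hk h'⟩ }

end Update

end Inv

end Sim

end LocalTimestepping

namespace LocalTimestepping

namespace Sim

variable {n M : ℕ} [NeZero n] [NeZero M] {P : Sim n M} {f : ℝ → ℝ} {lo hi : ℝ} {U₀ : Fin n → ℝ}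
  {τ : ℕ} {A : Fin M → Prop} {Push : Fin M → Side → ℝ → Bool → Prop}
  {Upd Upd' : Fin M → ℕ → Prop} {sub : Fin M → Submesh n} {T : Fin M → Set ℕ}
  {V : ℕ → Fin n → ℝ} {k : Fin M}

/-! ### The initial state -/

section Init

variable (P U₀ k)

/-- The initial state of submesh `k`, before the bounds and the next update time are computed. -/
def initRaw : Submesh n :=
  { tFloor := 0
    tCeil := 0
    u := U₀
    bdry := fun s =>
      { tFloor := 0
        tSync := 0
        u := U₀ (P.outer k s)
        sumF := 0
        Kint := 0
        Kext := 0 } }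

/-- The initial state of submesh `k`, before the next update time is computed. -/
def initBounds : Submesh n :=
  P.updateKBdry 0 k .right (P.updateKBdry 0 k .left (P.initRaw U₀ k))

lemma initSub_eq : P.initSub U₀ k =
    { P.initBounds U₀ k with tCeil := P.computeTNext k (P.initBounds U₀ k) } := by
  have h : P.initRaw U₀ k =
      { tFloor := 0
        tCeil := 0
        u := U₀
        bdry := fun s =>
          { tFloor := 0
            tSync := 0
            u := match s with
              | .left => U₀ (P.first k - 1)
              | .right => U₀ (P.last k + 1)
            sumF := 0
            Kint := 0
            Kext := 0 } } := by
    rw [initRaw]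
    congr 1
    funext s
    cases s <;> rfl
  rw [initBounds, h]
  rfl

variable {s : Side}

lemma initSub_tFloor : (P.initSub U₀ k).tFloor = 0 := rfl

lemma initSub_tCeil : (P.initSub U₀ k).tCeil = P.computeTNext k (P.initSub U₀ k) := rfl

lemma initSub_bdry : (P.initSub U₀ k).bdry s = (P.initBounds U₀ k).bdry s := by rw [initSub_eq]

lemma initSub_bdry_tFloor : ((P.initSub U₀ k).bdry s).tFloor = 0 := by
  simp [initSub_bdry, initBounds, initRaw]

lemma initSub_bdry_tSync : ((P.initSub U₀ k).bdry s).tSync = 0 := by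
  simp [initSub_bdry, initBounds, initRaw]

lemma initSub_bdry_sumF : ((P.initSub U₀ k).bdry s).sumF = 0 := by
  simp [initSub_bdry, initBounds, initRaw]

lemma initSub_bdry_u : ((P.initSub U₀ k).bdry s).u = U₀ (P.outer k s) := by
  simp [initSub_bdry, initBounds, initRaw]

lemma sameView_initRaw : SameView (P.initRaw U₀ k) (P.initSub U₀ k) s :=
  ⟨rfl, by rw [initSub_bdry_u, initRaw]⟩

lemma initSub_bdry_Kint :
    ((P.initSub U₀ k).bdry s).Kint = P.intNow k (P.initSub U₀ k) s := by
  rw [← intNow_congr (P.sameView_initRaw U₀ k), initSub_bdry, initBounds, updateKBdry_both_Kint,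
    if_pos (show (P.initRaw U₀ k).tFloor = 0 from rfl)]

lemma initSub_bdry_Kext :
    ((P.initSub U₀ k).bdry s).Kext = P.extNow k (P.initSub U₀ k) s := by
  rw [← extNow_congr (P.sameView_initRaw U₀ k), initSub_bdry, initBounds, updateKBdry_both_Kext,
    if_pos (show ((P.initRaw U₀ k).bdry s).tSync = 0 from rfl)]

end Init

lemma inv_init (hP : P.Admissible f lo hi) (hU₀ : ∀ j, U₀ j ∈ Set.Icc lo hi)
    (hpush : ∀ k s m f, ¬ Push k s m f) (hupd : ∀ k, Upd k (P.initSub U₀ k).tCeil) :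
    P.Inv lo hi U₀ 0 (fun _ => False) Push Upd (P.initSub U₀) (fun _ => {0}) (fun _ => U₀) := by
  -- Nothing in {0} comes after any t. The impossible equation stands for a contradiction in a form
  -- suited to `omega`.
  have hnext : ∀ {a t b : ℕ}, IsNextIn {0} t b → a = a + 1 := by
    intro a t b h
    have h1 : b = 0 := h.1
    have h2 := h.2.1
    omega
  have hu : ∀ k : Fin M, ∀ j ∈ P.cells k, (P.initSub U₀ k).u j ∈ Set.Icc lo hi :=
    fun k j _ => hU₀ j
  have hb : ∀ (k : Fin M) s, ((P.initSub U₀ k).bdry s).u ∈ Set.Icc lo hi := fun k s => by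
    rw [initSub_bdry_u]
    exact hU₀ _
  have hside : ∀ (k : Fin M) s, 0 < P.N → 0 < P.computeTNextBdry (P.initSub U₀ k) s := by
    intro k s hN
    refine lt_computeTNextBdry hN (initSub_tFloor P U₀ k) (initSub_bdry_tSync P U₀ k) ?_ ?_
    · rw [initSub_bdry_Kint]
      exact hP.dt_mul_intNow_le (hu k) (hb k)
    · rw [initSub_bdry_Kext]
      exact hP.dt_mul_extNow_le (hu k) (hb k)
  exact
  { zero_mem := fun _ => rfl
    le_now := fun _ t ht => le_of_eq ht
    const := fun _ _ _ _ _ => rfl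
    init := rfl
    range := fun _ => hU₀
    euler := fun _ _ _ a b _ hb => absurd (hnext (a := a) hb) (by omega)
    cflInt := fun _ _ _ _ a _ _ hb => absurd (hnext (a := a) hb) (by omega)
    cflExt := fun _ _ _ a _ _ hb => absurd (hnext (a := a) hb) (by omega)
    floor_mem := fun _ => rfl
    le_floor := fun _ t ht => le_of_eq ht
    u_eq := fun _ _ _ => rfl
    side := fun k s =>
      { nb_mem := initSub_bdry_tFloor P U₀ k
        nb_gap := fun t ht => Or.inl ((le_of_eq ht).trans (Nat.zero_le _))
        nb_u := initSub_bdry_u P U₀ k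
        push := fun m f hm => absurd hm (hpush k s m f)
        sumF := by rw [initSub_bdry_sumF, initSub_bdry_tFloor, initSub_tFloor]; simp
        Kint_ge := fun t _ ht => absurd ht (Nat.not_lt_zero t)
        Kint_now := (initSub_bdry_Kint P U₀ k).ge
        Kext_ge := fun t _ ht => absurd ht (Nat.not_lt_zero t)
        Kext_now := (initSub_bdry_Kext P U₀ k).ge
        sync_mem := initSub_bdry_tSync P U₀ k
        sync_mem_nb := Or.inl (initSub_bdry_tSync P U₀ k)
        sync_max := fun t ht _ => Or.inl ((le_of_eq ht).trans (Nat.zero_le _))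
        ordered := by
          rintro p rfl q rfl
          exact Or.inl ⟨0, rfl, rfl, by simp, by simp⟩ }
    safe := fun k hk => absurd hk (Nat.not_lt_zero _)
    ceil_le := fun k => (initSub_tCeil P U₀ k).le
    awake := fun k hk => absurd hk (Nat.not_lt_zero _)
    side_ok := fun k _ hN s => Or.inl (hside k s hN)
    ceil_ok := by
      intro k _ hN
      refine Or.inl ⟨?_, hupd k⟩
      rw [initSub_tCeil]
      exact lt_computeTNext (fun s => hside k s hN)
        (hP.lt_computeTNextInt hN (initSub_tFloor P U₀ k) (hu k) (hb k)) }

/-! ### Steps of the simulation -/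

/-- Removing an update event of submesh `k` at the current time, if it is either obsolete or about
to be executed. -/
lemma Inv.drop_update (h : P.Inv lo hi U₀ τ (fun _ => False) Push Upd sub T V)
    (hU : ∀ k' t, Upd k' t → Upd' k' t ∨ (k' = k ∧ t = τ))
    (hA : (sub k).tFloor < τ → (sub k).tCeil = τ → A k) :
    P.Inv lo hi U₀ τ A Push Upd' sub T V := by
  have hforced : ∀ k' s, Forced (fun _ => False) Push k' s → Forced A Push k' s :=
    fun k' s h' => h'.imp False.elim id
  have hwill : ∀ k' s, WillReceive τ (fun _ => False) Push sub k' s →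
      WillReceive τ A Push sub k' s := fun k' s h' => h'.imp id fun h' => ⟨hforced _ _ h'.1, h'.2⟩
  exact
  { toHist := h.toHist
    floor_mem := h.floor_mem
    le_floor := h.le_floor
    u_eq := h.u_eq
    side := fun k' s => (h.side k' s).transfer rfl rfl rfl (fun _ _ => id) id
      (fun h' => Or.inl (hforced _ _ h')) (fun h' => Or.inl (hforced _ _ h'))
    safe := h.safe
    ceil_le := h.ceil_le
    awake := by
      intro k' hk'
      rcases hU k' _ ((h.awake k' hk').resolve_left id) with h' | ⟨rfl, h'⟩
      · exact Or.inr h'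
      · exact Or.inl (hA hk' h')
    side_ok := fun k' hk' hN s => (h.side_ok k' hk' hN s).imp id (hwill k' s)
    ceil_ok := fun k' hk' hN => (h.ceil_ok k' hk' hN).imp
      (fun h' => ⟨h'.1, (hU k' _ h'.2).resolve_right fun h2 => by have := h'.1; omega⟩)
      fun ⟨s, h'⟩ => ⟨s, hwill k' s h'⟩ }

/-- The pushes at time `τ` in an event queue. -/
def pushIn (Q : Multiset (ℕ × Event M)) (τ : ℕ) (k : Fin M) (s : Side) (m : ℝ) (f : Bool) : Prop :=
  (τ, Event.pushFlux k s m f) ∈ Q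

/-- The unforced updates in an event queue. -/
def updIn (Q : Multiset (ℕ × Event M)) (k : Fin M) (t : ℕ) : Prop :=
  (t, Event.update k false) ∈ Q

/-- The timestamps in an event queue at time `τ` are consistent. -/
structure QueueOk (P : Sim n M) (τ : ℕ) (Q : Multiset (ℕ × Event M)) : Prop where
  ge_now : ∀ e ∈ Q, τ ≤ e.1
  le_end : ∀ e ∈ Q, e.1 ≤ P.N
  push_now : ∀ t k s m f, (t, Event.pushFlux k s m f) ∈ Q → t = τ

/-- The invariant of a configuration of the simulation at time `τ`. -/
structure ConfigInv (P : Sim n M) (lo hi : ℝ) (U₀ : Fin n → ℝ) (c : Config n M) (τ : ℕ)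
    (T : Fin M → Set ℕ) (V : ℕ → Fin n → ℝ) : Prop where
  inv : P.Inv lo hi U₀ τ (fun _ => False) (pushIn c.queue τ) (updIn c.queue) c.sub T V
  now_le : τ ≤ P.N
  queue : P.QueueOk τ c.queue
  trace : c.trace = historyTrace P.dt (fun j => T (P.owner j)) V

lemma configInv_init (hP : P.Admissible f lo hi) (hU₀ : ∀ j, U₀ j ∈ Set.Icc lo hi) :
    P.ConfigInv lo hi U₀ (P.initConfig U₀) 0 (fun _ => {0}) (fun _ => U₀) := by
  have hmem : ∀ e, e ∈ (P.initConfig U₀).queue ↔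
      ∃ k, ((P.initSub U₀ k).tCeil, Event.update k false) = e := by
    intro e
    simp [initConfig]
  refine ⟨inv_init hP hU₀ ?_ ?_, Nat.zero_le _, ⟨fun _ _ => Nat.zero_le _, ?_, ?_⟩, ?_⟩
  · intro k s m f hm
    obtain ⟨k', hk'⟩ := (hmem _).1 hm
    simp at hk'
  · exact fun k => (hmem _).2 ⟨k, rfl⟩
  · intro e he
    obtain ⟨k, rfl⟩ := (hmem _).1 he
    exact computeTNext_le_N
  · intro t k s m f hm
    obtain ⟨k', hk'⟩ := (hmem _).1 hm
    simp at hk'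
  · ext ⟨j, r, v⟩
    rw [mem_historyTrace]
    simp [initConfig]

/-- Pending pushes carry the current time, so if the smallest timestamp is later, none is in flight
and the time may be moved. -/
lemma ConfigInv.advance {c : Config n M} (h : P.ConfigInv lo hi U₀ c τ T V)
    (hP : P.Admissible f lo hi) {e : ℕ × Event M} (he : e ∈ c.queue)
    (hmin : ∀ e' ∈ c.queue, e.1 ≤ e'.1) : P.ConfigInv lo hi U₀ c e.1 T V := by
  rcases (h.queue.ge_now e he).eq_or_lt with heq | hlt
  · rwa [← heq]
  have hno : ∀ t k s m f, (t, Event.pushFlux k s m f) ∉ c.queue := by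
    intro t k s m f hm
    have h1 := h.queue.push_now _ _ _ _ _ hm
    have h2 := hmin _ hm
    simp only at h2
    omega
  have hN := h.queue.le_end e he
  exact
  { inv := h.inv.advance hP hlt (hlt.trans_le hN) (fun k s m f => hno τ k s m f)
      (fun k s m f => hno e.1 k s m f) fun k t ht => hmin _ ht
    now_le := hN
    queue :=
      { ge_now := hmin
        le_end := h.queue.le_end
        push_now := fun t k s m f hm => absurd hm (hno t k s m f) }
    trace := h.trace }

lemma historyTrace_union (P : Sim n M) (hT : ∀ t ∈ T k, t < τ) (u : Fin n → ℝ) :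
    historyTrace P.dt (fun j => T (P.owner j)) V ∪
        {e | ∃ j ∈ P.cells k, e = (j, (τ : ℝ) * P.dt, u j)} =
      historyTrace P.dt (fun j => insertTime T k τ (P.owner j)) (P.overwrite V k τ u) := by
  ext ⟨j, r, v⟩
  rw [Set.mem_union, mem_historyTrace, mem_historyTrace]
  by_cases hj : j ∈ P.cells k
  · rw [P.owner_eq hj]
    constructor
    · rintro (⟨t, ht, h1, h2⟩ | ⟨j', hj', h'⟩)
      · exact ⟨t, subset_insertTime ht, h1, by rw [overwrite_of_lt (hT t ht), h2]⟩
      · simp only [Prod.mk.injEq] at h'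
        obtain ⟨rfl, rfl, rfl⟩ := h'
        exact ⟨τ, mem_insertTime_self.2 (Or.inl rfl), rfl, by rw [overwrite_of_mem hj le_rfl]⟩
    · rintro ⟨t, ht, h1, h2⟩
      rcases mem_insertTime_self.1 ht with rfl | ht
      · right
        rw [overwrite_of_mem hj le_rfl] at h2
        exact ⟨j, hj, by rw [h1, h2]⟩
      · left
        rw [overwrite_of_lt (hT t ht)] at h2
        exact ⟨t, ht, h1, h2⟩
  · have hne : P.owner j ≠ k := fun e => hj (e ▸ P.mem_cells_owner j)
    rw [insertTime_of_ne hne]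
    simp only [overwrite_of_notMem hj]
    refine or_iff_left ?_
    rintro ⟨j', hj', h'⟩
    simp only [Prod.mk.injEq] at h'
    exact hj (h'.1 ▸ hj')

/-- The configuration after a proper update of submesh `k`. -/
lemma configInv_update {Q q : Multiset (ℕ × Event M)} {trace : EventTrace n}
    (h : P.Inv lo hi U₀ τ A (pushIn Q τ) (updIn Q) sub T V) (hP : P.Admissible f lo hi)
    (hA : ∀ k', A k' → k' = k) (hlt : (sub k).tFloor < τ) (hN : τ ≤ P.N)
    (hQ : P.QueueOk τ Q) (htr : trace = historyTrace P.dt (fun j => T (P.owner j)) V)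
    (hq1 : Q ⊆ q)
    (hq2 : ∀ e ∈ q, e ∈ Q ∨ (∃ s, e = P.pushEvent τ k (sub k) s) ∨
      ∃ t, e = (t, Event.update k false) ∧ τ < t ∧ t ≤ P.N)
    (hq3 : ∀ s, P.pushEvent τ k (sub k) s ∈ q)
    (hq4 : τ < (P.updated τ k (sub k)).tCeil →
      ((P.updated τ k (sub k)).tCeil, Event.update k false) ∈ q) :
    ∃ T' V', P.ConfigInv lo hi U₀
      { sub := Function.update sub k (P.updated τ k (sub k))
        queue := q
        trace := trace ∪
          {e | ∃ j ∈ P.cells k, e = (j, (τ : ℝ) * P.dt, (P.updated τ k (sub k)).u j)} }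
      τ T' V' := by
  have hT : ∀ t ∈ T k, t < τ := fun t ht => (h.le_floor k t ht).trans_lt hlt
  refine ⟨insertTime T k τ, P.overwrite V k τ (P.updated τ k (sub k)).u, ?_, hN, ?_, ?_⟩
  · refine h.update hP hA hlt (fun k' s' m f hm => hq1 hm) ?_ hq3 (fun k' t ht => hq1 ht) hq4
    intro k' s' m f hm
    rcases hq2 _ hm with h' | ⟨s, h'⟩ | ⟨t, h', -⟩
    · exact Or.inl h'
    · simp only [pushEvent, Prod.mk.injEq, Event.pushFlux.injEq, true_and] at h'
      exact Or.inr ⟨s, h'⟩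
    · simp at h'
  · refine ⟨fun e he => ?_, fun e he => ?_, fun t k' s' m f hm => ?_⟩
    · rcases hq2 _ he with h' | ⟨s, rfl⟩ | ⟨t, rfl, h1, -⟩
      · exact hQ.ge_now e h'
      · exact le_rfl
      · exact h1.le
    · rcases hq2 _ he with h' | ⟨s, rfl⟩ | ⟨t, rfl, -, h2⟩
      · exact hQ.le_end e h'
      · exact hN
      · exact h2
    · rcases hq2 _ hm with h' | ⟨s, h'⟩ | ⟨t, h', -⟩
      · exact hQ.push_now _ _ _ _ _ h'
      · exact (Prod.mk.inj h').1
      · simp at h'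
  · rw [htr]
    exact historyTrace_union P hT _

/-- The weight of an event in the potential that bounds the number of remaining steps. -/
def weight : ℕ × Event M → ℕ
  | (_, .update _ _) => 1
  | (_, .pushFlux _ _ _ _) => 2

lemma weight_pushEvent {S : Submesh n} : weight (P.pushEvent τ k S s) = 2 := rfl

/-- A bound for the number of remaining steps of the simulation. -/
def potential (P : Sim n M) (c : Config n M) : ℕ :=
  -- A proper update lowers the sum by at least one. It schedules two pushes and one update at most,
  -- and the push that triggered it perhaps another update: total weight at most 6, less than 10.
  10 * ∑ k, (P.N - (c.sub k).tFloor) + (c.queue.map weight).sum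

lemma sum_update_lt (hN : τ ≤ P.N) (hlt : (sub k).tFloor < τ) {S' : Submesh n}
    (hS' : S'.tFloor = τ) :
    ∑ k', (P.N - (Function.update sub k S' k').tFloor) < ∑ k', (P.N - (sub k').tFloor) := by
  refine Finset.sum_lt_sum (fun k' _ => ?_) ⟨k, Finset.mem_univ _, ?_⟩
  · by_cases hk : k' = k
    · subst hk
      rw [Function.update_self, hS']
      omega
    · rw [Function.update_of_ne hk]
  · rw [Function.update_self, hS']
    omega

lemma sum_update_eq {S' : Submesh n} (hS' : S'.tFloor = (sub k).tFloor) :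
    ∑ k', (P.N - (Function.update sub k S' k').tFloor) = ∑ k', (P.N - (sub k').tFloor) := by
  refine Finset.sum_congr rfl fun k' _ => ?_
  by_cases hk : k' = k
  · subst hk
    rw [Function.update_self, hS']
  · rw [Function.update_of_ne hk]

lemma weight_schedule_le (p : Prop) [Decidable p] (t : ℕ) (k : Fin M) :
    ((if p then {(t, Event.update k false)} else 0 : Multiset (ℕ × Event M)).map weight).sum ≤ 1 := by
  split_ifs <;> simp [weight]

lemma mem_schedule {p : Prop} [Decidable p] {t : ℕ} {k : Fin M} {e : ℕ × Event M} :
    e ∈ (if p then {(t, Event.update k false)} else 0 : Multiset (ℕ × Event M)) ↔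
      p ∧ e = (t, Event.update k false) := by
  split_ifs with h <;> simp [h]

lemma QueueOk.of_cons {e : ℕ × Event M} {Q : Multiset (ℕ × Event M)}
    (h : P.QueueOk τ (e ::ₘ Q)) : P.QueueOk τ Q :=
  ⟨fun e' he' => h.ge_now e' (Multiset.mem_cons_of_mem he'),
    fun e' he' => h.le_end e' (Multiset.mem_cons_of_mem he'),
    fun t k s m f hm => h.push_now t k s m f (Multiset.mem_cons_of_mem hm)⟩

lemma configInv_exec_update {c : Config n M} {Q : Multiset (ℕ × Event M)} {forced : Bool}
    (h : P.ConfigInv lo hi U₀ c τ T V) (hP : P.Admissible f lo hi)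
    (hQ : c.queue = (τ, Event.update k forced) ::ₘ Q) :
    ∃ T' V', P.ConfigInv lo hi U₀ (P.execUpdate τ k forced { c with queue := Q }) τ T' V' ∧
      P.potential (P.execUpdate τ k forced { c with queue := Q }) < P.potential c := by
  classical
  have hqok := h.queue
  rw [hQ] at hqok
  have hpush : pushIn c.queue τ = pushIn Q τ := by
    funext k' s m f
    simp [pushIn, hQ]
  have hupd : ∀ k' t, updIn c.queue k' t → updIn Q k' t ∨ (k' = k ∧ t = τ) := by
    intro k' t ht
    rw [updIn, hQ, Multiset.mem_cons, Prod.mk.injEq, Event.update.injEq] at ht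
    rcases ht with ⟨h1, h2, -⟩ | h'
    · exact Or.inr ⟨h2, h1⟩
    · exact Or.inl h'
  have hinv := h.inv
  rw [hpush] at hinv
  have hpot : P.potential c = P.potential { c with queue := Q } + 1 := by
    simp [potential, hQ, weight]
    ring
  have hnoop : ((c.sub k).tFloor < τ → (c.sub k).tCeil = τ → False) →
      P.ConfigInv lo hi U₀ { c with queue := Q } τ T V ∧
        P.potential { c with queue := Q } < P.potential c := fun hA =>
    ⟨⟨hinv.drop_update hupd hA, h.now_le, hqok.of_cons, h.trace⟩, by omega⟩
  by_cases h1 : τ ≠ (c.sub k).tCeil ∧ forced = false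
  · rw [P.execUpdate_of_ne (c := { c with queue := Q }) h1]
    exact ⟨T, V, hnoop fun _ e => h1.1 e.symm⟩
  by_cases h2 : τ = (c.sub k).tFloor
  · rw [P.execUpdate_of_eq (c := { c with queue := Q }) h2]
    exact ⟨T, V, hnoop fun e _ => by omega⟩
  have hlt : (c.sub k).tFloor < τ := lt_of_le_of_ne (h.inv.floor_le_now k) (Ne.symm h2)
  rw [P.execUpdate_of_run (c := { c with queue := Q }) h1 h2]
  obtain ⟨T', V', h'⟩ := configInv_update
    (q := Q + {P.pushEvent τ k (c.sub k) .left, P.pushEvent τ k (c.sub k) .right} +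
      (if τ < (P.updated τ k (c.sub k)).tCeil then
        {((P.updated τ k (c.sub k)).tCeil, Event.update k false)} else 0))
    (hinv.drop_update (A := fun k' => k' = k) hupd fun _ _ => rfl) hP (fun _ => id) hlt h.now_le
    hqok.of_cons h.trace
    (fun e he => by simp [he])
    (fun e he => by
      simp only [Multiset.mem_add, mem_schedule, Multiset.insert_eq_cons, Multiset.mem_cons,
        Multiset.mem_singleton] at he
      rcases he with (he | he | he) | he
      · exact Or.inl he
      · exact Or.inr (Or.inl ⟨_, he⟩)
      · exact Or.inr (Or.inl ⟨_, he⟩)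
      · exact Or.inr (Or.inr ⟨_, he.2, he.1, computeTNext_le_N⟩))
    (fun s => by cases s <;> simp)
    (fun hc => by simp [hc])
  refine ⟨T', V', h', ?_⟩
  have e1 := sum_update_lt (P := P) h.now_le hlt (updated_tFloor (P := P) (k := k) (S := c.sub k))
  have e2 := weight_schedule_le (τ < (P.updated τ k (c.sub k)).tCeil)
    (P.updated τ k (c.sub k)).tCeil k
  rw [hpot]
  simp only [potential, Multiset.map_add, Multiset.sum_add, Multiset.insert_eq_cons,
    Multiset.map_cons, Multiset.sum_cons, Multiset.map_singleton, Multiset.sum_singleton, weight_pushEvent]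
  eta_reduce at *
  omega

lemma configInv_exec_push {c : Config n M} {Q : Multiset (ℕ × Event M)} {s : Side} {msg : ℝ}
    {force : Bool} (h : P.ConfigInv lo hi U₀ c τ T V) (hP : P.Admissible f lo hi)
    (hQ : c.queue = (τ, Event.pushFlux k s msg force) ::ₘ Q) :
    ∃ T' V',
      P.ConfigInv lo hi U₀ (P.execPushFlux τ k s msg force { c with queue := Q }) τ T' V' ∧
      P.potential (P.execPushFlux τ k s msg force { c with queue := Q }) < P.potential c := by
  classical
  have hqok := h.queue
  rw [hQ] at hqok
  have hmem : pushIn c.queue τ k s msg force := by simp [pushIn, hQ]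
  have hP1 : ∀ k' s' m f, pushIn Q τ k' s' m f → pushIn c.queue τ k' s' m f := by
    intro k' s' m f hm
    rw [pushIn, hQ]
    exact Multiset.mem_cons_of_mem hm
  have hP2 : ∀ k' s' m f, pushIn c.queue τ k' s' m f →
      pushIn Q τ k' s' m f ∨ (k' = k ∧ s' = s ∧ m = msg ∧ f = force) := by
    intro k' s' m f hm
    rw [pushIn, hQ, Multiset.mem_cons, Prod.mk.injEq, Event.pushFlux.injEq] at hm
    exact hm.symm.imp id And.right
  have hU : ∀ k' t, updIn c.queue k' t → updIn Q k' t := by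
    intro k' t ht
    simpa [updIn, hQ] using ht
  have hpot : P.potential c = P.potential { c with queue := Q } + 2 := by
    simp [potential, hQ, weight]
    ring
  set S' := P.received τ k s msg (c.sub k) with hS'
  have hSf : S'.tFloor = (c.sub k).tFloor := received_tFloor
  have hsum := sum_update_eq (P := P) (sub := c.sub) (k := k) (S' := S') hSf
  by_cases hrun : (c.sub k).tFloor < τ ∧ (force = true ∨ S'.tCeil ≤ τ)
  · obtain ⟨hlt, hcond⟩ := hrun
    have hinv := h.inv.receive (A := fun k' => k' = k) (Push' := pushIn Q τ) (Upd' := updIn Q)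
      hP hmem hP1 hP2 (fun _ => hlt) (fun _ _ => rfl) (fun _ _ => rfl) hU
      (fun _ hA => absurd rfl hA)
    rw [← hS'] at hinv
    have hself : Function.update c.sub k S' k = S' := Function.update_self _ _ _
    rw [P.execPushFlux_eq]
    simp only [← hS', if_pos hcond]
    rw [P.execUpdate_of_run (by simp) (by simp only [hself]; omega)]
    simp only [hself, Function.update_self]
    have hlt' : (Function.update c.sub k S' k).tFloor < τ := by rw [hself]; omega
    -- An update triggered by a push has its successor scheduled twice, by itself and by the push.
    -- The invariant only uses membership in the queue, so the duplicate is harmless.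
    obtain ⟨T', V', h'⟩ := configInv_update
      (q := Q + {P.pushEvent τ k S' .left, P.pushEvent τ k S' .right} +
        (if τ < (P.updated τ k S').tCeil then
          {((P.updated τ k S').tCeil, Event.update k false)} else 0) +
        (if τ < (P.updated τ k S').tCeil then
          {((P.updated τ k S').tCeil, Event.update k false)} else 0))
      hinv hP (fun _ => id) hlt' h.now_le hqok.of_cons h.trace
      (fun e he => by simp [he])
      (fun e he => by
        rw [hself]
        simp only [Multiset.mem_add, mem_schedule, Multiset.insert_eq_cons, Multiset.mem_cons,
          Multiset.mem_singleton] at he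
        rcases he with ((he | he | he) | he) | he
        · exact Or.inl he
        · exact Or.inr (Or.inl ⟨_, he⟩)
        · exact Or.inr (Or.inl ⟨_, he⟩)
        · exact Or.inr (Or.inr ⟨_, he.2, he.1, computeTNext_le_N⟩)
        · exact Or.inr (Or.inr ⟨_, he.2, he.1, computeTNext_le_N⟩))
      (fun s => by rw [hself]; cases s <;> simp)
      (fun hc => by rw [hself] at hc ⊢; simp [hc])
    rw [hself] at h'
    refine ⟨T', V', h', ?_⟩
    have e1 := sum_update_lt (P := P) h.now_le hlt' (updated_tFloor (P := P) (k := k) (S := S'))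
    have e2 := weight_schedule_le (τ < (P.updated τ k S').tCeil) (P.updated τ k S').tCeil k
    rw [hpot]
    simp only [potential, Multiset.map_add, Multiset.sum_add, Multiset.insert_eq_cons,
      Multiset.map_cons, Multiset.sum_cons, Multiset.map_singleton, Multiset.sum_singleton, weight_pushEvent]
    omega
  · have hcond : force = true ∨ S'.tCeil ≤ τ → τ = (c.sub k).tFloor := fun h' =>
      le_antisymm (not_lt.1 fun hlt => hrun ⟨hlt, h'⟩) (h.inv.floor_le_now k)
    have heq : P.execPushFlux τ k s msg force { c with queue := Q } =
        { c with
          sub := Function.update c.sub k S'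
          queue := Q + (if τ < S'.tCeil then {(S'.tCeil, Event.update k false)} else 0) } := by
      have hc₂ : (if force = true ∨ S'.tCeil ≤ τ then
          P.execUpdate τ k true { c with sub := Function.update c.sub k S', queue := Q } else
          { c with sub := Function.update c.sub k S', queue := Q }) =
          { c with sub := Function.update c.sub k S', queue := Q } := by
        split_ifs with h1
        · exact P.execUpdate_of_eq (by simp only [Function.update_self, hSf]; exact hcond h1)
        · rfl
      rw [P.execPushFlux_eq]
      simp only [← hS', hc₂, Function.update_self]
    rw [heq]
    refine ⟨T, V, ⟨?_, h.now_le, ?_, h.trace⟩, ?_⟩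
    · refine h.inv.receive hP hmem ?_ ?_ False.elim (fun h1 h2 => ?_) (fun h1 h2 => ?_) ?_ ?_
      · intro k' s' m f hm
        refine hP1 k' s' m f ?_
        simpa [pushIn, mem_schedule] using hm
      · intro k' s' m f hm
        refine (hP2 k' s' m f hm).imp (fun h' => ?_) id
        exact Multiset.mem_add.2 (Or.inl h')
      · have := hcond (Or.inl h1)
        omega
      · have := hcond (Or.inr h1)
        omega
      · exact fun k' t ht => Multiset.mem_add.2 (Or.inl (hU k' t ht))
      · intro hc _
        exact Multiset.mem_add.2 (Or.inr (mem_schedule.2 ⟨hc, rfl⟩))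
    · have hok := hqok.of_cons
      refine ⟨fun e he => ?_, fun e he => ?_, fun t k' s' m f hm => ?_⟩
      · rcases Multiset.mem_add.1 he with he | he
        · exact hok.ge_now e he
        · obtain ⟨h1, rfl⟩ := mem_schedule.1 he
          exact h1.le
      · rcases Multiset.mem_add.1 he with he | he
        · exact hok.le_end e he
        · obtain ⟨h1, rfl⟩ := mem_schedule.1 he
          exact computeTNext_le_N
      · rcases Multiset.mem_add.1 hm with hm | hm
        · exact hok.push_now _ _ _ _ _ hm
        · simpa using (mem_schedule.1 hm).2
    · have e2 := weight_schedule_le (τ < S'.tCeil) S'.tCeil k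
      rw [hpot]
      simp only [potential, Multiset.map_add, Multiset.sum_add, hsum]
      omega

/-- Every step of the simulation preserves the invariant and decreases the potential. -/
lemma ConfigInv.step {c c' : Config n M} (h : P.ConfigInv lo hi U₀ c τ T V)
    (hP : P.Admissible f lo hi) (hstep : P.Step c c') :
    (∃ τ' T' V', P.ConfigInv lo hi U₀ c' τ' T' V') ∧ P.potential c' < P.potential c := by
  obtain ⟨⟨τ', ev⟩, Q, hQ, hmin, rfl⟩ := hstep
  have h' := h.advance hP (e := (τ', ev)) (by rw [hQ]; exact Multiset.mem_cons_self _ _) (by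
    intro e' he'
    rw [hQ, Multiset.mem_cons] at he'
    rcases he' with rfl | he'
    · exact le_rfl
    · exact hmin e' he')
  cases ev with
  | update k forced =>
    obtain ⟨T', V', h1, h2⟩ := configInv_exec_update h' hP hQ
    exact ⟨⟨_, T', V', h1⟩, h2⟩
  | pushFlux k s msg force =>
    obtain ⟨T', V', h1, h2⟩ := configInv_exec_push h' hP hQ
    exact ⟨⟨_, T', V', h1⟩, h2⟩

lemma exists_configInv_of_reachable {c : Config n M} (hP : P.Admissible f lo hi)
    (hU₀ : ∀ j, U₀ j ∈ Set.Icc lo hi)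
    (hc : Relation.ReflTransGen P.Step (P.initConfig U₀) c) :
    ∃ τ T V, P.ConfigInv lo hi U₀ c τ T V := by
  induction hc with
  | refl => exact ⟨0, _, _, configInv_init hP hU₀⟩
  | tail _ hstep ih =>
    obtain ⟨τ, T, V, h⟩ := ih
    exact (h.step hP hstep).1

lemma not_exists_infinite_run (hP : P.Admissible f lo hi) (hU₀ : ∀ j, U₀ j ∈ Set.Icc lo hi) :
    ¬ ∃ c : ℕ → Config n M, c 0 = P.initConfig U₀ ∧ ∀ i, P.Step (c i) (c (i + 1)) := by
  rintro ⟨c, h0, hstep⟩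
  have hreach : ∀ i, Relation.ReflTransGen P.Step (P.initConfig U₀) (c i) := by
    intro i
    induction i with
    | zero => rw [h0]
    | succ i ih => exact ih.tail (hstep i)
  have hdec : ∀ i, P.potential (c (i + 1)) < P.potential (c i) := by
    intro i
    obtain ⟨τ, T, V, h⟩ := exists_configInv_of_reachable hP hU₀ (hreach i)
    exact (h.step hP (hstep i)).2
  have hbound : ∀ i, P.potential (c i) + i ≤ P.potential (c 0) := by
    intro i
    induction i with
    | zero => simp
    | succ i ih => have := hdec i; omega
  have := hbound (P.potential (c 0) + 1)
  omega

/-! ### The final event trace -/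

/-- An empty queue removes every exception from the invariant. Interfaces between submeshes are then
covered by the `side` clauses and `cflExt`; inside a submesh adjacent cells share their timestamps,
every one of which is a synchronization, and `cflInt` suffices. -/
lemma ConfigInv.isHistory {c : Config n M} (h : P.ConfigInv lo hi U₀ c τ T V)
    (hq : c.queue = 0) :
    IsHistory P.F P.dx P.dt P.N (fun j => T (P.owner j)) V := by
  have hinv := h.inv
  have hpush : ∀ k s m f, ¬ pushIn c.queue τ k s m f := by simp [pushIn, hq]
  have hupd : ∀ k t, ¬ updIn c.queue k t := by simp [updIn, hq]
  have hforced : ∀ k s, ¬ Forced (fun _ => False) (pushIn c.queue τ) k s := by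
    rintro k s (h' | ⟨m, h'⟩)
    · exact h'
    · exact hpush _ _ _ _ h'
  have hfloor : ∀ k, (c.sub k).tFloor = τ := by
    intro k
    by_contra hne
    exact hupd k _ ((hinv.awake k (lt_of_le_of_ne (hinv.floor_le_now k) hne)).resolve_left id)
  -- Before the final time `ceil_ok` would supply a scheduled update or an expected push; any one
  -- submesh suffices for the contradiction.
  have hN : τ = P.N := by
    by_contra hne
    rcases hinv.ceil_ok 0 (hfloor 0) (lt_of_le_of_ne h.now_le hne) with h' | ⟨s, ⟨m, f, h'⟩ | h'⟩
    · exact hupd _ _ h'.2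
    · exact hpush _ _ _ _ h'
    · exact hforced _ _ h'.1
  subst hN
  have hin : ∀ j, j ≠ P.last (P.owner j) → P.owner (j + 1) = P.owner j := fun j hj =>
    P.owner_eq (P.add_one_mem (P.mem_cells_owner j) hj)
  have hlast : ∀ j, j = P.last (P.owner j) → P.owner (j + 1) = P.owner j + 1 := fun j hj => by
    have h1 : j + 1 = P.first (P.owner j + 1) := by rw [← P.last_add_one, ← hj]
    rw [h1, P.owner_eq (P.first_mem _)]
  exact
  { zero_mem := fun j => hinv.zero_mem _
    last_mem := fun j => (hinv.floor_eq_iff _).1 (hfloor _)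
    le_last := fun j => hinv.le_now _
    const := fun j => hinv.const _ j (P.mem_cells_owner j)
    euler := fun j => hinv.euler _ j (P.mem_cells_owner j)
    ordered := by
      intro j p hp q hq
      by_cases hj : j = P.last (P.owner j)
      · rw [hlast j hj] at hq ⊢
        rcases (hinv.side (P.owner j) .right).ordered p hp q hq with ⟨r, h1, h2, h3⟩ | h' | h'
        · exact ⟨r, ⟨h1, h2⟩, h3⟩
        · exact absurd h'.2 (hforced _ _)
        · exact absurd h'.2 (hforced _ _)
      · rw [hin j hj]
        exact ⟨p, ⟨hp, hp⟩, min_le_left _ _, le_max_left _ _⟩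
    cflD := by
      intro j t σ b hσ hb
      by_cases hj : j = P.last (P.owner j)
      · rw [hlast j hj] at hσ
        have := hinv.cflExt (P.owner j) .right t σ b hσ hb
        rwa [extV, ← hj] at this
      · rw [hin j hj, Set.inter_self] at hσ
        exact (hinv.cflInt _ j (P.mem_cells_owner j) t σ b hσ hb).2
    cflC := by
      intro j t σ b hσ hb
      by_cases hj : j = P.last (P.owner j)
      · have h1 : j + 1 = P.first (P.owner j + 1) := by rw [← P.last_add_one, ← hj]
        rw [hlast j hj] at hσ hb
        have := hinv.cflExt (P.owner j + 1) .left t σ b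
          (by rwa [neigh, add_sub_cancel_right, Set.inter_comm]) hb
        rwa [extV, ← h1] at this
      · rw [hin j hj] at hb
        rw [hin j hj, Set.inter_self] at hσ
        exact (hinv.cflInt _ (j + 1) (P.add_one_mem (P.mem_cells_owner j) hj) t σ b hσ hb).1 }

end Sim

end LocalTimestepping

end

/-! ### The main theorem -/

theorem theorem3 {n M : ℕ} [NeZero n] [NeZero M] (hM : 2 ≤ M)
    (f : ℝ → ℝ) (u₀ : UnitAddCircle → ℝ) (hu₀ : MemLp u₀ ⊤ volume)
    (P : LocalTimestepping.Sim n M)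
    (hF : LocalTimestepping.IsNumericalFlux f P.F)
    (hdt : 0 < P.dt)
    (hmin : ENNReal.ofReal P.dt < ⨅ ξ ∈ LocalTimestepping.dataRange u₀,
      ENNReal.ofReal P.minDx /
        (2 * max (LocalTimestepping.lipConst (fun v => P.F v ξ) (LocalTimestepping.dataRange u₀))
          (LocalTimestepping.lipConst (fun v => P.F ξ v) (LocalTimestepping.dataRange u₀)))) :
    -- whatever the order of simultaneous events, the simulation terminates,
    (¬ ∃ c : ℕ → LocalTimestepping.Config n M,
      c 0 = P.initConfig (P.cellAvg u₀) ∧ ∀ i, P.Step (c i) (c (i + 1))) ∧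
    -- and once no event is left, the event trace has the claimed properties
    ∀ c : LocalTimestepping.Config n M,
      Relation.ReflTransGen P.Step (P.initConfig (P.cellAvg u₀)) c → c.queue = 0 →
        c.trace.IsTraceOn P.tEnd (P.cellAvg u₀) ∧
        c.trace.LocallyOrdered P.tEnd ∧
        c.trace.SatisfiesCFL P.F P.dx P.tEnd ∧
        c.trace.IsForwardEuler P.F P.dx ∧
        c.trace.IsTVD P.tEnd := by
  have hP : P.Admissible f (essInf u₀ volume) (essSup u₀ volume) :=
    ⟨hM, hF, hdt, LocalTimestepping.halfCFL_of_lt_iInf hdt P.minDx_pos hmin⟩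
  have hU₀ : ∀ j, P.cellAvg u₀ j ∈ Set.Icc (essInf u₀ volume) (essSup u₀ volume) :=
    LocalTimestepping.cellAvg_mem_dataRange P.toMesh hu₀
  refine ⟨LocalTimestepping.Sim.not_exists_infinite_run hP hU₀, fun c hc hq => ?_⟩
  obtain ⟨τ, T, V, h⟩ := LocalTimestepping.Sim.exists_configInv_of_reachable hP hU₀ hc
  have hh := h.isHistory hq
  rw [h.trace, ← h.inv.init]
  exact ⟨hh.isTraceOn hdt, hh.locallyOrdered hdt, hh.satisfiesCFL hdt, hh.isForwardEuler hdt,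
    hh.isTVD hF P.dx_pos hdt⟩
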